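/- **Setting.** Let $U\subseteq\mathbb R^4$ be open, with coordinates $(x^a)_{a=0,\dots,3}=(t,x^1,x^2,x^3)$, and let $(g_\varepsilon)_{0<\varepsilon\le1}$ be a family of smooth Lorentzian metrics on $U$ of signature $(-,+,+,+)$, with components $g^\varepsilon_{ab}$, inverse $g_\varepsilon^{ab}$ and Levi-Civita connection $\nabla^\varepsilon$. Put $\xi_a:=-(dt)_a$, $\xi_\varepsilon^a:=g_\varepsilon^{ab}\xi_b$, $V_\varepsilon:=\sqrt{-g_\varepsilon(\xi_\varepsilon,\xi_\varepsilon)}$, $\hat\xi_\varepsilon:=\xi_\varepsilon/V_\varepsilon$, $\hat\xi^\varepsilon_a:=g^\varepsilon_{ab}\hat\xi_\varepsilon^b$, and let $e_\varepsilon^{ab}$ be the inverse of the Riemannian metric $e^\varepsilon_{ab}:=g^\varepsilon_{ab}+2\hat\xi^\varepsilon_a\hat\xi^\varepsilon_b$. Assume: * there is $M_0>0$ with $g_\varepsilon^{-1}(dt,dt)\le -1/M_0^2$ on $U$ for all small $\varepsilon$; * (A) for every compact $K\subset U$ and every $k\ge0$, all partial derivatives of order $k$ of the components $g^\varepsilon_{ab}$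 and $g_\varepsilon^{ab}$ are $O(\varepsilon^{-k})$ uniformly on $K$ as $\varepsilon\to0$; * (B) for every compact $K\subset U$, the components of $\nabla^\varepsilon\xi_\varepsilon$ are $O(1)$ uniformly on $K$ as $\varepsilon\to0$. Let $\Omega$ be open with compact closure $\overline\Omega\subset U$, and suppose that the part of the boundary of $\Omega\cap\{t\ge0\}$ outside $\Omega$ is a space-like hypersurface with future-directed outward side: there is a $C^1$ function $\rho$ on $U$ with $\Omega\cap\{t\ge0\}=\{\rho<0,\ t\ge0\}$ such that, for all small $\varepsilon$, $g_\varepsilon^{-1}(d\rho,d\rho)<0$ and $d\rho(\xi_\varepsilon)>0$ at every point of $\overline{\Omega\cap\{t\ge0\}}\setminus\Omega$. For $\tau\ge0$ let $S_\tau:=\Omega\cap\{t=\tau\}$ and $\Omega_\tau:=\Omega\cap\{0<t<\tau\}$. Let $\mu^\varepsilon=|\det g_\varepsilon|^{1/2}dt\,dx^1dx^2dx^3$, and let $\mu^\varepsilon_\tau=|\det g_\varepsilon|^{1/2}dx^1dx^2dx^3$ be the form on $S_\tau$ with $dt\wedge\mu^\varepsilon_\tau=\mu^\varepsilon$. For smooth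 $u$ on $U$ put $$|\nabla_\varepsilon^{(j)}u|^2:=e_\varepsilon^{p_1q_1}\cdots e_\varepsilon^{p_jq_j}\,(\nabla^\varepsilon_{p_1}\cdots\nabla^\varepsilon_{p_j}u)(\nabla^\varepsilon_{q_1}\cdots\nabla^\varepsilon_{q_j}u),\qquad \|u\|_{k,\Omega_\tau,\varepsilon}:=\Big(\sum_{j=0}^k\int_{\Omega_\tau}|\nabla_\varepsilon^{(j)}u|^2\mu^\varepsilon\Big)^{1/2},$$ $$T^{ab,0}_\varepsilon(u):=-\tfrac12g_\varepsilon^{ab}u^2,$$ $$T^{ab,k}_\varepsilon(u):=\big(g_\varepsilon^{ac}g_\varepsilon^{bd}-\tfrac12g_\varepsilon^{ab}g_\varepsilon^{cd}\big)e_\varepsilon^{p_1q_1}\cdots e_\varepsilon^{p_{k-1}q_{k-1}}(\nabla^\varepsilon_c\nabla^\varepsilon_{p_1}\cdots\nabla^\varepsilon_{p_{k-1}}u)(\nabla^\varepsilon_d\nabla^\varepsilon_{q_1}\cdots\nabla^\varepsilon_{q_{k-1}}u)\quad(k\ge1),$$ $$E^k_{\tau,\varepsilon}(u):=\sum_{j=0}^k\int_{S_\tau}T^{ab,j}_\varepsilon(u)\,\xi_a\hat\xi^\varepsilon_b\,\mu^\varepsilon_\tau,\qquad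 \Box^\varepsilon u:=|\det g_\varepsilon|^{-1/2}\partial_a\big(|\det g_\varepsilon|^{1/2}g_\varepsilon^{ab}\partial_bu\big).$$ **Proposition.** Let $\gamma>0$. For each $k\ge1$ there exist positive constants $C_k',C_k'',C_k'''$ and $\varepsilon_0\in(0,1]$ such that for all $0<\varepsilon<\varepsilon_0$, all smooth functions $u_\varepsilon,f_\varepsilon$ on $U$ with $\Box^\varepsilon u_\varepsilon=f_\varepsilon$ on $U$, and all $0\le\tau\le\gamma$, $$E^k_{\tau,\varepsilon}(u_\varepsilon)\le E^k_{0,\varepsilon}(u_\varepsilon)+C_k'\,\|f_\varepsilon\|_{k-1,\Omega_\tau,\varepsilon}^2+C_k''\sum_{j=1}^{k-1}\frac1{\varepsilon^{2(1+k-j)}}\int_0^\tau E^j_{\zeta,\varepsilon}(u_\varepsilon)\,d\zeta+C_k'''\int_0^\tau E^k_{\zeta,\varepsilon}(u_\varepsilon)\,d\zeta .$$ In particular the constants do not depend on $\varepsilon$, $\tau$, $u_\varepsilon$ or $f_\varepsilon$. -/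

import Mathlib

open scoped ContDiff Topology BigOperators

namespace SingularWave

noncomputable section

/-- Coordinate space `ℝ⁴` with coordinates `(x⁰, x¹, x², x³) = (t, x¹, x², x³)`. -/
abbrev Pt : Type := Fin 4 → ℝ

/-- The component matrix `(g_{ab}(x))` of a `(0,2)`-tensor field in the coordinates. -/
abbrev MetricField : Type := Pt → Matrix (Fin 4) (Fin 4) ℝ

/-- The partial derivative `∂_a f`. -/
def pd (a : Fin 4) (f : Pt → ℝ) (x : Pt) : ℝ := fderiv ℝ f x (Pi.single a 1)

/-- Iterated partial derivatives `∂_{a₁} ⋯ ∂_{a_k} f`. -/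
def iterPd : List (Fin 4) → (Pt → ℝ) → Pt → ℝ
  | [], f => f
  | a :: l, f => pd a (iterPd l f)

/-- A symmetric matrix of signature `(-,+,+,+)`. -/
def IsLorentzian (A : Matrix (Fin 4) (Fin 4) ℝ) : Prop :=
  A.IsSymm ∧ ∃ P : Matrix (Fin 4) (Fin 4) ℝ,
    IsUnit P.det ∧ P.transpose * A * P = Matrix.diagonal ![-1, 1, 1, 1]

/-- The Christoffel symbols `Γ^c_{ab}` of the metric `g`. -/
def christoffel (g : MetricField) (x : Pt) (c a b : Fin 4) : ℝ :=
  (1 / 2 : ℝ) * ∑ d : Fin 4, (g x)⁻¹ c d *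
    (pd a (fun y => g y b d) x + pd b (fun y => g y a d) x - pd d (fun y => g y a b) x)

/-- The covariant derivative `∇_a T_{p₁ … p_k}` of a covariant tensor field; the index of the
derivative is the first one. -/
def covDeriv (g : MetricField) {k : ℕ} (T : Pt → (Fin k → Fin 4) → ℝ) (x : Pt)
    (I : Fin (k + 1) → Fin 4) : ℝ :=
  pd (I 0) (fun y => T y (Fin.tail I)) x
    - ∑ i : Fin k, ∑ c : Fin 4,
        christoffel g x c (I 0) (I i.succ) * T x (Function.update (Fin.tail I) i c)

/-- The iterated covariant derivative `∇_{p₁} ⋯ ∇_{p_k} u` of a function. -/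
def iterCov (g : MetricField) (u : Pt → ℝ) : (k : ℕ) → Pt → (Fin k → Fin 4) → ℝ
  | 0 => fun x _ => u x
  | k + 1 => covDeriv g (iterCov g u k)

/-- `|det g|^{1/2}`, the density of the volume form of `g` with respect to `dx⁰dx¹dx²dx³`. -/
def volDensity (g : MetricField) (x : Pt) : ℝ := Real.sqrt |(g x).det|

/-- The d'Alembertian `□u = |g|^{-1/2} ∂_a (|g|^{1/2} g^{ab} ∂_b u)`. -/
def box (g : MetricField) (u : Pt → ℝ) (x : Pt) : ℝ :=
  (volDensity g x)⁻¹ * ∑ a : Fin 4,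
    pd a (fun y => volDensity g y * ∑ b : Fin 4, (g y)⁻¹ a b * pd b u y) x

/-- The components `ξ_a` of the conormal `σ = -dt` of the level sets of `t = x⁰`. -/
def xiLow (a : Fin 4) : ℝ := if a = 0 then -1 else 0

/-- The normal vector field `ξ^a`, given by `σ = g(ξ, ·)`. -/
def xi (g : MetricField) (x : Pt) (a : Fin 4) : ℝ := ∑ b : Fin 4, (g x)⁻¹ a b * xiLow b

/-- `V = (-g(ξ, ξ))^{1/2}`. -/
def V (g : MetricField) (x : Pt) : ℝ :=
  Real.sqrt (-∑ a : Fin 4, ∑ b : Fin 4, g x a b * xi g x a * xi g x b)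

/-- The normalised normal vector field `ξ̂^a = ξ^a / V`. -/
def xiHat (g : MetricField) (x : Pt) (a : Fin 4) : ℝ := xi g x a / V g x

/-- The normalised conormal `ξ̂_a = g_{ab} ξ̂^b`. -/
def xiHatLow (g : MetricField) (x : Pt) (a : Fin 4) : ℝ := ∑ b : Fin 4, g x a b * xiHat g x b

/-- The covariant derivative `∇_a ξ^b` of the normal vector field. -/
def covXi (g : MetricField) (x : Pt) (a b : Fin 4) : ℝ :=
  pd a (fun y => xi g y b) x + ∑ c : Fin 4, christoffel g x b a c * xi g x c

/-- The Riemannian metric `e_{ab} = g_{ab} + 2 ξ̂_a ξ̂_b`. -/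
def riem (g : MetricField) : MetricField := fun x =>
  Matrix.of fun a b => g x a b + 2 * xiHatLow g x a * xiHatLow g x b

/-- `e^{p₁q₁} ⋯ e^{p_kq_k}`, where `e^{pq}` is the inverse of the Riemannian metric. -/
def riemInvProd (g : MetricField) {k : ℕ} (x : Pt) (I J : Fin k → Fin 4) : ℝ :=
  ∏ i : Fin k, (riem g x)⁻¹ (I i) (J i)

/-- The square of the pointwise norm,
`|∇^{(j)}u|² = e^{p₁q₁} ⋯ e^{p_jq_j} (∇_{p₁} ⋯ ∇_{p_j} u) (∇_{q₁} ⋯ ∇_{q_j} u)`. -/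
def normCovSq (g : MetricField) (u : Pt → ℝ) (j : ℕ) (x : Pt) : ℝ :=
  ∑ I : Fin j → Fin 4, ∑ J : Fin j → Fin 4,
    riemInvProd g x I J * iterCov g u j x I * iterCov g u j x J

/-- The energy momentum tensors `T^{ab,k}(u)`. -/
def energyTensor (g : MetricField) (u : Pt → ℝ) : ℕ → Pt → Fin 4 → Fin 4 → ℝ
  | 0 => fun x a b => -(1 / 2 : ℝ) * (g x)⁻¹ a b * u x ^ 2
  | k + 1 => fun x a b =>
      ∑ c : Fin 4, ∑ d : Fin 4, ∑ I : Fin k → Fin 4, ∑ J : Fin k → Fin 4,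
        ((g x)⁻¹ a c * (g x)⁻¹ b d - (1 / 2 : ℝ) * (g x)⁻¹ a b * (g x)⁻¹ c d)
          * riemInvProd g x I J
          * iterCov g u (k + 1) x (Fin.cons c I) * iterCov g u (k + 1) x (Fin.cons d J)

/-- The point with `t = τ` and spatial coordinates `y`. -/
def atTime (τ : ℝ) (y : Fin 3 → ℝ) : Pt := Fin.cons τ y

/-- `S_τ = {t = τ} ∩ Ω` in the spatial coordinates. -/
def slice (Ω : Set Pt) (τ : ℝ) : Set (Fin 3 → ℝ) := {y | atTime τ y ∈ Ω}

/-- `Ω_τ`, the open part of `Ω` between `{t = 0}` and `{t = τ}`. -/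
def slab (Ω : Set Pt) (τ : ℝ) : Set Pt := {x | x ∈ Ω ∧ 0 < x 0 ∧ x 0 < τ}

/-- The energy integral `E^k_τ(u) = ∑_{j ≤ k} ∫_{S_τ} T^{ab,j}(u) ξ_a ξ̂_b μ_τ`. The form `μ_τ` with
`dt ∧ μ_τ = μ` is `|det g|^{1/2} dx¹dx²dx³`. -/
def energy (g : MetricField) (Ω : Set Pt) (k : ℕ) (τ : ℝ) (u : Pt → ℝ) : ℝ :=
  ∑ j ∈ Finset.range (k + 1), ∫ y in slice Ω τ,
    (∑ a : Fin 4, ∑ b : Fin 4,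
      energyTensor g u j (atTime τ y) a b * xiLow a * xiHatLow g (atTime τ y) b)
      * volDensity g (atTime τ y)

/-- The Sobolev norm of order `k` on `Ω_τ` with respect to the covariant derivative of `g`, the
Riemannian metric `e` and the volume form of `g`. -/
def sobolevNorm (g : MetricField) (Ω : Set Pt) (k : ℕ) (τ : ℝ) (u : Pt → ℝ) : ℝ :=
  Real.sqrt (∑ j ∈ Finset.range (k + 1), ∫ x in slab Ω τ, normCovSq g u j x * volDensity g x)

/-- The conditions on the net of Lorentzian metrics `(g_ε)_{0 < ε ≤ 1}` on `U`: uniform spacelikeness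
of the level sets of `t`, and the two asymptotic conditions on the metric, its inverse and the
normal vector field. -/
structure IsWeaklySingular (U : Set Pt) (g : ℝ → MetricField) : Prop where
  /-- The components of every `g_ε` are smooth. -/
  smooth : ∀ ε, 0 < ε → ε ≤ 1 → ∀ a b, ContDiffOn ℝ ∞ (fun x => g ε x a b) U
  /-- Every `g_ε` is a Lorentzian metric. -/
  lorentzian : ∀ ε, 0 < ε → ε ≤ 1 → ∀ x ∈ U, IsLorentzian (g ε x)
  /-- `g_ε^{-1}(dt, dt) ≤ -1/M₀²` on `U` for small `ε`. -/
  dt_timelike : ∃ M₀ : ℝ, 0 < M₀ ∧ ∀ᶠ ε in 𝓝[>] (0 : ℝ), ∀ x ∈ U,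
    (g ε x)⁻¹ 0 0 ≤ -1 / M₀ ^ 2
  /-- Derivatives of order `k` of the components of `g_ε` are `O(ε^{-k})` on compact sets. -/
  bound : ∀ K : Set Pt, IsCompact K → K ⊆ U → ∀ l : List (Fin 4), ∃ C : ℝ,
    ∀ᶠ ε in 𝓝[>] (0 : ℝ), ∀ x ∈ K, ∀ a b,
      |iterPd l (fun y => g ε y a b) x| ≤ C / ε ^ l.length
  /-- Derivatives of order `k` of the components of `g_ε^{-1}` are `O(ε^{-k})` on compact sets. -/
  bound_inv : ∀ K : Set Pt, IsCompact K → K ⊆ U → ∀ l : List (Fin 4), ∃ C : ℝ,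
    ∀ᶠ ε in 𝓝[>] (0 : ℝ), ∀ x ∈ K, ∀ a b,
      |iterPd l (fun y => (g ε y)⁻¹ a b) x| ≤ C / ε ^ l.length
  /-- `∇^ε ξ_ε` is `O(1)` on compact sets. -/
  bound_covXi : ∀ K : Set Pt, IsCompact K → K ⊆ U → ∃ C : ℝ,
    ∀ᶠ ε in 𝓝[>] (0 : ℝ), ∀ x ∈ K, ∀ a b, |covXi (g ε) x a b| ≤ C

/-- `Ω` is open and relatively compact in `U`, and the part of the boundary of `Ω ∩ {t ≥ 0}` that
does not belong to `Ω` is a spacelike hypersurface for all small `ε`, through which one leaves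
`Ω ∩ {t ≥ 0}` towards the future: it is cut out by a function `ρ`, negative inside, whose
differential (the outward conormal) is timelike and positive on the future-directed normal
vector `ξ_ε`. -/
structure IsAdmissibleRegion (U : Set Pt) (g : ℝ → MetricField) (Ω : Set Pt) : Prop where
  isOpen : IsOpen Ω
  compact_closure : IsCompact (closure Ω)
  closure_subset : closure Ω ⊆ U
  spacelike_boundary : ∃ ρ : Pt → ℝ, ContDiffOn ℝ 1 ρ U ∧
    (∀ x ∈ U, 0 ≤ x 0 → (x ∈ Ω ↔ ρ x < 0)) ∧
    ∀ᶠ ε in 𝓝[>] (0 : ℝ), ∀ x ∈ closure (Ω ∩ {y : Pt | 0 ≤ y 0}), x ∉ Ω →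
      (∑ a : Fin 4, ∑ b : Fin 4, (g ε x)⁻¹ a b * pd a ρ x * pd b ρ x) < 0 ∧
      0 < ∑ a : Fin 4, xi (g ε) x a * pd a ρ x

end

end SingularWave

open SingularWave

namespace SingularWave

noncomputable section

/-! ### Calculus of partial derivatives -/

section PartialDerivatives

variable {f h : Pt → ℝ} {x : Pt} {a b : Fin 4} {U : Set Pt}

/-! The proof is the energy method for the currents `J^a = -T^{ab,j} ξ̂_b`, with the powers of `ε`
tracked throughout. Because `ξ = -dt`, the integrand of the energy is the `t`-component of the
current, and it equals `V/2` times `|∇^{(j)}u|²` (`current_zero`). The divergence theorem on the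
slab compares the energy at time `τ` with that at time `0`: the difference is the integral of the
divergence minus the flux through the rest of the boundary. That flux is nonnegative by the dominant
energy condition (`current_flux_nonneg`) and is discarded. As the boundary is known only through
`ρ`, the current is cut off near `ρ = 0`; the derivative of the cutoff contributes a term of
favourable sign (`integral_slice_le`).

Everything then rests on the divergence of the current of order `k` (`sum_pd_current`), which has
three kinds of terms. The first come from derivatives of the coefficients. Since `∇g = 0`, they
involve only `∇ξ̂`, hence only `∇ξ`, which is `O(1)` by (B) although the Christoffel symbols are
merely `O(1/ε)`; this is why the factor in front of the energy of order `k` does not depend on `ε`.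
The second kind contains the trace `g^{ac} ∇_a ∇_c ∇^{(k-1)} u`, which is `∇^{(k-1)} f` plus the
error of commuting the d'Alembertian with covariant derivatives. The third kind contains a
commutator of two covariant derivatives applied to `∇^{(k-1)} u`.

Commutator and error are linear in `∇^{(l)} u` with `1 ≤ l ≤ k-1`; the value `l = 0` is absent
because covariant derivatives commute on functions. A derivative falling on the metric costs one
power of `1/ε`, and `k+1` derivatives are distributed in all, so the coefficient of `∇^{(l)} u` is
`O(ε^{-(k+1-l)})` (`isLower_commError`, `isLower_boxError`). The Cauchy-Schwarz inequality squares
this to the weight `ε^{-2(1+k-l)}`. The bounds on `V` and `e` convert components into energy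
densities, and Fubini's theorem converts slab integrals into time integrals of energies. -/

theorem pd_congr (hfh : f =ᶠ[𝓝 x] h) : pd a f x = pd a h x := by
  simp only [pd, hfh.fderiv_eq]

theorem pd_congr_of_isOpen (hU : IsOpen U) (hx : x ∈ U) (hfh : ∀ y ∈ U, f y = h y) :
    pd a f x = pd a h x :=
  pd_congr (Filter.eventually_of_mem (hU.mem_nhds hx) hfh)

theorem pd_of_hasFDerivAt {f' : Pt →L[ℝ] ℝ} (hf : HasFDerivAt f f' x) :
    pd a f x = f' (Pi.single a 1) := by
  simp only [pd, hf.fderiv]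

theorem pd_const (c : ℝ) : pd a (fun _ => c) x = 0 := by
  simp [pd]

theorem pd_add (hf : DifferentiableAt ℝ f x) (hh : DifferentiableAt ℝ h x) :
    pd a (fun y => f y + h y) x = pd a f x + pd a h x := by
  rw [pd_of_hasFDerivAt (hf.hasFDerivAt.fun_add hh.hasFDerivAt)]; rfl

theorem pd_sub (hf : DifferentiableAt ℝ f x) (hh : DifferentiableAt ℝ h x) :
    pd a (fun y => f y - h y) x = pd a f x - pd a h x := by
  rw [pd_of_hasFDerivAt (hf.hasFDerivAt.fun_sub hh.hasFDerivAt)]; rfl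

theorem pd_neg (hf : DifferentiableAt ℝ f x) :
    pd a (fun y => - f y) x = - pd a f x := by
  rw [pd_of_hasFDerivAt (hf.hasFDerivAt.fun_neg)]; rfl

theorem pd_mul (hf : DifferentiableAt ℝ f x) (hh : DifferentiableAt ℝ h x) :
    pd a (fun y => f y * h y) x = pd a f x * h x + f x * pd a h x := by
  rw [pd_of_hasFDerivAt (hf.hasFDerivAt.fun_mul hh.hasFDerivAt)]
  simp [pd]; ring

theorem pd_const_mul (c : ℝ) (hf : DifferentiableAt ℝ f x) :
    pd a (fun y => c * f y) x = c * pd a f x := by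
  rw [pd_mul (differentiableAt_const c) hf, pd_const]; ring

theorem pd_sum {ι : Type*} {s : Finset ι} {F : ι → Pt → ℝ}
    (hF : ∀ i ∈ s, DifferentiableAt ℝ (F i) x) :
    pd a (fun y => ∑ i ∈ s, F i y) x = ∑ i ∈ s, pd a (F i) x := by
  rw [pd_of_hasFDerivAt (HasFDerivAt.fun_sum fun i hi => (hF i hi).hasFDerivAt)]
  simp [pd]

theorem pd_prod {ι : Type*} [DecidableEq ι] {s : Finset ι} {F : ι → Pt → ℝ}
    (hF : ∀ i ∈ s, DifferentiableAt ℝ (F i) x) :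
    pd a (fun y => ∏ i ∈ s, F i y) x
      = ∑ i ∈ s, (∏ j ∈ s.erase i, F j x) * pd a (F i) x := by
  rw [pd_of_hasFDerivAt (HasFDerivAt.finsetProd fun i hi => (hF i hi).hasFDerivAt)]
  simp [pd]

theorem differentiableAt_of_smooth (hU : IsOpen U) (hf : ContDiffOn ℝ ∞ f U)
    (hx : x ∈ U) : DifferentiableAt ℝ f x :=
  (hf.contDiffAt (hU.mem_nhds hx)).differentiableAt (by simp)

theorem contDiffOn_pd (hU : IsOpen U) (hf : ContDiffOn ℝ ∞ f U) (a : Fin 4) :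
    ContDiffOn ℝ ∞ (pd a f) U :=
  (hf.fderiv_of_isOpen hU (m := ∞) (by simp)).clm_apply contDiffOn_const

theorem pd_comm (hU : IsOpen U) (hf : ContDiffOn ℝ ∞ f U) (hx : x ∈ U) (a b : Fin 4) :
    pd a (pd b f) x = pd b (pd a f) x := by
  have hs : IsSymmSndFDerivAt ℝ f x :=
    (hf.contDiffAt (hU.mem_nhds hx)).isSymmSndFDerivAt (by simp only [minSmoothness_of_isRCLikeNormedField]; exact WithTop.coe_le_coe.2 le_top)
  have hd : DifferentiableAt ℝ (fderiv ℝ f) x :=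
    ((hf.fderiv_of_isOpen hU (m := ∞) (by simp)).contDiffAt
      (hU.mem_nhds hx)).differentiableAt (by simp)
  have key : ∀ c d, pd c (pd d f) x
      = fderiv ℝ (fderiv ℝ f) x (Pi.single c 1) (Pi.single d 1) := by
    intro c d
    have := hd.hasFDerivAt.clm_apply (hasFDerivAt_const (Pi.single d (1 : ℝ) : Pt) x)
    have e : pd d f = fun y => fderiv ℝ f y (Pi.single d 1) := rfl
    rw [e, pd_of_hasFDerivAt this]
    simp
  rw [key, key, hs.eq]

end PartialDerivatives

/-! ### Smoothness and derivatives of determinants and inverses -/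

section MatrixFields

variable {U : Set Pt} {g : MetricField}

theorem contDiffOn_det {n : ℕ} {A : Pt → Matrix (Fin n) (Fin n) ℝ}
    (hA : ∀ a b, ContDiffOn ℝ ∞ (fun x => A x a b) U) :
    ContDiffOn ℝ ∞ (fun x => (A x).det) U := by
  simp only [Matrix.det_apply']
  exact ContDiffOn.sum fun σ _ => contDiffOn_const.mul (contDiffOn_prod fun i _ => hA _ _)

theorem contDiffOn_adjugate {A : MetricField}
    (hA : ∀ a b, ContDiffOn ℝ ∞ (fun x => A x a b) U) (a b : Fin 4) :
    ContDiffOn ℝ ∞ (fun x => (A x).adjugate a b) U := by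
  simp only [Matrix.adjugate_apply]
  refine contDiffOn_det fun c d => ?_
  by_cases h : c = b
  · subst h; simpa using contDiffOn_const
  · simpa [Matrix.updateRow_ne h] using hA c d

theorem contDiffOn_inv {A : MetricField}
    (hA : ∀ a b, ContDiffOn ℝ ∞ (fun x => A x a b) U) (hd : ∀ x ∈ U, (A x).det ≠ 0)
    (a b : Fin 4) : ContDiffOn ℝ ∞ (fun x => (A x)⁻¹ a b) U := by
  have : ∀ x, (A x)⁻¹ a b = ((A x).det)⁻¹ * (A x).adjugate a b := by
    intro x; simp [Matrix.inv_def]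
  simp only [this]
  exact ((contDiffOn_det hA).inv hd).mul (contDiffOn_adjugate hA a b)

/-- Jacobi's formula. -/
theorem pd_det {A : MetricField} {x : Pt} (a : Fin 4)
    (hA : ∀ b c, DifferentiableAt ℝ (fun y => A y b c) x) (hd : (A x).det ≠ 0) :
    pd a (fun y => (A y).det) x
      = (A x).det * ∑ b, ∑ c, (A x)⁻¹ b c * pd a (fun y => A y c b) x := by
  have hadj : ∀ b c, (A x).adjugate b c = (A x).det * (A x)⁻¹ b c := by
    intro b c; simp [Matrix.inv_def, hd]
  -- The product rule in the Leibniz expansion differentiates one column at a time; by Cramer's rule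
  -- the determinant with column `i` differentiated is row `i` of the adjugate applied to that
  -- derivative.
  have hcol : ∀ i : Fin 4, ((A x).updateCol i fun j => pd a (fun y => A y j i) x).det
      = ∑ c, (A x).adjugate i c * pd a (fun y => A y c i) x := by
    intro i
    rw [← Matrix.cramer_apply, Matrix.cramer_eq_adjugate_mulVec]; rfl
  rw [Finset.mul_sum]
  simp only [Finset.mul_sum, ← mul_assoc, ← hadj]
  simp only [← hcol, Matrix.det_apply']
  have hp : ∀ σ : Equiv.Perm (Fin 4), DifferentiableAt ℝ (fun y => ∏ i, A y (σ i) i) x :=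
    fun σ => (HasFDerivAt.finsetProd fun i _ => (hA (σ i) i).hasFDerivAt).differentiableAt
  rw [pd_sum (fun σ _ => (differentiableAt_const _).fun_mul (hp σ)), Finset.sum_comm]
  refine Finset.sum_congr rfl fun σ _ => ?_
  rw [pd_const_mul _ (hp σ), pd_prod (fun i _ => hA (σ i) i), Finset.mul_sum]
  refine Finset.sum_congr rfl fun i _ => ?_
  congr 1
  rw [← Finset.prod_erase_mul _ _ (Finset.mem_univ i)]
  simp only [Matrix.updateCol_self]
  congr 1
  refine Finset.prod_congr rfl fun j hj => ?_
  rw [Matrix.updateCol_ne (Finset.ne_of_mem_erase hj)]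

end MatrixFields

/-! ### Linear algebra of Lorentzian matrices -/

section LorentzAlgebra

open Matrix

variable {A : Matrix (Fin 4) (Fin 4) ℝ}

theorem IsLorentzian.det_neg (hA : IsLorentzian A) : A.det < 0 := by
  obtain ⟨-, P, hP, h⟩ := hA
  have h1 : P.det ^ 2 * A.det = -1 := by
    have := congrArg Matrix.det h
    rw [det_mul, det_mul, det_transpose, det_diagonal] at this
    simp [Fin.prod_univ_four] at this
    linarith
  have h2 : 0 < P.det ^ 2 := by have := hP.ne_zero; positivity
  by_contra hcon
  nlinarith [mul_nonneg h2.le (not_lt.1 hcon)]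

theorem IsLorentzian.isUnit_det (hA : IsLorentzian A) : IsUnit A.det :=
  isUnit_iff_ne_zero.2 hA.det_neg.ne

/-- Inverting the congruence `Pᵀ A P = D` gives `P⁻¹ A⁻¹ (P⁻¹)ᵀ = D⁻¹`, and `D = diag(-1,1,1,1)` is
its own inverse. The inverse metric is the form needed later, since the algebra is applied to
covectors. -/
theorem IsLorentzian.inv (hA : IsLorentzian A) : IsLorentzian A⁻¹ := by
  have hu := hA.isUnit_det
  obtain ⟨hs, P, hP, h⟩ := hA
  refine ⟨?_, (P⁻¹)ᵀ, ?_, ?_⟩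
  · rw [IsSymm, transpose_nonsing_inv, hs.eq]
  · rw [det_transpose]; exact isUnit_nonsing_inv_det _ hP
  · have hD : (diagonal ![(-1 : ℝ), 1, 1, 1])⁻¹ = diagonal ![-1, 1, 1, 1] := by
      apply inv_eq_right_inv
      rw [diagonal_mul_diagonal, ← diagonal_one]
      congr 1
      funext i
      fin_cases i <;> simp
    rw [← hD, ← h, Matrix.mul_inv_rev, Matrix.mul_inv_rev, transpose_transpose, transpose_nonsing_inv, mul_assoc]

theorem IsLorentzian.dotProduct_comm (hA : IsLorentzian A) (v w : Fin 4 → ℝ) :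
    v ⬝ᵥ A *ᵥ w = w ⬝ᵥ A *ᵥ v := by
  rw [dotProduct_mulVec, ← mulVec_transpose, hA.1.eq, _root_.dotProduct_comm]

/-- The orthogonal complement of a timelike vector is spacelike. -/
theorem IsLorentzian.nonneg_of_orthogonal (hA : IsLorentzian A) {n v : Fin 4 → ℝ}
    (hn : n ⬝ᵥ A *ᵥ n = -1) (hv : n ⬝ᵥ A *ᵥ v = 0) : 0 ≤ v ⬝ᵥ A *ᵥ v := by
  obtain ⟨-, P, hP, h⟩ := hA
  have key : ∀ a b : Fin 4 → ℝ, (P *ᵥ a) ⬝ᵥ A *ᵥ (P *ᵥ b)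
      = -(a 0 * b 0) + a 1 * b 1 + a 2 * b 2 + a 3 * b 3 := by
    intro a b
    have : (P *ᵥ a) ⬝ᵥ A *ᵥ (P *ᵥ b) = a ⬝ᵥ (Pᵀ * A * P) *ᵥ b := by
      rw [← mulVec_mulVec, ← mulVec_mulVec, dotProduct_mulVec a, vecMul_transpose]
    rw [this, h]
    simp [dotProduct, Fin.sum_univ_four, mulVec_diagonal]
  obtain ⟨m, rfl⟩ : ∃ m, n = P *ᵥ m := ⟨P⁻¹ *ᵥ n, by simp [mulVec_mulVec, mul_nonsing_inv _ hP]⟩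
  obtain ⟨w, rfl⟩ : ∃ w, v = P *ᵥ w := ⟨P⁻¹ *ᵥ v, by simp [mulVec_mulVec, mul_nonsing_inv _ hP]⟩
  rw [key] at hn hv ⊢
  -- In the frame `P`, with `|m|² = m₀² - 1` for the spatial part of `m`, Cauchy-Schwarz gives `m₀²
  -- w₀² ≤ (m₀² - 1)|w|² ≤ m₀² |w|²`; then the factor `m₀² > 0` is cancelled.
  have h0 : m 0 * w 0 = m 1 * w 1 + m 2 * w 2 + m 3 * w 3 := by linarith
  have h1 : m 0 ^ 2 = 1 + (m 1 ^ 2 + m 2 ^ 2 + m 3 ^ 2) := by linarith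
  have cs : (m 0 * w 0) ^ 2 ≤ (m 1 ^ 2 + m 2 ^ 2 + m 3 ^ 2) * (w 1 ^ 2 + w 2 ^ 2 + w 3 ^ 2) := by
    rw [h0]
    nlinarith [sq_nonneg (m 1 * w 2 - m 2 * w 1), sq_nonneg (m 1 * w 3 - m 3 * w 1),
      sq_nonneg (m 2 * w 3 - m 3 * w 2)]
  have h3 : 0 ≤ m 0 ^ 2 * (-(w 0 * w 0) + w 1 * w 1 + w 2 * w 2 + w 3 * w 3) := by
    have : (m 1 ^ 2 + m 2 ^ 2 + m 3 ^ 2) = m 0 ^ 2 - 1 := by linarith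
    rw [this] at cs
    nlinarith [sq_nonneg (w 1), sq_nonneg (w 2), sq_nonneg (w 3)]
  have h4 : 0 < m 0 ^ 2 := by rw [h1]; positivity
  exact nonneg_of_mul_nonneg_right h3 h4

theorem IsLorentzian.expand (hA : IsLorentzian A) (n p q : Fin 4 → ℝ) (s t : ℝ) :
    (s • p + t • q) ⬝ᵥ A *ᵥ (s • p + t • q)
      = s ^ 2 * (p ⬝ᵥ A *ᵥ p) + 2 * s * t * (p ⬝ᵥ A *ᵥ q) + t ^ 2 * (q ⬝ᵥ A *ᵥ q) ∧
    n ⬝ᵥ A *ᵥ (s • p + t • q) = s * (n ⬝ᵥ A *ᵥ p) + t * (n ⬝ᵥ A *ᵥ q) := by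
  simp only [mulVec_add, mulVec_smul, dotProduct_add, add_dotProduct, dotProduct_smul,
    smul_dotProduct, smul_eq_mul, hA.dotProduct_comm q p]
  exact ⟨by ring, trivial⟩

/-- As `n` has square `-1`, the vector `v + ⟨n,v⟩ n` is orthogonal to `n`, and the expression is its
square. -/
theorem IsLorentzian.add_sq_nonneg (hA : IsLorentzian A) {n : Fin 4 → ℝ}
    (hn : n ⬝ᵥ A *ᵥ n = -1) (v : Fin 4 → ℝ) : 0 ≤ v ⬝ᵥ A *ᵥ v + (n ⬝ᵥ A *ᵥ v) ^ 2 := by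
  have h := hA.nonneg_of_orthogonal (v := (1 : ℝ) • v + (n ⬝ᵥ A *ᵥ v) • n) hn (by
    rw [(hA.expand n v n _ _).2, hn]; ring)
  rw [(hA.expand n v n _ _).1, hn, hA.dotProduct_comm v n] at h
  nlinarith

/-- The reversed Cauchy-Schwarz argument: a Cauchy-Schwarz inequality for the components
orthogonal to `n`. -/
theorem IsLorentzian.cauchy_schwarz (hA : IsLorentzian A) {n : Fin 4 → ℝ}
    (hn : n ⬝ᵥ A *ᵥ n = -1) (p q : Fin 4 → ℝ) :
    (p ⬝ᵥ A *ᵥ q + (n ⬝ᵥ A *ᵥ p) * (n ⬝ᵥ A *ᵥ q)) ^ 2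
      ≤ (p ⬝ᵥ A *ᵥ p + (n ⬝ᵥ A *ᵥ p) ^ 2) * (q ⬝ᵥ A *ᵥ q + (n ⬝ᵥ A *ᵥ q) ^ 2) := by
  -- The form `v ↦ ⟨v,v⟩ + ⟨n,v⟩²` is nonnegative along `p + t q` for every `t`, so this quadratic
  -- polynomial in `t` has nonpositive discriminant.
  have h := discrim_le_zero (a := q ⬝ᵥ A *ᵥ q + (n ⬝ᵥ A *ᵥ q) ^ 2)
    (b := 2 * (p ⬝ᵥ A *ᵥ q + (n ⬝ᵥ A *ᵥ p) * (n ⬝ᵥ A *ᵥ q)))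
    (c := p ⬝ᵥ A *ᵥ p + (n ⬝ᵥ A *ᵥ p) ^ 2) fun t => by
      have := hA.add_sq_nonneg hn ((1 : ℝ) • p + t • q)
      rw [(hA.expand n p q _ _).1, (hA.expand n p q _ _).2] at this
      nlinarith
  rw [discrim] at h
  nlinarith

/-- The dominant energy condition for the energy momentum tensor of a scalar field. -/
theorem IsLorentzian.dominant_energy (hA : IsLorentzian A) {n r : Fin 4 → ℝ}
    (hn : n ⬝ᵥ A *ᵥ n = -1) (hr : r ⬝ᵥ A *ᵥ r < 0) (hrn : 0 < n ⬝ᵥ A *ᵥ r) (p : Fin 4 → ℝ) :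
    0 ≤ -((r ⬝ᵥ A *ᵥ p) * (n ⬝ᵥ A *ᵥ p)) + 1 / 2 * (n ⬝ᵥ A *ᵥ r) * (p ⬝ᵥ A *ᵥ p) := by
  have cs := hA.cauchy_schwarz hn r p
  have hQ := hA.add_sq_nonneg hn p
  have hR := hA.add_sq_nonneg hn r
  set a := n ⬝ᵥ A *ᵥ p
  set b := n ⬝ᵥ A *ᵥ r
  set s := r ⬝ᵥ A *ᵥ p
  set Q := p ⬝ᵥ A *ᵥ p
  -- `Q + a²` is the squared length of the part of `p` orthogonal to `n`; for `r` that length is at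
  -- most `b`, because `r` is timelike. The claim is `(s + b a) a ≤ b ((Q + a²) + a²)/2`:
  -- Cauchy-Schwarz for the orthogonal parts, followed by the inequality of arithmetic and geometric
  -- means.
  have h1 : (s + b * a) ^ 2 ≤ b ^ 2 * (Q + a ^ 2) :=
    cs.trans (mul_le_mul_of_nonneg_right (by linarith) hQ)
  have h2 : ((s + b * a) * a) ^ 2 ≤ (b * ((Q + a ^ 2) + a ^ 2) / 2) ^ 2 := by
    rw [mul_pow]
    nlinarith [mul_le_mul_of_nonneg_right h1 (sq_nonneg a), sq_nonneg (b * Q)]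
  have h3 := abs_le_of_sq_le_sq h2 (by positivity)
  nlinarith [le_of_abs_le h3]

end LorentzAlgebra

/-! ### Metrics for which the time coordinate is a time function -/

/-- A smooth Lorentzian metric for which `dt` is timelike. -/
structure IsTimeMetric (U : Set Pt) (g : MetricField) : Prop where
  smooth : ∀ a b, ContDiffOn ℝ ∞ (fun x => g x a b) U
  lorentzian : ∀ x ∈ U, IsLorentzian (g x)
  timelike : ∀ x ∈ U, (g x)⁻¹ 0 0 < 0

namespace IsTimeMetric

variable {U : Set Pt} {g : MetricField} {x : Pt}

section Pointwise

variable (hm : IsTimeMetric U g) (hx : x ∈ U)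
include hm hx

theorem symm (a b : Fin 4) : g x a b = g x b a := (hm.lorentzian x hx).1.apply b a

theorem inv_symm (a b : Fin 4) : (g x)⁻¹ a b = (g x)⁻¹ b a :=
  (hm.lorentzian x hx).inv.1.apply b a

theorem mul_inv_apply (a b : Fin 4) :
    ∑ c, g x a c * (g x)⁻¹ c b = if a = b then 1 else 0 := by
  have := congrFun (congrFun (Matrix.mul_nonsing_inv (g x) (hm.lorentzian x hx).isUnit_det) a) b
  rwa [Matrix.mul_apply, Matrix.one_apply] at this

theorem inv_mul_apply (a b : Fin 4) :
    ∑ c, (g x)⁻¹ a c * g x c b = if a = b then 1 else 0 := by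
  have := congrFun (congrFun (Matrix.nonsing_inv_mul (g x) (hm.lorentzian x hx).isUnit_det) a) b
  rwa [Matrix.mul_apply, Matrix.one_apply] at this

omit hm hx in
theorem xi_eq (g : MetricField) (x : Pt) (a : Fin 4) : xi g x a = -(g x)⁻¹ a 0 := by
  simp [xi, xiLow]

theorem lower_xi (a : Fin 4) : ∑ b, g x a b * xi g x b = xiLow a := by
  simp only [xi_eq, mul_neg, Finset.sum_neg_distrib, hm.mul_inv_apply hx, xiLow]
  split_ifs <;> simp

/-- Lowering the index of `ξ` returns `-dt`, so `g(ξ,ξ) = g⁻¹(dt,dt) = g^{00}`. Bounds for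
`g⁻¹(dt,dt)` are thereby bounds for `V`. -/
theorem V_eq : V g x = Real.sqrt (-(g x)⁻¹ 0 0) := by
  unfold V
  have : ∀ a, ∑ b, g x a b * xi g x a * xi g x b = xiLow a * xi g x a := by
    intro a
    rw [← hm.lower_xi hx a, Finset.sum_mul]
    exact Finset.sum_congr rfl fun b _ => by ring
  simp only [this]
  simp [xiLow, xi_eq]

theorem V_pos : 0 < V g x := by
  rw [hm.V_eq hx]
  exact Real.sqrt_pos.2 (by linarith [hm.timelike x hx])

theorem V_sq : V g x ^ 2 = -(g x)⁻¹ 0 0 := by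
  rw [hm.V_eq hx, Real.sq_sqrt (by linarith [hm.timelike x hx])]

theorem xiHatLow_eq (a : Fin 4) : xiHatLow g x a = xiLow a / V g x := by
  simp only [xiHatLow, xiHat, mul_div_assoc', ← Finset.sum_div, hm.lower_xi hx]

theorem raise_xiHatLow (a : Fin 4) : ∑ b, (g x)⁻¹ a b * xiHatLow g x b = xiHat g x a := by
  simp only [hm.xiHatLow_eq hx, mul_div_assoc', ← Finset.sum_div]
  rfl

theorem xiHatLow_xiHat : ∑ a, xiHatLow g x a * xiHat g x a = -1 := by
  have hV := (hm.V_pos hx).ne'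
  have h2 := hm.V_sq hx
  simp only [hm.xiHatLow_eq hx, xiHat]
  simp only [xiLow, Fin.sum_univ_four, xi_eq]
  simp
  field_simp
  linarith

/-- Passing from `g` to `e` reverses the sign on the line of `ξ̂`, and the same reversal of `g⁻¹`
inverts it: the cross terms `2 + 2 - 4` cancel since `ξ̂` has square `-1`. -/
theorem riem_inv (a b : Fin 4) :
    (riem g x)⁻¹ a b = (g x)⁻¹ a b + 2 * xiHat g x a * xiHat g x b := by
  have : (riem g x)⁻¹ = Matrix.of fun a b => (g x)⁻¹ a b + 2 * xiHat g x a * xiHat g x b := by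
    apply Matrix.inv_eq_right_inv
    ext a b
    rw [Matrix.mul_apply, Matrix.one_apply, ← hm.mul_inv_apply hx]
    have e : ∀ c, riem g x a c * (Matrix.of fun a b => (g x)⁻¹ a b + 2 * xiHat g x a * xiHat g x b)
          c b = g x a c * (g x)⁻¹ c b + 2 * xiHat g x b * (g x a c * xiHat g x c)
            + 2 * xiHatLow g x a * ((g x)⁻¹ b c * xiHatLow g x c)
            + 4 * xiHatLow g x a * xiHat g x b * (xiHatLow g x c * xiHat g x c) := by
      intro c
      simp only [riem, Matrix.of_apply, hm.inv_symm hx b c]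
      ring
    simp only [e, Finset.sum_add_distrib, ← Finset.mul_sum, hm.raise_xiHatLow hx,
      hm.xiHatLow_xiHat hx]
    rw [← xiHatLow]
    ring
  rw [this]; rfl

theorem riem_inv_symm (a b : Fin 4) : (riem g x)⁻¹ a b = (riem g x)⁻¹ b a := by
  rw [hm.riem_inv hx, hm.riem_inv hx, hm.inv_symm hx a b]; ring

theorem riem_inv_mul : (riem g x)⁻¹ * riem g x = 1 := by
  ext a b
  rw [Matrix.mul_apply]
  have e : ∀ c, (riem g x)⁻¹ a c * riem g x c b
        = (g x)⁻¹ a c * g x c b + 2 * xiHat g x a * (g x b c * xiHat g x c)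
          + 2 * xiHatLow g x b * ((g x)⁻¹ a c * xiHatLow g x c)
          + 4 * xiHatLow g x b * xiHat g x a * (xiHatLow g x c * xiHat g x c) := by
    intro c
    rw [hm.riem_inv hx]
    simp only [riem, Matrix.of_apply, hm.symm hx b c]
    ring
  simp only [e, Finset.sum_add_distrib, ← Finset.mul_sum, hm.raise_xiHatLow hx,
    hm.xiHatLow_xiHat hx, hm.inv_mul_apply hx]
  rw [← xiHatLow, Matrix.one_apply]
  ring

theorem dotProduct_xiHatLow (p : Fin 4 → ℝ) :
    dotProduct (xiHatLow g x) ((g x)⁻¹.mulVec p) = ∑ a, xiHat g x a * p a := by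
  rw [(hm.lorentzian x hx).inv.dotProduct_comm]
  have : (g x)⁻¹.mulVec (xiHatLow g x) = xiHat g x := by
    funext a; exact hm.raise_xiHatLow hx a
  rw [this, dotProduct]
  exact Finset.sum_congr rfl fun _ _ => mul_comm _ _

theorem xiHatLow_unit : dotProduct (xiHatLow g x) ((g x)⁻¹.mulVec (xiHatLow g x)) = -1 := by
  rw [hm.dotProduct_xiHatLow hx, ← hm.xiHatLow_xiHat hx]
  exact Finset.sum_congr rfl fun _ _ => mul_comm _ _

/-- The inverse of the Riemannian metric is a Gram matrix. -/
theorem exists_riem_inv_factor : ∃ L : Matrix (Fin 4) (Fin 4) ℝ,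
    (riem g x)⁻¹ = L.transpose * L ∧ IsUnit L.det := by
  have hpsd : ((riem g x)⁻¹).PosSemidef := by
    refine Matrix.PosSemidef.of_dotProduct_mulVec_nonneg ?_ fun v => ?_
    · ext a b
      simpa using hm.riem_inv_symm hx b a
    · have h := (hm.lorentzian x hx).inv.add_sq_nonneg (hm.xiHatLow_unit hx) v
      have hle : ((g x)⁻¹.mulVec v ⬝ᵥ v) + (xiHatLow g x ⬝ᵥ (g x)⁻¹.mulVec v) ^ 2
          + (xiHatLow g x ⬝ᵥ (g x)⁻¹.mulVec v) ^ 2 = star v ⬝ᵥ (riem g x)⁻¹.mulVec v := by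
        rw [hm.dotProduct_xiHatLow hx]
        simp only [dotProduct, Matrix.mulVec, hm.riem_inv hx, star_trivial, Fin.sum_univ_four]
        ring
      rw [← hle, dotProduct_comm]
      positivity
  open scoped MatrixOrder in
  obtain ⟨L, hL⟩ := CStarAlgebra.nonneg_iff_eq_star_mul_self.mp hpsd.nonneg
  have hL' : (riem g x)⁻¹ = L.transpose * L := by
    rw [hL, Matrix.star_eq_conjTranspose, Matrix.conjTranspose_eq_transpose_of_trivial]
  refine ⟨L, hL', ?_⟩
  -- Invertibility of `L` is read off from determinants in `e⁻¹ e = 1`.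
  have h1 := congrArg Matrix.det (hm.riem_inv_mul hx)
  rw [hL', Matrix.det_mul, Matrix.det_mul, Matrix.det_one] at h1
  rw [isUnit_iff_ne_zero]
  intro h0
  simp [h0] at h1

end Pointwise

end IsTimeMetric

/-! ### Christoffel symbols, metric compatibility and the volume density -/

namespace IsTimeMetric

variable {U : Set Pt} {g : MetricField} {x : Pt}

section Smoothness

variable (hU : IsOpen U) (hm : IsTimeMetric U g)
include hm

theorem smooth_inv (a b : Fin 4) : ContDiffOn ℝ ∞ (fun x => (g x)⁻¹ a b) U :=
  contDiffOn_inv hm.smooth (fun x hx => (hm.lorentzian x hx).det_neg.ne) a b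

theorem smooth_volDensity : ContDiffOn ℝ ∞ (volDensity g) U := by
  have h : ContDiffOn ℝ ∞ (fun x => Real.sqrt (-(g x).det)) U :=
    (contDiffOn_det hm.smooth).neg.sqrt fun x hx => by linarith [(hm.lorentzian x hx).det_neg]
  refine h.congr fun x hx => ?_
  rw [volDensity, abs_of_neg (hm.lorentzian x hx).det_neg]

theorem volDensity_pos (hx : x ∈ U) : 0 < volDensity g x :=
  Real.sqrt_pos.2 (abs_pos.2 (hm.lorentzian x hx).det_neg.ne)

theorem volDensity_sq (hx : x ∈ U) : volDensity g x ^ 2 = -(g x).det := by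
  rw [volDensity, Real.sq_sqrt (abs_nonneg _), abs_of_neg (hm.lorentzian x hx).det_neg]

theorem smooth_xi (a : Fin 4) : ContDiffOn ℝ ∞ (fun x => xi g x a) U := by
  simp only [xi_eq]; exact (hm.smooth_inv a 0).neg

theorem smooth_V : ContDiffOn ℝ ∞ (V g) U := by
  have h : ContDiffOn ℝ ∞ (fun x => Real.sqrt (-(g x)⁻¹ 0 0)) U :=
    (hm.smooth_inv 0 0).neg.sqrt fun x hx => by linarith [hm.timelike x hx]
  exact h.congr fun x hx => hm.V_eq hx

theorem smooth_xiHat (a : Fin 4) : ContDiffOn ℝ ∞ (fun x => xiHat g x a) U :=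
  (hm.smooth_xi a).div hm.smooth_V fun _ hx => (hm.V_pos hx).ne'

theorem smooth_riem_inv (a b : Fin 4) : ContDiffOn ℝ ∞ (fun x => (riem g x)⁻¹ a b) U :=
  ((hm.smooth_inv a b).add ((contDiffOn_const.mul (hm.smooth_xiHat a)).mul
    (hm.smooth_xiHat b))).congr fun _ hx => hm.riem_inv hx a b

include hU

theorem smooth_christoffel (c a b : Fin 4) :
    ContDiffOn ℝ ∞ (fun x => christoffel g x c a b) U := by
  unfold christoffel
  refine contDiffOn_const.mul (ContDiffOn.sum fun d _ => (hm.smooth_inv c d).mul ?_)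
  exact ((contDiffOn_pd hU (hm.smooth b d) a).add (contDiffOn_pd hU (hm.smooth a d) b)).sub
    (contDiffOn_pd hU (hm.smooth a b) d)

end Smoothness

section Identities

variable (hU : IsOpen U) (hm : IsTimeMetric U g) (hx : x ∈ U)
include hU hm hx

theorem pd_symm (a b c : Fin 4) : pd a (fun y => g y b c) x = pd a (fun y => g y c b) x :=
  pd_congr_of_isOpen hU hx fun _ hy => hm.symm hy b c

theorem christoffel_symm (c a b : Fin 4) : christoffel g x c a b = christoffel g x c b a := by
  unfold christoffel
  congr 1
  refine Finset.sum_congr rfl fun d _ => ?_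
  rw [hm.pd_symm hU hx d a b]; ring

omit hU in
theorem lower_christoffel (a b c : Fin 4) :
    ∑ d, g x c d * christoffel g x d a b = 1 / 2 * (pd a (fun y => g y b c) x
      + pd b (fun y => g y a c) x - pd c (fun y => g y a b) x) := by
  unfold christoffel
  simp only [Finset.mul_sum]
  rw [Finset.sum_comm]
  have : ∀ e, ∑ d, g x c d * (1 / 2 * ((g x)⁻¹ d e * (pd a (fun y => g y b e) x
      + pd b (fun y => g y a e) x - pd e (fun y => g y a b) x)))
      = (if c = e then 1 else 0) * (1 / 2 * (pd a (fun y => g y b e) x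
      + pd b (fun y => g y a e) x - pd e (fun y => g y a b) x)) := by
    intro e
    rw [← hm.mul_inv_apply hx, Finset.sum_mul]
    exact Finset.sum_congr rfl fun _ _ => by ring
  simp only [this]
  simp

/-- The Levi-Civita connection is compatible with the metric. -/
theorem pd_metric (a b c : Fin 4) : pd a (fun y => g y b c) x
    = (∑ d, g x c d * christoffel g x d a b) + ∑ d, g x b d * christoffel g x d a c := by
  rw [hm.lower_christoffel hx, hm.lower_christoffel hx, hm.pd_symm hU hx a c b,
    hm.pd_symm hU hx b a c, hm.pd_symm hU hx c a b, hm.pd_symm hU hx b c a]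
  ring

/-- The Levi-Civita connection is compatible with the inverse metric. -/
theorem pd_inv (a b c : Fin 4) : pd a (fun y => (g y)⁻¹ b c) x
    = -(∑ d, christoffel g x b a d * (g x)⁻¹ d c) - ∑ d, christoffel g x c a d * (g x)⁻¹ b d := by
  have d1 : ∀ b c, DifferentiableAt ℝ (fun y => g y b c) x :=
    fun b c => differentiableAt_of_smooth hU (hm.smooth b c) hx
  have d2 : ∀ b c, DifferentiableAt ℝ (fun y => (g y)⁻¹ b c) x :=
    fun b c => differentiableAt_of_smooth hU (hm.smooth_inv b c) hx
  have e0 : ∀ p q, ∑ c, (pd a (fun y => g y p c) x * (g x)⁻¹ c q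
      + g x p c * pd a (fun y => (g y)⁻¹ c q) x) = 0 := by
    intro p q
    have h1 : pd a (fun y => ∑ c, g y p c * (g y)⁻¹ c q) x = 0 := by
      rw [pd_congr_of_isOpen hU hx (h := fun _ => if p = q then 1 else 0)
        fun y hy => hm.mul_inv_apply hy p q, pd_const]
    rw [pd_sum fun i _ => (d1 _ _).fun_mul (d2 _ _)] at h1
    rw [← h1]
    exact Finset.sum_congr rfl fun i _ => (pd_mul (d1 _ _) (d2 _ _)).symm
  -- With `D = ∂_a g`, `E = ∂_a g⁻¹` and `Γ = (Γ^p_{aq})`, differentiating `g g⁻¹ = 1` gives `D g⁻¹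
  -- + g E = 0`, and compatibility gives `D = Γᵀ g + g Γ`; these are solved for `E`.
  let D : Matrix (Fin 4) (Fin 4) ℝ := Matrix.of fun p q => pd a (fun y => g y p q) x
  let E : Matrix (Fin 4) (Fin 4) ℝ := Matrix.of fun p q => pd a (fun y => (g y)⁻¹ p q) x
  let Γ : Matrix (Fin 4) (Fin 4) ℝ := Matrix.of fun p q => christoffel g x p a q
  have hu := (hm.lorentzian x hx).isUnit_det
  have hs : (g x).transpose = g x := (hm.lorentzian x hx).1
  have m1 : D * (g x)⁻¹ + g x * E = 0 := by
    ext p q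
    have := e0 p q
    rw [Finset.sum_add_distrib] at this
    rw [Matrix.add_apply, Matrix.mul_apply, Matrix.mul_apply]
    exact this
  have m2 : D = Γ.transpose * g x + g x * Γ := by
    ext p q
    rw [Matrix.add_apply, Matrix.mul_apply, Matrix.mul_apply]
    refine (hm.pd_metric hU hx a p q).trans ?_
    congr 1
    refine Finset.sum_congr rfl fun d _ => ?_
    rw [hm.symm hx q d, mul_comm]; rfl
  have m3 : E = -((g x)⁻¹ * Γ.transpose) - Γ * (g x)⁻¹ := by
    have : g x * E = -(D * (g x)⁻¹) := eq_neg_of_add_eq_zero_right m1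
    have h3 : E = (g x)⁻¹ * (g x * E) := by
      rw [← Matrix.mul_assoc, Matrix.nonsing_inv_mul _ hu, Matrix.one_mul]
    rw [h3, this, m2, Matrix.add_mul, Matrix.mul_assoc, Matrix.mul_nonsing_inv _ hu,
      Matrix.mul_one, neg_add, Matrix.mul_add, Matrix.mul_neg, Matrix.mul_neg, Matrix.mul_assoc,
      ← Matrix.mul_assoc, Matrix.nonsing_inv_mul _ hu, Matrix.one_mul, sub_eq_add_neg]
  have m4 := congrFun (congrFun m3 b) c
  refine m4.trans ?_
  rw [Matrix.sub_apply, Matrix.neg_apply, Matrix.mul_apply, Matrix.mul_apply]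
  have : ∑ j, (g x)⁻¹ b j * Γ.transpose j c = ∑ d, christoffel g x c a d * (g x)⁻¹ b d :=
    Finset.sum_congr rfl fun d _ => mul_comm _ _
  rw [this]
  have h5 : ∑ j, Γ b j * (g x)⁻¹ j c = ∑ d, christoffel g x b a d * (g x)⁻¹ d c := rfl
  rw [h5]; ring

/-- The logarithmic derivative of the volume density is the trace of the connection. -/
theorem pd_volDensity (a : Fin 4) :
    pd a (volDensity g) x = volDensity g x * ∑ b, christoffel g x b b a := by
  have d1 : ∀ b c, DifferentiableAt ℝ (fun y => g y b c) x :=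
    fun b c => differentiableAt_of_smooth hU (hm.smooth b c) hx
  have dv := differentiableAt_of_smooth hU hm.smooth_volDensity hx
  have hv := (hm.volDensity_pos hx).ne'
  -- Differentiating the square of the density, which is `-det g`, avoids the derivative of the
  -- square root and reduces the claim to Jacobi's formula.
  have h1 : pd a (fun y => volDensity g y * volDensity g y) x
      = pd a (fun y => -(g y).det) x :=
    pd_congr_of_isOpen hU hx fun y hy => by rw [← sq, hm.volDensity_sq hy]
  rw [pd_mul dv dv, pd_neg (differentiableAt_of_smooth hU (contDiffOn_det hm.smooth) hx),
    pd_det a d1 (hm.lorentzian x hx).det_neg.ne, ← neg_mul, ← hm.volDensity_sq hx] at h1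
  have h2 : ∑ b, ∑ c, (g x)⁻¹ b c * pd a (fun y => g y c b) x
      = 2 * ∑ b, christoffel g x b b a := by
    unfold christoffel
    -- The two remaining derivatives of the metric are antisymmetric in `b, d` and vanish against
    -- the symmetric `g^{bd}`.
    have s1 : ∑ b, ∑ d, (g x)⁻¹ b d * (pd b (fun y => g y a d) x - pd d (fun y => g y b a) x)
        = 0 := by
      have : ∑ b, ∑ d, (g x)⁻¹ b d * pd d (fun y => g y b a) x
          = ∑ b, ∑ d, (g x)⁻¹ b d * pd b (fun y => g y a d) x := by
        rw [Finset.sum_comm]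
        refine Finset.sum_congr rfl fun b _ => Finset.sum_congr rfl fun d _ => ?_
        rw [hm.inv_symm hx d b, hm.pd_symm hU hx b d a]
      simp only [mul_sub, Finset.sum_sub_distrib, this, sub_self]
    have s2 : ∀ b, ∑ d, (g x)⁻¹ b d * (pd b (fun y => g y a d) x + pd a (fun y => g y b d) x
          - pd d (fun y => g y b a) x) = (∑ d, (g x)⁻¹ b d * pd a (fun y => g y d b) x)
          + ∑ d, (g x)⁻¹ b d * (pd b (fun y => g y a d) x - pd d (fun y => g y b a) x) := by
      intro b
      rw [← Finset.sum_add_distrib]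
      refine Finset.sum_congr rfl fun d _ => ?_
      rw [hm.pd_symm hU hx a d b]; ring
    simp only [s2, ← Finset.mul_sum, Finset.sum_add_distrib, s1]
    ring
  rw [h2] at h1
  have h3 : volDensity g x * (pd a (volDensity g) x)
      = volDensity g x * (volDensity g x * ∑ b, christoffel g x b b a) := by linarith
  exact mul_left_cancel₀ hv h3

/-- The divergence of the weighted vector field `|g|^{1/2} X` in terms of the connection. -/
theorem sum_pd_volDensity_mul {X : Fin 4 → Pt → ℝ} (hX : ∀ a, DifferentiableAt ℝ (X a) x) :
    ∑ a, pd a (fun y => volDensity g y * X a y) x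
      = volDensity g x * ∑ a, (pd a (X a) x + (∑ b, christoffel g x b b a) * X a x) := by
  rw [Finset.mul_sum]
  refine Finset.sum_congr rfl fun a _ => ?_
  rw [pd_mul (differentiableAt_of_smooth hU hm.smooth_volDensity hx) (hX a),
    hm.pd_volDensity hU hx]
  ring

end Identities

/-! ### The normalised normal vector field -/

section Normal

/-- The covariant derivative `∇_a ξ̂^b`. -/
def _root_.SingularWave.covXiHat (g : MetricField) (x : Pt) (a b : Fin 4) : ℝ :=
  pd a (fun y => xiHat g y b) x + ∑ c, christoffel g x b a c * xiHat g x c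

variable (hU : IsOpen U) (hm : IsTimeMetric U g) (hx : x ∈ U)
include hU hm hx

/-- By metric compatibility `V ∂_a V = -½ ∂_a g(ξ,ξ) = -g(∇_a ξ, ξ)`. The gain over differentiating
`g^{00}` directly is that only `∇ξ` appears, so `∂V` is `O(1)` under (B) while a derivative of the
metric is only `O(1/ε)`. -/
theorem V_mul_pd_V (a : Fin 4) :
    V g x * pd a (V g) x = -∑ b, ∑ c, g x b c * covXi g x a b * xi g x c := by
  have dV := differentiableAt_of_smooth hU hm.smooth_V hx
  have dxi : ∀ b, DifferentiableAt ℝ (fun y => xi g y b) x :=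
    fun b => differentiableAt_of_smooth hU (hm.smooth_xi b) hx
  -- `V² = -g^{00} = ξ^0`, so it suffices to find the partial derivative of one component of `ξ`.
  have h1 : pd a (fun y => V g y * V g y) x = pd a (fun y => xi g y 0) x :=
    pd_congr_of_isOpen hU hx fun y hy => by rw [← sq, hm.V_sq hy, xi_eq]
  rw [pd_mul dV dV] at h1
  -- `ξ_b = g_{bc} ξ^c` is constant
  have h2 : ∀ b, ∑ c, (pd a (fun y => g y b c) x * xi g x c + g x b c * pd a (fun y => xi g y c) x)
      = 0 := by
    intro b
    have d1 : ∀ b c, DifferentiableAt ℝ (fun y => g y b c) x :=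
      fun b c => differentiableAt_of_smooth hU (hm.smooth b c) hx
    have : pd a (fun y => ∑ c, g y b c * xi g y c) x = 0 := by
      rw [pd_congr_of_isOpen hU hx (h := fun _ => xiLow b) fun y hy => hm.lower_xi hy b, pd_const]
    rw [pd_sum fun c _ => (d1 _ _).fun_mul (dxi _)] at this
    rw [← this]
    exact Finset.sum_congr rfl fun i _ => (pd_mul (d1 _ _) (dxi _)).symm
  have lx : ∀ b, ∑ c, xi g x c * g x c b = xiLow b := fun b => by
    rw [← hm.lower_xi hx b]
    exact Finset.sum_congr rfl fun c _ => by rw [hm.symm hx c b, mul_comm]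
  have e1 : ∑ b, ∑ c, g x b c * covXi g x a b * xi g x c = ∑ b, covXi g x a b * xiLow b := by
    refine Finset.sum_congr rfl fun b _ => ?_
    rw [← hm.lower_xi hx b, Finset.mul_sum]
    exact Finset.sum_congr rfl fun c _ => by ring
  have e2 : ∑ b, covXi g x a b * xiLow b = -covXi g x a 0 := by simp [xiLow]
  -- the contraction of `∇_a ξ^b` with `ξ_b`, computed with the constancy of `ξ_b`
  have e3 : ∑ b, xi g x b * ∑ c, (pd a (fun y => g y b c) x * xi g x c
      + g x b c * pd a (fun y => xi g y c) x) = 0 := by simp [h2]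
  have e4 : ∑ b, xi g x b * ∑ c, g x b c * pd a (fun y => xi g y c) x
      = -pd a (fun y => xi g y 0) x := by
    have : ∀ c, ∑ b, xi g x b * (g x b c * pd a (fun y => xi g y c) x)
        = xiLow c * pd a (fun y => xi g y c) x := by
      intro c
      rw [← lx c, Finset.sum_mul]
      exact Finset.sum_congr rfl fun b _ => by ring
    simp only [Finset.mul_sum]
    rw [Finset.sum_comm]
    simp only [this]
    simp [xiLow]
  -- Metric compatibility splits `∂_a g_{bc}` into two Christoffel terms, which agree after
  -- contraction with the symmetric `ξ^b ξ^c`.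
  have e5 : ∑ b, xi g x b * ∑ c, pd a (fun y => g y b c) x * xi g x c
      = -2 * ∑ c, christoffel g x 0 a c * xi g x c := by
    have s1 : ∑ b, ∑ c, ∑ d, xi g x b * xi g x c * (g x c d * christoffel g x d a b)
        = -∑ c, christoffel g x 0 a c * xi g x c := by
      rw [← Finset.sum_neg_distrib]
      refine Finset.sum_congr rfl fun b _ => ?_
      rw [Finset.sum_comm]
      have : ∀ d, ∑ c, xi g x b * xi g x c * (g x c d * christoffel g x d a b)
          = xiLow d * (christoffel g x d a b * xi g x b) := by
        intro d
        rw [← lx d, Finset.sum_mul]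
        exact Finset.sum_congr rfl fun c _ => by ring
      simp only [this]
      simp [xiLow]
    have s2 : ∑ b, ∑ c, ∑ d, xi g x b * xi g x c * (g x b d * christoffel g x d a c)
        = -∑ c, christoffel g x 0 a c * xi g x c := by
      rw [← s1, Finset.sum_comm]
      exact Finset.sum_congr rfl fun b _ => Finset.sum_congr rfl fun c _ =>
        Finset.sum_congr rfl fun d _ => by ring
    calc _ = ∑ b, ∑ c, ((∑ d, xi g x b * xi g x c * (g x c d * christoffel g x d a b))
          + ∑ d, xi g x b * xi g x c * (g x b d * christoffel g x d a c)) := by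
          refine Finset.sum_congr rfl fun b _ => ?_
          rw [Finset.mul_sum]
          refine Finset.sum_congr rfl fun c _ => ?_
          rw [hm.pd_metric hU hx, ← Finset.mul_sum, ← Finset.mul_sum]
          ring
      _ = _ := by
          simp only [Finset.sum_add_distrib]
          rw [s1, s2]; ring
  simp only [Finset.sum_add_distrib, mul_add] at e3
  rw [e4, e5] at e3
  rw [e1, e2, covXi]
  linarith

/-- The covariant derivative of the normalised normal vector field. -/
theorem covXiHat_eq (a b : Fin 4) : covXiHat g x a b
    = covXi g x a b / V g x
      + xi g x b * (∑ c, ∑ d, g x c d * covXi g x a c * xi g x d) / V g x ^ 3 := by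
  have dV := differentiableAt_of_smooth hU hm.smooth_V hx
  have dxi : ∀ b, DifferentiableAt ℝ (fun y => xi g y b) x :=
    fun b => differentiableAt_of_smooth hU (hm.smooth_xi b) hx
  have dh := differentiableAt_of_smooth hU (hm.smooth_xiHat b) hx
  have hV := (hm.V_pos hx).ne'
  have h1 : pd a (fun y => xi g y b) x = pd a (fun y => xiHat g y b * V g y) x :=
    pd_congr_of_isOpen hU hx fun y hy => by
      rw [xiHat, div_mul_cancel₀ _ (hm.V_pos hy).ne']
  rw [pd_mul dh dV] at h1
  have h2 := hm.V_mul_pd_V hU hx a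
  have h3 : ∑ c, ∑ d, g x c d * covXi g x a c * xi g x d = -(V g x * pd a (V g) x) := by linarith
  have h4 : pd a (fun y => xiHat g y b) x
      = (pd a (fun y => xi g y b) x - xiHat g x b * pd a (V g) x) / V g x := by
    rw [h1]; field_simp; ring
  rw [h3, covXiHat, h4, covXi]
  simp only [xiHat, mul_div_assoc', ← Finset.sum_div]
  field_simp
  ring

end Normal

end IsTimeMetric

/-! ### Contractions of tensors -/

section Contraction

variable {k : ℕ}

/-- Components of a covariant tensor of rank `k`. -/
abbrev Tens (k : ℕ) : Type := (Fin k → Fin 4) → ℝ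

/-- The contraction of two covariant tensors with one matrix for every slot. -/
def contr (m : Fin k → Matrix (Fin 4) (Fin 4) ℝ) (S T : Tens k) : ℝ :=
  ∑ I, ∑ J, (∏ i, m i (I i) (J i)) * S I * T J

/-- The sum of the squares of the components. -/
def compSq (S : Tens k) : ℝ := ∑ I, S I ^ 2

/-- The action of a matrix on all slots of a covariant tensor as a derivation. -/
def slotAction (Γ : Matrix (Fin 4) (Fin 4) ℝ) (S : Tens k) : Tens k := fun J =>
  ∑ i, ∑ c, Γ c (J i) * S (Function.update J i c)

/-- The action of a matrix on all slots of a covariant tensor. -/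
def tensorPow (L : Matrix (Fin 4) (Fin 4) ℝ) (S : Tens k) : Tens k := fun R =>
  ∑ I, (∏ i, L (R i) (I i)) * S I

variable (m : Fin k → Matrix (Fin 4) (Fin 4) ℝ) (S S' T T' : Tens k)

theorem contr_transpose : contr (fun i => (m i).transpose) S T = contr m T S := by
  unfold contr
  rw [Finset.sum_comm]
  refine Finset.sum_congr rfl fun J _ => Finset.sum_congr rfl fun I _ => ?_
  simp only [Matrix.transpose_apply]
  ring

theorem contr_comm (hm : ∀ i, (m i).IsSymm) : contr m S T = contr m T S := by
  rw [← contr_transpose]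
  congr 1
  funext i
  exact hm i

theorem contr_add_left : contr m (S + S') T = contr m S T + contr m S' T := by
  simp only [contr, Pi.add_apply, mul_add, add_mul, Finset.sum_add_distrib]

theorem contr_smul_left (c : ℝ) : contr m (c • S) T = c * contr m S T := by
  simp only [contr, Pi.smul_apply, smul_eq_mul, Finset.mul_sum]
  exact Finset.sum_congr rfl fun I _ => Finset.sum_congr rfl fun J _ => by ring

theorem contr_add_right : contr m S (T + T') = contr m S T + contr m S T' := by
  rw [← contr_transpose, contr_add_left, contr_transpose, contr_transpose]

theorem contr_smul_right (c : ℝ) : contr m S (c • T) = c * contr m S T := by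
  rw [← contr_transpose, contr_smul_left, contr_transpose]

theorem contr_sub_right : contr m S (T - T') = contr m S T - contr m S T' := by
  rw [sub_eq_add_neg, contr_add_right, ← neg_one_smul ℝ T', contr_smul_right]; ring

theorem contr_sum_left {ι : Type*} (s : Finset ι) (F : ι → Tens k) :
    contr m (∑ i ∈ s, F i) T = ∑ i ∈ s, contr m (F i) T := by
  classical
  induction s using Finset.induction_on with
  | empty => simp [contr]
  | insert i s hi ih => rw [Finset.sum_insert hi, Finset.sum_insert hi, contr_add_left, ih]

theorem prod_update_apply (i : Fin k) (A : Matrix (Fin 4) (Fin 4) ℝ) (I J : Fin k → Fin 4) :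
    ∏ l, Function.update m i A l (I l) (J l)
      = (∏ l ∈ Finset.univ.erase i, m l (I l) (J l)) * A (I i) (J i) := by
  rw [← Finset.prod_erase_mul _ _ (Finset.mem_univ i), Function.update_self]
  congr 1
  exact Finset.prod_congr rfl fun l hl => by rw [Function.update_of_ne (Finset.ne_of_mem_erase hl)]

theorem contr_update_add (i : Fin k) (A B : Matrix (Fin 4) (Fin 4) ℝ) :
    contr (Function.update m i (A + B)) S T
      = contr (Function.update m i A) S T + contr (Function.update m i B) S T := by
  simp only [contr, prod_update_apply, Matrix.add_apply, mul_add, add_mul, Finset.sum_add_distrib]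

/-- The map exchanging the entry in slot `i` with the additional index is an involution of the index
set. -/
theorem sum_slot_swap (i : Fin k) (F : (Fin k → Fin 4) → Fin 4 → ℝ) :
    ∑ I, ∑ c, F (Function.update I i c) (I i) = ∑ I, ∑ c, F I c := by
  rw [← Fintype.sum_prod_type', ← Fintype.sum_prod_type']
  let e : (Fin k → Fin 4) × Fin 4 ≃ (Fin k → Fin 4) × Fin 4 :=
    { toFun := fun p => (Function.update p.1 i p.2, p.1 i)
      invFun := fun p => (Function.update p.1 i p.2, p.1 i)
      left_inv := fun p => by simp
      right_inv := fun p => by simp }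
  exact e.sum_comp fun p => F p.1 p.2

/-- A derivation acting on a tensor can be transferred to the matrices it is contracted with: after
exchanging the summed index with the entry of slot `i`, the action there is multiplication of `m i`
by `Γ`. Connection terms are moved onto the coefficients in this way. -/
theorem contr_slotAction_left (Γ : Matrix (Fin 4) (Fin 4) ℝ) :
    contr m (slotAction Γ S) T = ∑ i, contr (Function.update m i (Γ * m i)) S T := by
  have h1 : contr m (slotAction Γ S) T = ∑ i, ∑ J, ∑ I, ∑ c,
      (∏ l, m l (I l) (J l)) * (Γ c (I i) * S (Function.update I i c)) * T J := by
    unfold contr slotAction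
    rw [Finset.sum_comm, Finset.sum_comm (γ := Fin k)]
    refine Finset.sum_congr rfl fun J _ => ?_
    rw [Finset.sum_comm (γ := Fin k)]
    refine Finset.sum_congr rfl fun I _ => ?_
    rw [Finset.mul_sum, Finset.sum_mul]
    refine Finset.sum_congr rfl fun i _ => ?_
    rw [Finset.mul_sum, Finset.sum_mul]
  rw [h1]
  refine Finset.sum_congr rfl fun i _ => ?_
  unfold contr
  refine Eq.trans ?_ Finset.sum_comm
  refine Finset.sum_congr rfl fun J _ => ?_
  refine (sum_slot_swap i _).symm.trans ?_
  refine Finset.sum_congr rfl fun I _ => ?_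
  rw [prod_update_apply, Matrix.mul_apply, Finset.mul_sum, Finset.sum_mul, Finset.sum_mul]
  refine Finset.sum_congr rfl fun c _ => ?_
  rw [← Finset.prod_erase_mul _ _ (Finset.mem_univ i)]
  have : ∏ l ∈ Finset.univ.erase i, m l (Function.update I i c l) (J l)
      = ∏ l ∈ Finset.univ.erase i, m l (I l) (J l) :=
    Finset.prod_congr rfl fun l hl => by rw [Function.update_of_ne (Finset.ne_of_mem_erase hl)]
  rw [this]
  simp only [Function.update_self, Function.update_idem, Function.update_eq_self]
  ring

theorem contr_slotAction_right (Γ : Matrix (Fin 4) (Fin 4) ℝ) :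
    contr m S (slotAction Γ T)
      = ∑ i, contr (Function.update m i (m i * Γ.transpose)) S T := by
  rw [← contr_transpose, contr_slotAction_left]
  refine Finset.sum_congr rfl fun i _ => ?_
  rw [← contr_transpose]
  congr 1
  funext l
  by_cases h : l = i
  · subst h; simp [Matrix.transpose_mul]
  · simp [Function.update_of_ne h]

theorem sum_cons (F : (Fin (k + 1) → Fin 4) → ℝ) :
    ∑ I, F I = ∑ c, ∑ I : Fin k → Fin 4, F (Fin.cons c I) := by
  rw [← (Fin.consEquiv (fun _ : Fin (k + 1) => Fin 4)).sum_comp, Fintype.sum_prod_type]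
  rfl

theorem contr_cons (M : Matrix (Fin 4) (Fin 4) ℝ) (S T : Tens (k + 1)) :
    contr (Fin.cons M m) S T
      = ∑ c, ∑ d, M c d * contr m (fun I => S (Fin.cons c I)) fun J => T (Fin.cons d J) := by
  unfold contr
  rw [sum_cons]
  refine Finset.sum_congr rfl fun c _ => ?_
  simp only [sum_cons (k := k), Fin.prod_univ_succ, Fin.cons_zero, Fin.cons_succ, Finset.mul_sum]
  rw [Finset.sum_comm]
  refine Finset.sum_congr rfl fun d _ => Finset.sum_congr rfl fun I _ =>
    Finset.sum_congr rfl fun J _ => by ring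

/-- Expanding the product of the matrix entries over the slots turns a Gram matrix in every slot
into the Euclidean inner product of the transformed tensors. -/
theorem contr_gram (L : Matrix (Fin 4) (Fin 4) ℝ) :
    contr (fun _ => L.transpose * L) S T = ∑ R, tensorPow L S R * tensorPow L T R := by
  have h : ∀ I J : Fin k → Fin 4, ∏ i, (L.transpose * L) (I i) (J i)
      = ∑ R : Fin k → Fin 4, (∏ i, L (R i) (I i)) * ∏ i, L (R i) (J i) := by
    intro I J
    simp only [Matrix.mul_apply, Matrix.transpose_apply]
    rw [Finset.prod_univ_sum, Fintype.piFinset_univ]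
    exact Finset.sum_congr rfl fun R _ => Finset.prod_mul_distrib
  unfold contr tensorPow
  simp only [h, Finset.sum_mul, Finset.mul_sum]
  rw [Finset.sum_congr rfl fun I _ => Finset.sum_comm, Finset.sum_comm]
  refine Finset.sum_congr rfl fun R _ => ?_
  rw [Finset.sum_comm]
  exact Finset.sum_congr rfl fun J _ => Finset.sum_congr rfl fun I _ => by ring

theorem tensorPow_tensorPow (L L' : Matrix (Fin 4) (Fin 4) ℝ) :
    tensorPow L' (tensorPow L S) = tensorPow (L' * L) S := by
  funext R
  have h : ∀ I : Fin k → Fin 4, ∏ i, (L' * L) (R i) (I i)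
      = ∑ Q : Fin k → Fin 4, (∏ i, L' (R i) (Q i)) * ∏ i, L (Q i) (I i) := by
    intro I
    simp only [Matrix.mul_apply]
    rw [Finset.prod_univ_sum, Fintype.piFinset_univ]
    exact Finset.sum_congr rfl fun R _ => Finset.prod_mul_distrib
  unfold tensorPow
  simp only [h, Finset.sum_mul, Finset.mul_sum]
  rw [Finset.sum_comm]
  exact Finset.sum_congr rfl fun J _ => Finset.sum_congr rfl fun I _ => by ring

theorem tensorPow_one : tensorPow 1 S = S := by
  funext R
  unfold tensorPow
  rw [Finset.sum_eq_single R]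
  · simp
  · intro I _ hI
    obtain ⟨i, hi⟩ := Function.ne_iff.1 hI
    rw [Finset.prod_eq_zero (Finset.mem_univ i) (by simp [Ne.symm hi]), zero_mul]
  · simp

theorem compSq_nonneg : 0 ≤ compSq S := Finset.sum_nonneg fun _ _ => sq_nonneg _

theorem card_index : (Fintype.card (Fin k → Fin 4) : ℝ) = 4 ^ k := by simp

theorem abs_prod_le {C : ℝ} {f : Fin k → ℝ} (hf : ∀ i, |f i| ≤ C) : |∏ i, f i| ≤ C ^ k := by
  rw [Finset.abs_prod]
  calc ∏ i, |f i| ≤ ∏ _i : Fin k, C :=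
        Finset.prod_le_prod (fun i _ => abs_nonneg _) fun i _ => hf i
    _ = C ^ k := by simp

theorem sq_sum_le_compSq (f : Tens k) {C : ℝ} (hf : ∀ I, |f I| ≤ C) :
    (∑ I, f I * S I) ^ 2 ≤ 4 ^ k * C ^ 2 * compSq S := by
  have h1 := Finset.sum_mul_sq_le_sq_mul_sq Finset.univ f S
  refine h1.trans (mul_le_mul_of_nonneg_right ?_ (compSq_nonneg S))
  calc ∑ I, f I ^ 2 ≤ ∑ _I : Fin k → Fin 4, C ^ 2 :=
        Finset.sum_le_sum fun I _ => sq_le_sq' (by linarith [neg_abs_le (f I), hf I])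
          (le_of_abs_le (hf I))
    _ = 4 ^ k * C ^ 2 := by simp

theorem compSq_tensorPow_le {L : Matrix (Fin 4) (Fin 4) ℝ} {C : ℝ} (hL : ∀ a b, |L a b| ≤ C) :
    compSq (tensorPow L S) ≤ 4 ^ k * (4 ^ k * (C ^ k) ^ 2 * compSq S) := by
  calc compSq (tensorPow L S) ≤ ∑ _I : Fin k → Fin 4, 4 ^ k * (C ^ k) ^ 2 * compSq S :=
        Finset.sum_le_sum fun R _ =>
          sq_sum_le_compSq S _ fun I => abs_prod_le fun i => hL _ _
    _ = _ := by simp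

variable {m S T} in
-- Each product of components is estimated by the sum of two squares; `4^k` counts the values of the
-- index over which the respective square does not depend.
theorem abs_contr_le {C : ℝ} (hm : ∀ i a b, |m i a b| ≤ C) :
    |contr m S T| ≤ C ^ k * 4 ^ k * (compSq S + compSq T) := by
  have hC : 0 ≤ C ^ k := (abs_nonneg _).trans
    (abs_prod_le (f := fun i => m i 0 0) fun i => hm i 0 0)
  calc |contr m S T| ≤ ∑ I, ∑ J, C ^ k * (S I ^ 2 + T J ^ 2) := by
        refine (Finset.abs_sum_le_sum_abs _ _).trans (Finset.sum_le_sum fun I _ => ?_)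
        refine (Finset.abs_sum_le_sum_abs _ _).trans (Finset.sum_le_sum fun J _ => ?_)
        rw [mul_assoc, abs_mul]
        refine mul_le_mul (abs_prod_le fun i => hm i _ _) ?_ (abs_nonneg _) hC
        rw [abs_le]
        constructor <;> nlinarith [sq_nonneg (S I + T J), sq_nonneg (S I - T J)]
    _ = _ := by
        simp only [← Finset.mul_sum, Finset.sum_add_distrib, Finset.sum_const, Finset.card_univ,
          nsmul_eq_mul, card_index, compSq]
        ring

end Contraction

/-! ### Covariant derivatives of contractions -/

section Leibniz

variable {U : Set Pt} {g : MetricField} {x : Pt} {k : ℕ}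

/-- The connection matrix `Γ_a = (Γ^c_{ab})_{cb}`. -/
def connMatrix (g : MetricField) (x : Pt) (a : Fin 4) : Matrix (Fin 4) (Fin 4) ℝ :=
  Matrix.of fun c b => christoffel g x c a b

/-- The slice `∇_a T` of the covariant derivative of a tensor field. -/
def covSlice (g : MetricField) (T : Pt → Tens k) (x : Pt) (a : Fin 4) : Tens k := fun I =>
  covDeriv g T x (Fin.cons a I)

theorem covSlice_eq (T : Pt → Tens k) (a : Fin 4) (I : Fin k → Fin 4) :
    covSlice g T x a I = pd a (fun y => T y I) x - slotAction (connMatrix g x a) (T x) I := by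
  simp [covSlice, covDeriv, slotAction, connMatrix]

/-- The covariant derivative of a contravariant tensor field of rank two. -/
def covMatrix (g : MetricField) (M : MetricField) (x : Pt) (a : Fin 4) :
    Matrix (Fin 4) (Fin 4) ℝ :=
  Matrix.of (fun p q => pd a (fun y => M y p q) x) + connMatrix g x a * M x
    + M x * (connMatrix g x a).transpose

/-- In the ordinary product rule each partial derivative of `S` and `T` is the covariant one plus a
slot action. The slot actions pass to the matrices as `Γ m` and `m Γᵀ`, where they complete `∂m` to
the covariant derivative. -/
theorem pd_contr {m : Pt → Fin k → Matrix (Fin 4) (Fin 4) ℝ} {S T : Pt → Tens k} (a : Fin 4)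
    (hm : ∀ i p q, DifferentiableAt ℝ (fun y => m y i p q) x)
    (hS : ∀ I, DifferentiableAt ℝ (fun y => S y I) x)
    (hT : ∀ I, DifferentiableAt ℝ (fun y => T y I) x) :
    pd a (fun y => contr (m y) (S y) (T y)) x
      = contr (m x) (covSlice g S x a) (T x) + contr (m x) (S x) (covSlice g T x a)
        + ∑ i, contr (Function.update (m x) i (covMatrix g (fun y => m y i) x a)) (S x) (T x) := by
  have hp : ∀ I J : Fin k → Fin 4, DifferentiableAt ℝ (fun y => ∏ i, m y i (I i) (J i)) x :=
    fun I J => (HasFDerivAt.finsetProd fun i _ => (hm i _ _).hasFDerivAt).differentiableAt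
  have h1 : pd a (fun y => contr (m y) (S y) (T y)) x
      = (∑ i, contr (Function.update (m x) i (Matrix.of fun p q => pd a (fun y => m y i p q) x))
          (S x) (T x)) + contr (m x) (fun I => pd a (fun y => S y I) x) (T x)
        + contr (m x) (S x) (fun I => pd a (fun y => T y I) x) := by
    unfold contr
    rw [pd_sum fun I _ => DifferentiableAt.fun_sum fun J _ =>
      ((hp I J).fun_mul (hS I)).fun_mul (hT J)]
    simp only [pd_sum fun J _ => ((hp _ J).fun_mul (hS _)).fun_mul (hT J)]
    rw [Finset.sum_comm (γ := Fin k), ← Finset.sum_add_distrib, ← Finset.sum_add_distrib]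
    refine Finset.sum_congr rfl fun I _ => ?_
    rw [Finset.sum_comm (γ := Fin k), ← Finset.sum_add_distrib, ← Finset.sum_add_distrib]
    refine Finset.sum_congr rfl fun J _ => ?_
    rw [pd_mul ((hp I J).fun_mul (hS I)) (hT J), pd_mul (hp I J) (hS I), pd_prod fun i _ => hm i _ _]
    simp only [prod_update_apply, Matrix.of_apply, ← Finset.sum_mul]
    ring
  have hS' : (fun I => pd a (fun y => S y I) x)
      = covSlice g S x a + slotAction (connMatrix g x a) (S x) := by
    funext I; rw [Pi.add_apply, covSlice_eq]; ring
  have hT' : (fun I => pd a (fun y => T y I) x)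
      = covSlice g T x a + slotAction (connMatrix g x a) (T x) := by
    funext I; rw [Pi.add_apply, covSlice_eq]; ring
  rw [h1, hS', hT', contr_add_left, contr_add_right, contr_slotAction_left,
    contr_slotAction_right]
  simp only [covMatrix, contr_update_add, Finset.sum_add_distrib]
  ring

end Leibniz

/-! ### Energy currents -/

section Current

variable {U : Set Pt} {g : MetricField} {x : Pt} {k : ℕ} {u : Pt → ℝ}

/-- The coefficients of the energy current `-T^{ab} ξ̂_b` in the derivatives of the field. -/
def currentMatrix (g : MetricField) (x : Pt) (a : Fin 4) : Matrix (Fin 4) (Fin 4) ℝ :=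
  Matrix.of fun c d => -((g x)⁻¹ a c * xiHat g x d) + 1 / 2 * xiHat g x a * (g x)⁻¹ c d

/-- The coefficients of the energy current `-T^{ab,k+1} ξ̂_b` in `∇^{(k+1)} u`. -/
def currentSlots (g : MetricField) (k : ℕ) (a : Fin 4) (x : Pt) :
    Fin (k + 1) → Matrix (Fin 4) (Fin 4) ℝ :=
  Fin.cons (currentMatrix g x a) fun _ => (riem g x)⁻¹

/-- The energy current `-T^{ab,j} ξ̂_b`. -/
def current (g : MetricField) (u : Pt → ℝ) : ℕ → Fin 4 → Pt → ℝ
  | 0 => fun a x => 1 / 2 * xiHat g x a * u x ^ 2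
  | k + 1 => fun a x =>
      contr (currentSlots g k a x) (iterCov g u (k + 1) x) (iterCov g u (k + 1) x)

theorem normCovSq_eq (g : MetricField) (u : Pt → ℝ) (j : ℕ) (x : Pt) :
    normCovSq g u j x = contr (fun _ => (riem g x)⁻¹) (iterCov g u j x) (iterCov g u j x) := rfl

theorem contr_cons_sum {ι : Type*} (s : Finset ι) (M : ι → Matrix (Fin 4) (Fin 4) ℝ) (r : ι → ℝ)
    (m : Fin k → Matrix (Fin 4) (Fin 4) ℝ) (S T : Tens (k + 1)) :
    ∑ a ∈ s, r a * contr (Fin.cons (M a) m) S T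
      = contr (Fin.cons (∑ a ∈ s, r a • M a) m) S T := by
  simp only [contr_cons, Finset.mul_sum, Matrix.sum_apply, Matrix.smul_apply, smul_eq_mul,
    Finset.sum_mul]
  rw [Finset.sum_comm]
  refine Finset.sum_congr rfl fun c _ => ?_
  rw [Finset.sum_comm]
  exact Finset.sum_congr rfl fun d _ => Finset.sum_congr rfl fun a _ => by ring

/-- Once the trailing slots are diagonalised, the contraction is a sum over `R` of the quadratic
form `M` on single covectors. Pointwise inequalities for a scalar field, with `p = du`, thus extend
to derivatives of every order. -/
theorem contr_cons_gram (M L : Matrix (Fin 4) (Fin 4) ℝ) (S : Tens (k + 1)) :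
    contr (Fin.cons M fun _ => L.transpose * L) S S
      = ∑ R : Fin k → Fin 4, ∑ c, ∑ d, M c d
          * (tensorPow L (fun I => S (Fin.cons c I)) R
            * tensorPow L (fun I => S (Fin.cons d I)) R) := by
  rw [contr_cons]
  simp only [contr_gram, Finset.mul_sum]
  rw [Finset.sum_congr rfl fun c _ => Finset.sum_comm, Finset.sum_comm]

theorem contr_riem_nonneg (hm : IsTimeMetric U g) (hx : x ∈ U) (S : Tens k) :
    0 ≤ contr (fun _ => (riem g x)⁻¹) S S := by
  obtain ⟨L, hL, -⟩ := hm.exists_riem_inv_factor hx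
  rw [hL, contr_gram]
  exact Finset.sum_nonneg fun R _ => mul_self_nonneg _

theorem normCovSq_nonneg (hm : IsTimeMetric U g) (hx : x ∈ U) (j : ℕ) :
    0 ≤ normCovSq g u j x := contr_riem_nonneg hm hx _

/-- The components of a tensor are controlled by its norm if the Riemannian metric is bounded. -/
theorem compSq_le_contr_riem (hm : IsTimeMetric U g) (hx : x ∈ U) {C : ℝ} (hC : 0 ≤ C)
    (h : ∀ a, riem g x a a ≤ C ^ 2) (S : Tens k) :
    compSq S ≤ 4 ^ k * (4 ^ k * (C ^ k) ^ 2) * contr (fun _ => (riem g x)⁻¹) S S := by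
  obtain ⟨L, hL, hu⟩ := hm.exists_riem_inv_factor hx
  have hr : riem g x = L⁻¹ * L⁻¹.transpose := by
    have h1 := hm.riem_inv_mul hx
    rw [hL] at h1
    rw [Matrix.transpose_nonsing_inv, ← Matrix.mul_inv_rev, Matrix.inv_eq_right_inv h1]
  -- As `e = L⁻¹ (L⁻¹)ᵀ`, the diagonal entry `e_{aa}` is the sum of squares of row `a` of `L⁻¹`;
  -- bounds on the diagonal of `e` therefore suffice.
  have hb : ∀ a b, |L⁻¹ a b| ≤ C := by
    intro a b
    refine abs_le_of_sq_le_sq ?_ hC |> fun h => h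
    refine le_trans ?_ (h a)
    rw [hr, Matrix.mul_apply]
    simp only [Matrix.transpose_apply, ← sq]
    exact Finset.single_le_sum (f := fun b => L⁻¹ a b ^ 2) (fun _ _ => sq_nonneg _)
      (Finset.mem_univ b)
  have h2 : S = tensorPow L⁻¹ (tensorPow L S) := by
    rw [tensorPow_tensorPow, Matrix.nonsing_inv_mul _ hu, tensorPow_one]
  have h3 : contr (fun _ => (riem g x)⁻¹) S S = compSq (tensorPow L S) := by
    rw [hL, contr_gram]
    exact Finset.sum_congr rfl fun _ _ => (sq _).symm
  rw [h3]
  conv_lhs => rw [h2]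
  refine (compSq_tensorPow_le _ hb).trans (le_of_eq ?_)
  ring

/-- As `ξ = -dt`, contraction with `ξ_a` selects `a = 0` and supplies the sign in `-T^{ab} ξ̂_b`. -/
theorem energyTensor_eq_current (hm : IsTimeMetric U g) (hx : x ∈ U) (j : ℕ) :
    ∑ a, ∑ b, energyTensor g u j x a b * xiLow a * xiHatLow g x b = current g u j 0 x := by
  have hl : ∀ F : Fin 4 → Fin 4 → ℝ, ∑ a, ∑ b, F a b * xiLow a * xiHatLow g x b
      = -∑ b, F 0 b * xiHatLow g x b := by
    intro F
    simp [xiLow, Finset.sum_neg_distrib]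
  rw [hl]
  cases j with
  | zero =>
    simp only [energyTensor, current]
    rw [← hm.raise_xiHatLow hx, Finset.mul_sum, Finset.sum_mul, ← Finset.sum_neg_distrib]
    exact Finset.sum_congr rfl fun b _ => by ring
  | succ k =>
    simp only [current, currentSlots]
    rw [contr_cons]
    have hN : ∀ c d, currentMatrix g x 0 c d
        = -∑ b, ((g x)⁻¹ 0 c * (g x)⁻¹ b d - 1 / 2 * (g x)⁻¹ 0 b * (g x)⁻¹ c d)
            * xiHatLow g x b := by
      intro c d
      simp only [currentMatrix, Matrix.of_apply]
      rw [← hm.raise_xiHatLow hx d, ← hm.raise_xiHatLow hx 0]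
      simp only [Finset.mul_sum, ← Finset.sum_neg_distrib, ← Finset.sum_add_distrib,
        Finset.sum_mul]
      exact Finset.sum_congr rfl fun b _ => by rw [hm.inv_symm hx d b]; ring
    simp only [energyTensor, contr, hN, Finset.sum_mul, Finset.mul_sum, neg_mul,
      Finset.sum_neg_distrib]
    congr 1
    rw [Finset.sum_comm]
    refine Finset.sum_congr rfl fun c _ => ?_
    rw [Finset.sum_comm]
    refine Finset.sum_congr rfl fun d _ => ?_
    rw [Finset.sum_comm]
    refine Finset.sum_congr rfl fun I _ => ?_
    rw [Finset.sum_comm]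
    refine Finset.sum_congr rfl fun J _ => ?_
    refine Finset.sum_congr rfl fun b _ => ?_
    rw [riemInvProd]
    ring

/-- Since `ξ̂^0 = V` and `g^{0c} = -V ξ̂^c`, the matrix in the first slot becomes `V (ξ̂^c ξ̂^d + ½
g^{cd}) = (V/2) e^{cd}`, the same form as in the other slots. This is what makes the energy control
all components of the derivatives. -/
theorem current_zero (hm : IsTimeMetric U g) (hx : x ∈ U) (j : ℕ) :
    current g u j 0 x = V g x / 2 * normCovSq g u j x := by
  have hV := (hm.V_pos hx).ne'
  have h0 : xiHat g x 0 = V g x := by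
    rw [xiHat, IsTimeMetric.xi_eq, ← hm.V_sq hx]; field_simp
  cases j with
  | zero =>
    simp only [current, h0, normCovSq_eq, contr, iterCov]
    simp
    ring
  | succ k =>
    rw [normCovSq_eq]
    have e1 : currentMatrix g x 0 = (V g x / 2) • (riem g x)⁻¹ := by
      ext c d
      have hc : (g x)⁻¹ 0 c = -(V g x * xiHat g x c) := by
        rw [xiHat, IsTimeMetric.xi_eq, hm.inv_symm hx c 0]; field_simp
      rw [Matrix.smul_apply, hm.riem_inv hx, currentMatrix, Matrix.of_apply, h0, hc, smul_eq_mul]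
      ring
    have e2 : (fun _ : Fin (k + 1) => (riem g x)⁻¹)
        = Fin.cons (riem g x)⁻¹ fun _ : Fin k => (riem g x)⁻¹ := by
      funext i; refine Fin.cases rfl (fun _ => rfl) i
    simp only [current, currentSlots]
    rw [e1, e2, contr_cons, contr_cons, Finset.mul_sum]
    refine Finset.sum_congr rfl fun c _ => ?_
    rw [Finset.mul_sum]
    exact Finset.sum_congr rfl fun d _ => by rw [Matrix.smul_apply, smul_eq_mul]; ring

/-- The flux of the energy current through a spacelike hypersurface with future directed conormal
`r` is nonnegative. -/
theorem current_flux_nonneg (hm : IsTimeMetric U g) (hx : x ∈ U) {r : Fin 4 → ℝ}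
    (hr : ∑ a, ∑ b, (g x)⁻¹ a b * r a * r b < 0) (hrn : 0 < ∑ a, xi g x a * r a) (j : ℕ) :
    0 ≤ ∑ a, current g u j a x * r a := by
  have hV := hm.V_pos hx
  have hrn' : 0 < ∑ a, xiHat g x a * r a := by
    have : ∑ a, xiHat g x a * r a = (∑ a, xi g x a * r a) / V g x := by
      rw [Finset.sum_div]
      exact Finset.sum_congr rfl fun a _ => by rw [xiHat]; ring
    rw [this]; positivity
  cases j with
  | zero =>
    have : ∑ a, current g u 0 a x * r a = 1 / 2 * u x ^ 2 * ∑ a, xiHat g x a * r a := by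
      rw [Finset.mul_sum]
      exact Finset.sum_congr rfl fun a _ => by simp only [current]; ring
    rw [this]; positivity
  | succ k =>
    obtain ⟨L, hL, -⟩ := hm.exists_riem_inv_factor hx
    have e1 : ∑ a, current g u (k + 1) a x * r a
        = contr (Fin.cons (∑ a, r a • currentMatrix g x a) fun _ => L.transpose * L)
          (iterCov g u (k + 1) x) (iterCov g u (k + 1) x) := by
      rw [← contr_cons_sum]
      refine Finset.sum_congr rfl fun a _ => ?_
      simp only [current, currentSlots, hL]
      ring
    rw [e1, contr_cons_gram]
    refine Finset.sum_nonneg fun R _ => ?_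
    -- For fixed `R` this covector plays the part of the gradient of a scalar field.
    set p : Fin 4 → ℝ := fun c => tensorPow L (fun I => iterCov g u (k + 1) x (Fin.cons c I)) R
    have hd := (hm.lorentzian x hx).inv.dominant_energy (hm.xiHatLow_unit hx) (r := r)
      (by
        refine lt_of_eq_of_lt ?_ hr
        simp only [dotProduct, Matrix.mulVec, Finset.mul_sum]
        exact Finset.sum_congr rfl fun a _ => Finset.sum_congr rfl fun b _ => by ring)
      (by rw [hm.dotProduct_xiHatLow hx]; exact hrn') p
    refine hd.trans (le_of_eq ?_)
    rw [hm.dotProduct_xiHatLow hx, hm.dotProduct_xiHatLow hx]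
    simp only [dotProduct, Matrix.mulVec, Matrix.sum_apply, Matrix.smul_apply, currentMatrix,
      Matrix.of_apply, smul_eq_mul]
    change _ = ∑ c, ∑ d, (∑ a, r a * (-((g x)⁻¹ a c * xiHat g x d)
      + 1 / 2 * xiHat g x a * (g x)⁻¹ c d)) * (p c * p d)
    have s1 : ∀ c d, (∑ a, r a * (-((g x)⁻¹ a c * xiHat g x d)
        + 1 / 2 * xiHat g x a * (g x)⁻¹ c d)) * (p c * p d)
        = -((∑ a, r a * ((g x)⁻¹ a c * p c)) * (xiHat g x d * p d))
          + 1 / 2 * (∑ a, xiHat g x a * r a) * (p c * ((g x)⁻¹ c d * p d)) := by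
      intro c d
      simp only [Finset.mul_sum, Finset.sum_mul, ← Finset.sum_neg_distrib,
        ← Finset.sum_add_distrib]
      exact Finset.sum_congr rfl fun a _ => by ring
    simp only [s1, Finset.sum_add_distrib, Finset.sum_neg_distrib, ← Finset.mul_sum,
      ← Finset.sum_mul]
    congr 3
    rw [Finset.sum_comm]
    exact Finset.sum_congr rfl fun a _ => by rw [Finset.mul_sum]

theorem current_zero_nonneg (hm : IsTimeMetric U g) (hx : x ∈ U) (j : ℕ) :
    0 ≤ current g u j 0 x := by
  rw [current_zero hm hx]
  have := hm.V_pos hx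
  have := normCovSq_nonneg (u := u) hm hx j
  positivity

end Current

/-! ### The divergence of the energy current -/

section Divergence

variable {U : Set Pt} {g : MetricField} {x : Pt} {k : ℕ} {u : Pt → ℝ}

theorem smooth_covDeriv (hU : IsOpen U) (hm : IsTimeMetric U g) {T : Pt → Tens k}
    (hT : ∀ I, ContDiffOn ℝ ∞ (fun y => T y I) U) (I : Fin (k + 1) → Fin 4) :
    ContDiffOn ℝ ∞ (fun y => covDeriv g T y I) U :=
  (contDiffOn_pd hU (hT _) _).sub (ContDiffOn.sum fun _ _ => ContDiffOn.sum fun _ _ =>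
    (hm.smooth_christoffel hU _ _ _).mul (hT _))

theorem smooth_iterCov (hU : IsOpen U) (hm : IsTimeMetric U g) (hu : ContDiffOn ℝ ∞ u U) :
    ∀ (k : ℕ) (I : Fin k → Fin 4), ContDiffOn ℝ ∞ (fun y => iterCov g u k y I) U
  | 0, _ => hu
  | k + 1, I => smooth_covDeriv hU hm (smooth_iterCov hU hm hu k) I

/-- The covariant divergence of the coefficients of the energy current. -/
def divCurrentMatrix (g : MetricField) (x : Pt) : Matrix (Fin 4) (Fin 4) ℝ :=
  Matrix.of fun c d => -(∑ a, (g x)⁻¹ a c * covXiHat g x a d)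
    + 1 / 2 * (∑ a, covXiHat g x a a) * (g x)⁻¹ c d

/-- Since `∇g⁻¹ = 0`, only the summand `2 ξ̂ ⊗ ξ̂` of `e⁻¹` is differentiated. The outcome involves
`∇ξ̂` but no free Christoffel symbol, hence remains bounded under (B). -/
theorem covMatrix_riem_inv (hU : IsOpen U) (hm : IsTimeMetric U g) (hx : x ∈ U) (a p q : Fin 4) :
    covMatrix g (fun y => (riem g y)⁻¹) x a p q
      = 2 * (covXiHat g x a p * xiHat g x q + xiHat g x p * covXiHat g x a q) := by
  have dv : ∀ b, DifferentiableAt ℝ (fun y => xiHat g y b) x :=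
    fun b => differentiableAt_of_smooth hU (hm.smooth_xiHat b) hx
  have di : ∀ b c, DifferentiableAt ℝ (fun y => (g y)⁻¹ b c) x :=
    fun b c => differentiableAt_of_smooth hU (hm.smooth_inv b c) hx
  simp only [covMatrix, Matrix.add_apply, Matrix.of_apply, Matrix.mul_apply, connMatrix,
    Matrix.transpose_apply, hm.riem_inv hx]
  rw [pd_congr_of_isOpen hU hx fun y hy => hm.riem_inv hy p q,
    pd_add (di _ _) (((dv p).const_mul 2).fun_mul (dv q)),
    pd_mul ((dv p).const_mul 2) (dv q), pd_const_mul 2 (dv p), hm.pd_inv hU hx]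
  simp only [covXiHat, mul_add, add_mul, Finset.sum_add_distrib, Finset.mul_sum, Finset.sum_mul]
  have e1 : ∑ c, (g x)⁻¹ p c * christoffel g x q a c = ∑ c, christoffel g x q a c * (g x)⁻¹ p c :=
    Finset.sum_congr rfl fun _ _ => mul_comm _ _
  have e2 : ∑ c, christoffel g x p a c * (2 * xiHat g x c * xiHat g x q)
      = ∑ c, 2 * (christoffel g x p a c * xiHat g x c * xiHat g x q) :=
    Finset.sum_congr rfl fun _ _ => by ring
  have e3 : ∑ c, 2 * xiHat g x p * xiHat g x c * christoffel g x q a c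
      = ∑ c, 2 * (xiHat g x p * (christoffel g x q a c * xiHat g x c)) :=
    Finset.sum_congr rfl fun _ _ => by ring
  rw [e1, e2, e3]
  ring

/-- `covMatrix` accounts for the indices `c, d` only; the trace of the connection accounts for the
index `a` of the current, and together they form a covariant divergence. All terms with `∇g⁻¹` drop
out. -/
theorem sum_covMatrix_current (hU : IsOpen U) (hm : IsTimeMetric U g) (hx : x ∈ U) :
    ∑ a, (covMatrix g (fun y => currentMatrix g y a) x a
      + (∑ b, christoffel g x b b a) • currentMatrix g x a) = divCurrentMatrix g x := by
  have dv : ∀ b, DifferentiableAt ℝ (fun y => xiHat g y b) x :=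
    fun b => differentiableAt_of_smooth hU (hm.smooth_xiHat b) hx
  have di : ∀ b c, DifferentiableAt ℝ (fun y => (g y)⁻¹ b c) x :=
    fun b c => differentiableAt_of_smooth hU (hm.smooth_inv b c) hx
  ext c d
  simp only [Matrix.sum_apply, covMatrix, Matrix.add_apply, Matrix.of_apply, Matrix.mul_apply,
    connMatrix, Matrix.transpose_apply, Matrix.smul_apply, smul_eq_mul, currentMatrix,
    divCurrentMatrix]
  have e : ∀ a, pd a (fun y => -((g y)⁻¹ a c * xiHat g y d) + 1 / 2 * xiHat g y a * (g y)⁻¹ c d) x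
      = -(pd a (fun y => (g y)⁻¹ a c) x * xiHat g x d
          + (g x)⁻¹ a c * pd a (fun y => xiHat g y d) x)
        + (1 / 2 * pd a (fun y => xiHat g y a) x * (g x)⁻¹ c d
          + 1 / 2 * xiHat g x a * pd a (fun y => (g y)⁻¹ c d) x) := by
    intro a
    rw [pd_add (((di _ _).fun_mul (dv _)).fun_neg) (((dv a).const_mul _).fun_mul (di _ _)),
      pd_neg ((di _ _).fun_mul (dv _)), pd_mul (di _ _) (dv _),
      pd_mul ((dv a).const_mul _) (di _ _), pd_const_mul _ (dv a)]
  have hsy : ∀ a, (g x)⁻¹ a c = (g x)⁻¹ c a := fun a => hm.inv_symm hx a c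
  simp only [e, hm.pd_inv hU hx, covXiHat, hsy, Fin.sum_univ_four]
  ring

/-- Here `F a c d` stands for `⟨∇_a ∇_c w, ∇_d w⟩`. The first product yields the wave operator;
relabelling indices in the others leaves only the antisymmetric part of `F` in its first two
arguments. For a scalar `w` that part vanishes; for tensors it is the curvature term. -/
theorem current_leading_terms {gi : Fin 4 → Fin 4 → ℝ} (hs : ∀ a b, gi a b = gi b a)
    (v : Fin 4 → ℝ) (F : Fin 4 → Fin 4 → Fin 4 → ℝ) :
    ∑ a, ∑ c, ∑ d, (-(gi a c * v d) + 1 / 2 * v a * gi c d) * (F a c d + F a d c)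
      = -(∑ d, v d * ∑ a, ∑ c, gi a c * F a c d)
        - ∑ a, ∑ c, ∑ d, gi a c * v d * (F a d c - F d a c) := by
  have s1 : ∑ a, ∑ c, ∑ d, v a * gi c d * F a d c = ∑ a, ∑ c, ∑ d, v a * gi c d * F a c d := by
    refine Finset.sum_congr rfl fun a _ => ?_
    rw [Finset.sum_comm]
    exact Finset.sum_congr rfl fun c _ => Finset.sum_congr rfl fun d _ => by rw [hs d c]
  have s2 : ∑ a, ∑ c, ∑ d, gi a c * v d * F d a c = ∑ a, ∑ c, ∑ d, v a * gi c d * F a c d := by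
    rw [Finset.sum_congr rfl fun a _ => Finset.sum_comm, Finset.sum_comm]
    exact Finset.sum_congr rfl fun a _ => Finset.sum_congr rfl fun c _ =>
      Finset.sum_congr rfl fun d _ => by ring
  have s3 : ∑ d, v d * ∑ a, ∑ c, gi a c * F a c d = ∑ a, ∑ c, ∑ d, gi a c * v d * F a c d := by
    simp only [Finset.mul_sum]
    rw [Finset.sum_comm]
    refine Finset.sum_congr rfl fun a _ => ?_
    rw [Finset.sum_comm]
    exact Finset.sum_congr rfl fun c _ => Finset.sum_congr rfl fun d _ => by ring
  have e : ∀ a c d, (-(gi a c * v d) + 1 / 2 * v a * gi c d) * (F a c d + F a d c)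
      = -(gi a c * v d * F a c d) - gi a c * v d * F a d c
        + 1 / 2 * (v a * gi c d * F a c d) + 1 / 2 * (v a * gi c d * F a d c) := by
    intros; ring
  simp only [e, mul_sub, Finset.sum_add_distrib, Finset.sum_sub_distrib, Finset.sum_neg_distrib,
    ← Finset.mul_sum]
  rw [s1, s2, s3]
  ring

/-- The divergence of the energy current: the wave operator and the commutator of covariant
derivatives, up to terms without derivatives of the field. -/
theorem sum_pd_current (hU : IsOpen U) (hm : IsTimeMetric U g) (hx : x ∈ U)
    (hu : ContDiffOn ℝ ∞ u U) (k : ℕ) :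
    ∑ a, (pd a (current g u (k + 1) a) x
        + (∑ b, christoffel g x b b a) * current g u (k + 1) a x)
      = -(∑ d, xiHat g x d * contr (fun _ => (riem g x)⁻¹)
          (∑ a, ∑ c, (g x)⁻¹ a c • fun I => iterCov g u (k + 2) x (Fin.cons a (Fin.cons c I)))
          (fun J => iterCov g u (k + 1) x (Fin.cons d J)))
        - (∑ a, ∑ c, ∑ d, (g x)⁻¹ a c * xiHat g x d * contr (fun _ => (riem g x)⁻¹)
          (fun I => iterCov g u (k + 1) x (Fin.cons c I))
          ((fun J => iterCov g u (k + 2) x (Fin.cons a (Fin.cons d J)))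
            - fun J => iterCov g u (k + 2) x (Fin.cons d (Fin.cons a J))))
        + contr (Fin.cons (divCurrentMatrix g x) fun _ => (riem g x)⁻¹)
          (iterCov g u (k + 1) x) (iterCov g u (k + 1) x)
        + ∑ a, ∑ i : Fin k, contr (Fin.cons (currentMatrix g x a)
            (Function.update (fun _ => (riem g x)⁻¹) i (covMatrix g (fun y => (riem g y)⁻¹) x a)))
          (iterCov g u (k + 1) x) (iterCov g u (k + 1) x) := by
  have dv : ∀ b, DifferentiableAt ℝ (fun y => xiHat g y b) x :=
    fun b => differentiableAt_of_smooth hU (hm.smooth_xiHat b) hx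
  have di : ∀ b c, DifferentiableAt ℝ (fun y => (g y)⁻¹ b c) x :=
    fun b c => differentiableAt_of_smooth hU (hm.smooth_inv b c) hx
  have dr : ∀ b c, DifferentiableAt ℝ (fun y => (riem g y)⁻¹ b c) x :=
    fun b c => differentiableAt_of_smooth hU (hm.smooth_riem_inv b c) hx
  have dT : ∀ I, DifferentiableAt ℝ (fun y => iterCov g u (k + 1) y I) x :=
    fun I => differentiableAt_of_smooth hU (smooth_iterCov hU hm hu _ I) hx
  have dm : ∀ a i p q, DifferentiableAt ℝ (fun y => currentSlots g k a y i p q) x := by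
    intro a i p q
    refine Fin.cases ?_ (fun i => ?_) i
    · exact ((di _ _).fun_mul (dv _)).fun_neg.fun_add (((dv a).const_mul _).fun_mul (di _ _))
    · exact dr p q
  set T := iterCov g u (k + 1) x with hT
  set e : Fin k → Matrix (Fin 4) (Fin 4) ℝ := fun _ => (riem g x)⁻¹ with he
  have h1 : ∀ a, pd a (current g u (k + 1) a) x
      = contr (Fin.cons (currentMatrix g x a) e) (covSlice g (iterCov g u (k + 1)) x a) T
        + contr (Fin.cons (currentMatrix g x a) e) T (covSlice g (iterCov g u (k + 1)) x a)
        + (contr (Fin.cons (covMatrix g (fun y => currentMatrix g y a) x a) e) T T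
          + ∑ i : Fin k, contr (Fin.cons (currentMatrix g x a)
            (Function.update e i (covMatrix g (fun y => (riem g y)⁻¹) x a))) T T) := by
    intro a
    have := pd_contr (g := g) a (dm a) dT dT
    rw [Fin.sum_univ_succ] at this
    refine this.trans ?_
    have u0 : Function.update (currentSlots g k a x) 0
        (covMatrix g (fun y => currentSlots g k a y 0) x a)
        = Fin.cons (covMatrix g (fun y => currentMatrix g y a) x a) e := by
      unfold currentSlots
      rw [Fin.update_cons_zero]; rfl
    have u1 : ∀ i : Fin k, Function.update (currentSlots g k a x) i.succ
        (covMatrix g (fun y => currentSlots g k a y i.succ) x a)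
        = Fin.cons (currentMatrix g x a)
            (Function.update e i (covMatrix g (fun y => (riem g y)⁻¹) x a)) := by
      intro i
      unfold currentSlots
      rw [Fin.cons_update]; rfl
    simp only [u0, u1]
    rfl
  -- The current is quadratic, so the derivative falls on either factor; symmetry of `e⁻¹` brings
  -- both contributions to the form `F a c d + F a d c`.
  have hsym : ∀ i, (e i).IsSymm := fun i => Matrix.IsSymm.ext fun p q => hm.riem_inv_symm hx q p
  have h2 : ∑ a, (contr (Fin.cons (currentMatrix g x a) e) (covSlice g (iterCov g u (k + 1)) x a) T
        + contr (Fin.cons (currentMatrix g x a) e) T (covSlice g (iterCov g u (k + 1)) x a))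
      = -(∑ d, xiHat g x d * contr e
          (∑ a, ∑ c, (g x)⁻¹ a c • fun I => iterCov g u (k + 2) x (Fin.cons a (Fin.cons c I)))
          (fun J => T (Fin.cons d J)))
        - (∑ a, ∑ c, ∑ d, (g x)⁻¹ a c * xiHat g x d * contr e (fun I => T (Fin.cons c I))
          ((fun J => iterCov g u (k + 2) x (Fin.cons a (Fin.cons d J)))
            - fun J => iterCov g u (k + 2) x (Fin.cons d (Fin.cons a J)))) := by
    have := current_leading_terms (gi := fun a b => (g x)⁻¹ a b) (hm.inv_symm hx) (xiHat g x)
      (fun a c d => contr e (fun I => iterCov g u (k + 2) x (Fin.cons a (Fin.cons c I)))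
        fun J => T (Fin.cons d J))
    simp only [contr_sum_left, contr_smul_left, contr_sub_right]
    simp only [contr_comm e (fun I => T (Fin.cons _ I)) _ hsym]
    rw [← this]
    refine Finset.sum_congr rfl fun a _ => ?_
    rw [contr_cons, contr_cons, ← Finset.sum_add_distrib]
    refine Finset.sum_congr rfl fun c _ => ?_
    rw [← Finset.sum_add_distrib]
    refine Finset.sum_congr rfl fun d _ => ?_
    rw [contr_comm e (fun I => T (Fin.cons c I)) _ hsym]
    simp only [currentMatrix, Matrix.of_apply]
    rw [mul_add]
    rfl
  have h3 : contr (Fin.cons (divCurrentMatrix g x) e) T T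
      = ∑ a, (contr (Fin.cons (covMatrix g (fun y => currentMatrix g y a) x a) e) T T
        + (∑ b, christoffel g x b b a) * current g u (k + 1) a x) := by
    rw [← sum_covMatrix_current hU hm hx]
    have := contr_cons_sum Finset.univ (fun a => covMatrix g (fun y => currentMatrix g y a) x a
      + (∑ b, christoffel g x b b a) • currentMatrix g x a) (fun _ => 1) e T T
    simp only [one_mul, one_smul] at this
    rw [← this]
    refine Finset.sum_congr rfl fun a _ => ?_
    simp only [current, currentSlots, contr_cons, Matrix.add_apply, Matrix.smul_apply, smul_eq_mul,
      Finset.mul_sum, ← Finset.sum_add_distrib]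
    exact Finset.sum_congr rfl fun c _ => Finset.sum_congr rfl fun d _ => by ring
  rw [← h2, h3, ← Finset.sum_add_distrib, ← Finset.sum_add_distrib]
  refine Finset.sum_congr rfl fun a _ => ?_
  rw [h1]
  ring

end Divergence

/-! ### Pointwise bounds for the divergence of the energy current -/

section PointwiseBound

theorem compSq_slice_le {k : ℕ} (T : Tens (k + 1)) (d : Fin 4) :
    compSq (fun J => T (Fin.cons d J)) ≤ compSq T := by
  unfold compSq
  rw [sum_cons (k := k)]
  exact Finset.single_le_sum (f := fun c => ∑ I : Fin k → Fin 4, T (Fin.cons c I) ^ 2)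
    (fun c _ => Finset.sum_nonneg fun I _ => sq_nonneg _) (Finset.mem_univ d)

/-- All coefficients in the divergence formula are built from `g⁻¹`, `ξ̂`, `∇ξ̂` and `e⁻¹`, so `D`
depends on `k` and their bound `C` alone. The traced derivative and the commutators are kept as
separate squares, as they carry the negative powers of `ε`. -/
theorem exists_sum_pd_current_le (k : ℕ) {C : ℝ} (hC : 1 ≤ C) : ∃ D : ℝ, 0 ≤ D ∧
    ∀ (U : Set Pt) (g : MetricField) (u : Pt → ℝ) (x : Pt), IsOpen U → IsTimeMetric U g → x ∈ U →
      ContDiffOn ℝ ∞ u U → (∀ a b, |(g x)⁻¹ a b| ≤ C) → (∀ a, |xiHat g x a| ≤ C) →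
      (∀ a b, |covXiHat g x a b| ≤ C) → (∀ a b, |(riem g x)⁻¹ a b| ≤ C) →
      ∑ a, (pd a (current g u (k + 1) a) x
        + (∑ b, christoffel g x b b a) * current g u (k + 1) a x)
      ≤ D * (compSq (∑ a, ∑ c, (g x)⁻¹ a c • fun I : Fin k → Fin 4 =>
            iterCov g u (k + 2) x (Fin.cons a (Fin.cons c I)))
          + (∑ a, ∑ d, compSq ((fun J : Fin k → Fin 4 =>
              iterCov g u (k + 2) x (Fin.cons a (Fin.cons d J)))
            - fun J => iterCov g u (k + 2) x (Fin.cons d (Fin.cons a J))))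
          + compSq (iterCov g u (k + 1) x)) := by
  -- A common bound for the matrix entries: `3C²/2` for the current, `4C² + 2C²` for its divergence,
  -- `4C²` for the covariant derivative of `e⁻¹`.
  set B : ℝ := 6 * C ^ 2 with hB
  have hB1 : 1 ≤ B := by nlinarith
  set P : ℝ := B ^ (k + 1) * 4 ^ (k + 1) with hP
  have hP0 : 0 ≤ P := by positivity
  have hPk : B ^ k * 4 ^ k ≤ P := by
    have h1 : B ^ k ≤ B ^ (k + 1) := pow_le_pow_right₀ hB1 (Nat.le_succ k)
    have h2 : (4 : ℝ) ^ k ≤ 4 ^ (k + 1) := pow_le_pow_right₀ (by norm_num) (Nat.le_succ k)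
    exact mul_le_mul h1 h2 (by positivity) (by positivity)
  -- The traced derivative and the commutators enter with coefficient `4`, the square of
  -- `∇^{(k+1)}u` with `4 + 64 + 2 + 8k = 70 + 8k`; the sum of the two numbers dominates both.
  refine ⟨C ^ 2 * P * (74 + 8 * k), by positivity, ?_⟩
  intro U g u x hU hm hx hu hgi hv hcv hri
  rw [sum_pd_current hU hm hx hu]
  set T := iterCov g u (k + 1) x
  set X : Tens k := ∑ a, ∑ c, (g x)⁻¹ a c • fun I : Fin k → Fin 4 =>
            iterCov g u (k + 2) x (Fin.cons a (Fin.cons c I))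
  set Y : Fin 4 → Fin 4 → Tens k := fun a d => (fun J : Fin k → Fin 4 =>
              iterCov g u (k + 2) x (Fin.cons a (Fin.cons d J)))
            - fun J => iterCov g u (k + 2) x (Fin.cons d (Fin.cons a J))
  have hCB : C ≤ B := by nlinarith
  have hri' : ∀ a b, |(riem g x)⁻¹ a b| ≤ B := fun a b => (hri a b).trans hCB
  have hC2 : C ≤ C ^ 2 := by nlinarith
  have hmul : ∀ {p q : ℝ}, |p| ≤ C → |q| ≤ C → |p * q| ≤ C ^ 2 := by
    intro p q hp hq
    rw [abs_mul, sq]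
    exact mul_le_mul hp hq (abs_nonneg _) (by linarith)
  have b1 : ∀ S S' : Tens k, |contr (fun _ => (riem g x)⁻¹) S S'| ≤ P * (compSq S + compSq S') :=
    fun S S' => (abs_contr_le fun _ => hri').trans
      (mul_le_mul_of_nonneg_right hPk (add_nonneg (compSq_nonneg _) (compSq_nonneg _)))
  have b2 : ∀ (M : Matrix (Fin 4) (Fin 4) ℝ) (m : Fin k → Matrix (Fin 4) (Fin 4) ℝ),
      (∀ a b, |M a b| ≤ B) → (∀ i a b, |m i a b| ≤ B) →
      |contr (Fin.cons M m) T T| ≤ 2 * P * compSq T := by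
    intro M m hM hmB
    refine (abs_contr_le (C := B) fun i => ?_).trans (le_of_eq (by rw [hP]; ring))
    exact Fin.cases hM hmB i
  have hcur : ∀ a c d, |currentMatrix g x a c d| ≤ B := by
    intro a c d
    have h1 := hmul (hgi a c) (hv d)
    have h2 := hmul (hv a) (hgi c d)
    simp only [currentMatrix, Matrix.of_apply]
    rw [abs_le] at h1 h2 ⊢
    constructor <;> nlinarith
  have hdiv : ∀ c d, |divCurrentMatrix g x c d| ≤ B := by
    intro c d
    have h1 : |∑ a, (g x)⁻¹ a c * covXiHat g x a d| ≤ 4 * C ^ 2 :=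
      (Finset.abs_sum_le_sum_abs _ _).trans
        ((Finset.sum_le_sum fun a _ => hmul (hgi a c) (hcv a d)).trans (le_of_eq (by simp)))
    have h2 : |(∑ a, covXiHat g x a a) * (g x)⁻¹ c d| ≤ 4 * C ^ 2 := by
      rw [Finset.sum_mul]
      exact (Finset.abs_sum_le_sum_abs _ _).trans
        ((Finset.sum_le_sum fun a _ => hmul (hcv a a) (hgi c d)).trans (le_of_eq (by simp)))
    simp only [divCurrentMatrix, Matrix.of_apply]
    rw [abs_le] at h1 h2 ⊢
    constructor <;> nlinarith
  have hcov : ∀ a p q, |covMatrix g (fun y => (riem g y)⁻¹) x a p q| ≤ B := by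
    intro a p q
    rw [covMatrix_riem_inv hU hm hx]
    have h1 := hmul (hcv a p) (hv q)
    have h2 := hmul (hv p) (hcv a q)
    rw [abs_le] at h1 h2 ⊢
    constructor <;> nlinarith
  have hT0 := compSq_nonneg T
  have hX0 := compSq_nonneg X
  have hY0 : 0 ≤ ∑ a, ∑ d, compSq (Y a d) :=
    Finset.sum_nonneg fun a _ => Finset.sum_nonneg fun d _ => compSq_nonneg _
  have t1 : |∑ d, xiHat g x d * contr (fun _ => (riem g x)⁻¹) X fun J => T (Fin.cons d J)|
      ≤ 4 * (C ^ 2 * P * (compSq X + compSq T)) := by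
    refine (Finset.abs_sum_le_sum_abs _ _).trans ((Finset.sum_le_sum fun d _ => ?_).trans
      (le_of_eq (by simp)) (b := ∑ _d : Fin 4, C ^ 2 * P * (compSq X + compSq T)))
    rw [abs_mul, mul_assoc]
    refine mul_le_mul ((hv d).trans hC2) ((b1 _ _).trans ?_) (abs_nonneg _) (by positivity)
    exact mul_le_mul_of_nonneg_left (by linarith [compSq_slice_le T d]) hP0
  have t2 : |∑ a, ∑ c, ∑ d, (g x)⁻¹ a c * xiHat g x d * contr (fun _ => (riem g x)⁻¹)
          (fun I => T (Fin.cons c I)) (Y a d)|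
      ≤ 4 * (C ^ 2 * P * ∑ a, ∑ d, compSq (Y a d)) + 64 * (C ^ 2 * P * compSq T) := by
    calc _ ≤ ∑ a, ∑ _c : Fin 4, ∑ d, C ^ 2 * P * (compSq T + compSq (Y a d)) := by
          refine (Finset.abs_sum_le_sum_abs _ _).trans (Finset.sum_le_sum fun a _ => ?_)
          refine (Finset.abs_sum_le_sum_abs _ _).trans (Finset.sum_le_sum fun c _ => ?_)
          refine (Finset.abs_sum_le_sum_abs _ _).trans (Finset.sum_le_sum fun d _ => ?_)
          rw [abs_mul, mul_assoc]
          refine mul_le_mul (hmul (hgi a c) (hv d)) ((b1 _ _).trans ?_) (abs_nonneg _)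
            (by positivity)
          exact mul_le_mul_of_nonneg_left (by linarith [compSq_slice_le T c]) hP0
      _ = _ := by
          simp only [← Finset.mul_sum, Finset.sum_add_distrib, Finset.sum_const, Finset.card_univ,
            Fintype.card_fin, nsmul_eq_mul]
          push_cast
          ring
  have t3 := b2 _ _ hdiv fun _ : Fin k => hri'
  have t4 : |∑ a, ∑ i : Fin k, contr (Fin.cons (currentMatrix g x a)
            (Function.update (fun _ => (riem g x)⁻¹) i (covMatrix g (fun y => (riem g y)⁻¹) x a)))
          T T| ≤ 4 * (k * (2 * P * compSq T)) := by
    calc _ ≤ ∑ _a : Fin 4, ∑ _i : Fin k, 2 * P * compSq T := by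
          refine (Finset.abs_sum_le_sum_abs _ _).trans (Finset.sum_le_sum fun a _ => ?_)
          refine (Finset.abs_sum_le_sum_abs _ _).trans (Finset.sum_le_sum fun i _ => ?_)
          refine b2 _ _ (hcur a) fun l => ?_
          by_cases h : l = i
          · subst h; simpa using hcov a
          · simpa [Function.update_of_ne h] using hri'
      _ = _ := by simp
  have hPT : P * compSq T ≤ C ^ 2 * P * compSq T := by
    have : 0 ≤ P * compSq T := by positivity
    nlinarith
  have hk : (k : ℝ) * (P * compSq T) ≤ k * (C ^ 2 * P * compSq T) :=
    mul_le_mul_of_nonneg_left hPT (Nat.cast_nonneg k)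
  have hXX : 0 ≤ C ^ 2 * P * (70 + 8 * k) * compSq X := by positivity
  have hYY : 0 ≤ C ^ 2 * P * (70 + 8 * k) * ∑ a, ∑ d, compSq (Y a d) := by positivity
  have hTT : 0 ≤ C ^ 2 * P * compSq T := by positivity
  rw [abs_le] at t1 t2 t3 t4
  linarith [t1.1, t2.1, t3.2, t4.2]

end PointwiseBound

/-! ### Commutators of covariant derivatives -/

section Commutator

variable {U : Set Pt} {g : MetricField} {x : Pt} {k : ℕ} {u : Pt → ℝ}

theorem slotAction_cons (Γ : Matrix (Fin 4) (Fin 4) ℝ) (S : Tens (k + 1)) (b : Fin 4)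
    (J : Fin k → Fin 4) : slotAction Γ S (Fin.cons b J)
      = (∑ c, Γ c b * S (Fin.cons c J)) + slotAction Γ (fun I => S (Fin.cons b I)) J := by
  unfold slotAction
  rw [Fin.sum_univ_succ]
  simp only [Fin.update_cons_zero, Fin.cons_zero, Fin.cons_succ, Fin.cons_update]

theorem iterCov_cons (g : MetricField) (u : Pt → ℝ) (k : ℕ) (x : Pt) (a : Fin 4)
    (I : Fin k → Fin 4) :
    iterCov g u (k + 1) x (Fin.cons a I) = covSlice g (iterCov g u k) x a I := rfl

theorem covSlice_congr (hU : IsOpen U) (hx : x ∈ U) {S T : Pt → Tens k}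
    (h : ∀ y ∈ U, ∀ I, S y I = T y I) (a : Fin 4) (I : Fin k → Fin 4) :
    covSlice g S x a I = covSlice g T x a I := by
  rw [covSlice_eq, covSlice_eq, pd_congr_of_isOpen hU hx fun y hy => h y hy I]
  congr 2
  exact funext (h x hx)

theorem covSlice_sub {S T : Pt → Tens k} (hS : ∀ I, DifferentiableAt ℝ (fun y => S y I) x)
    (hT : ∀ I, DifferentiableAt ℝ (fun y => T y I) x) (a : Fin 4) (I : Fin k → Fin 4) :
    covSlice g (fun y I => S y I - T y I) x a I = covSlice g S x a I - covSlice g T x a I := by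
  simp only [covSlice_eq, slotAction]
  rw [pd_sub (hS I) (hT I)]
  simp only [mul_sub, Finset.sum_sub_distrib]
  ring

/-- Exchange of the first two indices. -/
def swapIdx (S : Tens (k + 2)) : Tens (k + 2) := fun I =>
  S (Fin.cons (I 1) (Fin.cons (I 0) (Fin.tail (Fin.tail I))))

theorem swapIdx_cons (S : Tens (k + 2)) (a b : Fin 4) (J : Fin k → Fin 4) :
    swapIdx S (Fin.cons a (Fin.cons b J)) = S (Fin.cons b (Fin.cons a J)) := rfl

/-- The connection acts on all slots alike, so covariant differentiation commutes with permuting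
them. -/
theorem covSlice_swapIdx (S : Pt → Tens (k + 2)) (p a b : Fin 4) (J : Fin k → Fin 4) :
    covSlice g (fun y => swapIdx (S y)) x p (Fin.cons a (Fin.cons b J))
      = covSlice g S x p (Fin.cons b (Fin.cons a J)) := by
  simp only [covSlice_eq, slotAction_cons, swapIdx_cons]
  ring

/-- The commutator of two covariant derivatives does not involve derivatives of the field. -/
theorem covDeriv_commutator (hU : IsOpen U) (hm : IsTimeMetric U g) (hx : x ∈ U)
    {T : Pt → Tens k} (hT : ∀ I, ContDiffOn ℝ ∞ (fun y => T y I) U) (a b : Fin 4)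
    (J : Fin k → Fin 4) :
    covSlice g (covDeriv g T) x a (Fin.cons b J) - covSlice g (covDeriv g T) x b (Fin.cons a J)
      = (∑ i, ∑ c, (pd b (fun y => christoffel g y c a (J i)) x
            - pd a (fun y => christoffel g y c b (J i)) x) * T x (Function.update J i c))
        + slotAction (connMatrix g x a) (slotAction (connMatrix g x b) (T x)) J
        - slotAction (connMatrix g x b) (slotAction (connMatrix g x a) (T x)) J := by
  have dT : ∀ I, DifferentiableAt ℝ (fun y => T y I) x :=
    fun I => differentiableAt_of_smooth hU (hT I) hx
  have dpT : ∀ b I, DifferentiableAt ℝ (pd b fun y => T y I) x :=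
    fun b I => differentiableAt_of_smooth hU (contDiffOn_pd hU (hT I) b) hx
  have dΓ : ∀ c a b, DifferentiableAt ℝ (fun y => christoffel g y c a b) x :=
    fun c a b => differentiableAt_of_smooth hU (hm.smooth_christoffel hU c a b) hx
  -- In this expansion the terms with derivatives of `T` are symmetric in `a, b` as a whole: second
  -- partials commute, the two mixed sums exchange roles, and `Γ^c_{ab}` is symmetric. Only `∂Γ` and
  -- `ΓΓ` survive antisymmetrisation.
  have key : ∀ a b, covSlice g (covDeriv g T) x a (Fin.cons b J)
      = pd a (pd b fun y => T y J) x
        - (∑ i, ∑ c, pd a (fun y => christoffel g y c b (J i)) x * T x (Function.update J i c))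
        - (∑ i, ∑ c, christoffel g x c b (J i) * pd a (fun y => T y (Function.update J i c)) x)
        - (∑ c, christoffel g x c a b * covSlice g T x c J)
        - (∑ i, ∑ c, christoffel g x c a (J i) * pd b (fun y => T y (Function.update J i c)) x)
        + slotAction (connMatrix g x a) (slotAction (connMatrix g x b) (T x)) J := by
    intro a b
    rw [covSlice_eq, slotAction_cons]
    have e1 : pd a (fun y => covDeriv g T y (Fin.cons b J)) x = pd a (fun y => pd b (fun y => T y J) y
        - ∑ i, ∑ c, christoffel g y c b (J i) * T y (Function.update J i c)) x := by
      congr 1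
    rw [e1, pd_sub (dpT _ _) (DifferentiableAt.fun_sum fun i _ => DifferentiableAt.fun_sum fun c _ =>
      (dΓ _ _ _).fun_mul (dT _)), pd_sum fun i _ => DifferentiableAt.fun_sum fun c _ =>
      (dΓ _ _ _).fun_mul (dT _)]
    simp only [pd_sum fun c _ => (dΓ _ _ _).fun_mul (dT _), pd_mul (dΓ _ _ _) (dT _),
      Finset.sum_add_distrib]
    have e2 : slotAction (connMatrix g x a) (fun I => covDeriv g T x (Fin.cons b I)) J
        = (∑ i, ∑ c, christoffel g x c a (J i) * pd b (fun y => T y (Function.update J i c)) x)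
          - slotAction (connMatrix g x a) (slotAction (connMatrix g x b) (T x)) J := by
      have : (fun I => covDeriv g T x (Fin.cons b I)) = fun I => pd b (fun y => T y I) x
          - slotAction (connMatrix g x b) (T x) I := funext fun I => covSlice_eq T b I
      rw [this]
      simp only [slotAction, mul_sub, Finset.sum_sub_distrib]
      rfl
    rw [e2]
    have e3 : ∑ c, connMatrix g x a c b * covDeriv g T x (Fin.cons c J)
        = ∑ c, christoffel g x c a b * covSlice g T x c J := rfl
    rw [e3]
    ring
  rw [key, key, pd_comm hU (hT J) hx a b]
  simp only [sub_mul, Finset.sum_sub_distrib, hm.christoffel_symm hU hx _ a b]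
  ring

/-- The trace of the first two indices with respect to the metric. -/
def traceIdx (g : MetricField) (x : Pt) (S : Tens (k + 2)) : Tens k := fun I =>
  ∑ a, ∑ c, (g x)⁻¹ a c * S (Fin.cons a (Fin.cons c I))

/-- The trace commutes with `∇` because `∇g⁻¹ = 0`. -/
theorem covSlice_traceIdx (hU : IsOpen U) (hm : IsTimeMetric U g) (hx : x ∈ U)
    {S : Pt → Tens (k + 2)} (hS : ∀ I, DifferentiableAt ℝ (fun y => S y I) x) (p : Fin 4)
    (I : Fin k → Fin 4) :
    covSlice g (fun y => traceIdx g y (S y)) x p I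
      = ∑ a, ∑ c, (g x)⁻¹ a c * covSlice g S x p (Fin.cons a (Fin.cons c I)) := by
  have di : ∀ b c, DifferentiableAt ℝ (fun y => (g y)⁻¹ b c) x :=
    fun b c => differentiableAt_of_smooth hU (hm.smooth_inv b c) hx
  have e1 : pd p (fun y => traceIdx g y (S y) I) x
      = ∑ a, ∑ c, (pd p (fun y => (g y)⁻¹ a c) x * S x (Fin.cons a (Fin.cons c I))
        + (g x)⁻¹ a c * pd p (fun y => S y (Fin.cons a (Fin.cons c I))) x) := by
    unfold traceIdx
    rw [pd_sum fun a _ => DifferentiableAt.fun_sum fun c _ => (di _ _).fun_mul (hS _)]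
    simp only [pd_sum fun c _ => (di _ _).fun_mul (hS _), pd_mul (di _ _) (hS _)]
  have e2 : slotAction (connMatrix g x p) (traceIdx g x (S x)) I
      = ∑ a, ∑ c, (g x)⁻¹ a c * slotAction (connMatrix g x p)
          (fun J => S x (Fin.cons a (Fin.cons c J))) I := by
    simp only [slotAction, traceIdx, Finset.mul_sum]
    rw [Finset.sum_congr rfl fun i _ => Finset.sum_comm, Finset.sum_comm]
    refine Finset.sum_congr rfl fun a _ => ?_
    rw [Finset.sum_congr rfl fun i _ => Finset.sum_comm, Finset.sum_comm]
    exact Finset.sum_congr rfl fun c _ => Finset.sum_congr rfl fun i _ =>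
      Finset.sum_congr rfl fun d _ => by ring
  simp only [covSlice_eq, slotAction_cons]
  rw [e1, e2]
  simp only [hm.pd_inv hU hx, connMatrix, Matrix.of_apply, Fin.sum_univ_four]
  ring

/-- The d'Alembertian is the trace of the second covariant derivative. -/
theorem box_eq_trace (hU : IsOpen U) (hm : IsTimeMetric U g) (hx : x ∈ U)
    (hu : ContDiffOn ℝ ∞ u U) (I : Fin 0 → Fin 4) :
    box g u x = traceIdx g x (iterCov g u 2 x) I := by
  have di : ∀ b c, DifferentiableAt ℝ (fun y => (g y)⁻¹ b c) x :=
    fun b c => differentiableAt_of_smooth hU (hm.smooth_inv b c) hx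
  have dpu : ∀ b, DifferentiableAt ℝ (pd b u) x :=
    fun b => differentiableAt_of_smooth hU (contDiffOn_pd hU hu b) hx
  have hX : ∀ a, DifferentiableAt ℝ (fun y => ∑ b, (g y)⁻¹ a b * pd b u y) x :=
    fun a => DifferentiableAt.fun_sum fun b _ => (di _ _).fun_mul (dpu _)
  have hv := (hm.volDensity_pos hx).ne'
  have i1 : ∀ y c (J : Fin 0 → Fin 4), iterCov g u 1 y (Fin.cons c J) = pd c u y := by
    intro y c J
    rw [iterCov_cons, covSlice_eq]
    simp [slotAction, iterCov]
  have i2 : ∀ a c (J : Fin 0 → Fin 4), iterCov g u 2 x (Fin.cons a (Fin.cons c J))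
      = pd a (pd c u) x - ∑ d, christoffel g x d a c * pd d u x := by
    intro a c J
    rw [iterCov_cons, covSlice_eq, slotAction_cons]
    simp only [i1, connMatrix, Matrix.of_apply]
    simp [slotAction]
  unfold box
  rw [hm.sum_pd_volDensity_mul hU hx hX, inv_mul_cancel_left₀ hv]
  simp only [traceIdx, i2]
  have e : ∀ a, pd a (fun y => ∑ b, (g y)⁻¹ a b * pd b u y) x
      = ∑ b, (pd a (fun y => (g y)⁻¹ a b) x * pd b u x + (g x)⁻¹ a b * pd a (pd b u) x) := by
    intro a
    rw [pd_sum fun b _ => (di _ _).fun_mul (dpu _)]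
    exact Finset.sum_congr rfl fun b _ => pd_mul (di _ _) (dpu _)
  simp only [e, hm.pd_inv hU hx]
  simp only [Fin.sum_univ_four]
  ring

theorem smooth_box (hU : IsOpen U) (hm : IsTimeMetric U g) (hu : ContDiffOn ℝ ∞ u U) :
    ContDiffOn ℝ ∞ (box g u) U := by
  have h : ContDiffOn ℝ ∞ (fun x => traceIdx g x (iterCov g u 2 x) default) U :=
    ContDiffOn.sum fun a _ => ContDiffOn.sum fun c _ =>
      (hm.smooth_inv a c).mul (smooth_iterCov hU hm hu _ _)
  exact h.congr fun x hx => box_eq_trace hU hm hx hu _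

theorem iterCov_congr (hU : IsOpen U) {f h : Pt → ℝ} (hfh : ∀ x ∈ U, f x = h x) :
    ∀ (k : ℕ) (x : Pt), x ∈ U → ∀ I, iterCov g f k x I = iterCov g h k x I
  | 0, x, hx, _ => hfh x hx
  | k + 1, x, hx, I => by
      have := covSlice_congr (g := g) hU hx (iterCov_congr hU hfh k) (I 0) (Fin.tail I)
      rw [covSlice, covSlice, Fin.cons_self_tail] at this
      exact this

/-- The error in commuting the d'Alembertian with iterated covariant derivatives. -/
def boxError (g : MetricField) (u : Pt → ℝ) (k : ℕ) (x : Pt) : Tens k := fun I =>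
  traceIdx g x (iterCov g u (k + 2) x) I - iterCov g (box g u) k x I

/-- The commutator of the first two derivatives in an iterated covariant derivative. -/
def commError (g : MetricField) (u : Pt → ℝ) (k : ℕ) (x : Pt) : Tens (k + 2) := fun I =>
  iterCov g u (k + 2) x I - swapIdx (iterCov g u (k + 2) x) I

/-- In `g^{ac} ∇_a ∇_c ∇_p` the index `p` is moved to the front in two exchanges: past `c`, which
leaves `∇_a` of a commutator, and then past `a`, which leaves a commutator one order higher. What
remains is `∇_p` of the previous error. -/
theorem boxError_succ (hU : IsOpen U) (hm : IsTimeMetric U g) (hx : x ∈ U)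
    (hu : ContDiffOn ℝ ∞ u U) (k : ℕ) (p : Fin 4) (I : Fin k → Fin 4) :
    boxError g u (k + 1) x (Fin.cons p I)
      = (∑ a, ∑ c, (g x)⁻¹ a c
          * (covSlice g (commError g u k) x a (Fin.cons c (Fin.cons p I))
            + commError g u (k + 1) x (Fin.cons a (Fin.cons p (Fin.cons c I)))))
        + covSlice g (boxError g u k) x p I := by
  have dc : ∀ k I, DifferentiableAt ℝ (fun y => iterCov g u k y I) x :=
    fun k I => differentiableAt_of_smooth hU (smooth_iterCov hU hm hu k I) hx
  have db : ∀ I, DifferentiableAt ℝ (fun y => iterCov g (box g u) k y I) x :=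
    fun I => differentiableAt_of_smooth hU (smooth_iterCov hU hm (smooth_box hU hm hu) k I) hx
  have di : ∀ b c, DifferentiableAt ℝ (fun y => (g y)⁻¹ b c) x :=
    fun b c => differentiableAt_of_smooth hU (hm.smooth_inv b c) hx
  have h1 : ∀ a c, covSlice g (commError g u k) x a (Fin.cons c (Fin.cons p I))
      = iterCov g u (k + 3) x (Fin.cons a (Fin.cons c (Fin.cons p I)))
        - iterCov g u (k + 3) x (Fin.cons a (Fin.cons p (Fin.cons c I))) := by
    intro a c
    rw [iterCov_cons, iterCov_cons, ← covSlice_swapIdx (iterCov g u (k + 2)) a c p I]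
    exact covSlice_sub (T := fun y => swapIdx (iterCov g u (k + 2) y)) (dc _) (fun I => dc _ _) _ _
  have h2 : covSlice g (boxError g u k) x p I
      = (∑ a, ∑ c, (g x)⁻¹ a c * iterCov g u (k + 3) x (Fin.cons p (Fin.cons a (Fin.cons c I))))
        - iterCov g (box g u) (k + 1) x (Fin.cons p I) := by
    have := covSlice_sub (g := g) (S := fun y => traceIdx g y (iterCov g u (k + 2) y))
      (T := iterCov g (box g u) k) (x := x) (fun I => DifferentiableAt.fun_sum fun a _ =>
        DifferentiableAt.fun_sum fun c _ => (di _ _).fun_mul (dc _ _)) db p I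
    refine this.trans ?_
    rw [covSlice_traceIdx hU hm hx (dc _)]
    rfl
  rw [h2]
  simp only [h1]
  simp only [boxError, traceIdx, commError, swapIdx_cons, mul_add, mul_sub]
  simp only [Finset.sum_add_distrib, Finset.sum_sub_distrib]
  ring

end Commutator

/-! ### Families of functions of order `O(ε^{-s})` -/

section Order

open Filter

variable {U : Set Pt} {s s' : ℕ} {q r : ℝ → Pt → ℝ}

/-- Derivatives of order `i ≤ n` are `O(ε^{-s-i})` on compact sets. -/
def OrderBound (U : Set Pt) : ℕ → ℕ → (ℝ → Pt → ℝ) → Prop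
  | 0, s, q => ∀ K : Set Pt, IsCompact K → K ⊆ U → ∃ C : ℝ,
      ∀ᶠ ε in 𝓝[>] (0 : ℝ), ∀ x ∈ K, |q ε x| ≤ C / ε ^ s
  | n + 1, s, q => OrderBound U 0 s q ∧ ∀ a, OrderBound U n (s + 1) fun ε => pd a (q ε)

theorem orderBound_zero : OrderBound U 0 s q ↔ ∀ K : Set Pt, IsCompact K → K ⊆ U → ∃ C : ℝ,
    ∀ᶠ ε in 𝓝[>] (0 : ℝ), ∀ x ∈ K, |q ε x| ≤ C / ε ^ s := by
  rw [OrderBound]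

theorem orderBound_succ {n : ℕ} : OrderBound U (n + 1) s q ↔
    OrderBound U 0 s q ∧ ∀ a, OrderBound U n (s + 1) fun ε => pd a (q ε) := by
  simp only [OrderBound]

/-- A family of smooth functions of order `O(ε^{-s})`, each derivative of which costs one more
power of `ε`. -/
structure HasOrder (U : Set Pt) (s : ℕ) (q : ℝ → Pt → ℝ) : Prop where
  smooth : ∀ᶠ ε in 𝓝[>] (0 : ℝ), ContDiffOn ℝ ∞ (q ε) U
  bound : ∀ n, OrderBound U n s q

theorem eventually_pos_le_one : ∀ᶠ ε in 𝓝[>] (0 : ℝ), 0 < ε ∧ ε ≤ 1 := by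
  filter_upwards [Ioc_mem_nhdsGT (zero_lt_one (α := ℝ))] with ε hε using hε

theorem OrderBound.of_succ : ∀ {n s : ℕ} {q : ℝ → Pt → ℝ},
    OrderBound U (n + 1) s q → OrderBound U n s q
  | 0, _, _, h => (orderBound_succ.1 h).1
  | _ + 1, _, _, h => orderBound_succ.2 ⟨(orderBound_succ.1 h).1,
      fun a => ((orderBound_succ.1 h).2 a).of_succ⟩

theorem OrderBound.congr (hU : IsOpen U) : ∀ {n s : ℕ} {q r : ℝ → Pt → ℝ},
    OrderBound U n s q → (∀ᶠ ε in 𝓝[>] (0 : ℝ), ∀ x ∈ U, q ε x = r ε x) → OrderBound U n s r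
  | 0, _, _, _, h, hqr => orderBound_zero.2 fun K hK hKU => by
      obtain ⟨C, hC⟩ := orderBound_zero.1 h K hK hKU
      refine ⟨C, ?_⟩
      filter_upwards [hC, hqr] with ε h1 h2 x hx
      rw [← h2 x (hKU hx)]
      exact h1 x hx
  | n + 1, s, q, r, h, hqr => by
      rw [orderBound_succ] at h ⊢
      refine ⟨OrderBound.congr hU (n := 0) h.1 hqr, fun a => OrderBound.congr hU (h.2 a) ?_⟩
      filter_upwards [hqr] with ε h2 x hx
      exact pd_congr_of_isOpen hU hx h2

theorem OrderBound.mono : ∀ {n s s' : ℕ} {q : ℝ → Pt → ℝ}, s ≤ s' →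
    OrderBound U n s q → OrderBound U n s' q
  | 0, s, s', q, hs, h => orderBound_zero.2 fun K hK hKU => by
      obtain ⟨C, hC⟩ := orderBound_zero.1 h K hK hKU
      refine ⟨max C 0, ?_⟩
      filter_upwards [hC, eventually_pos_le_one] with ε h1 hε x hx
      have hp : 0 < ε ^ s' := pow_pos hε.1 _
      calc |q ε x| ≤ C / ε ^ s := h1 x hx
        _ ≤ max C 0 / ε ^ s := by
            have := pow_pos hε.1 s
            gcongr; exact le_max_left _ _
        _ ≤ max C 0 / ε ^ s' :=
            div_le_div_of_nonneg_left (le_max_right _ _) hp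
              (pow_le_pow_of_le_one hε.1.le hε.2 hs)
  | n + 1, _, _, _, hs, h => by
      rw [orderBound_succ] at h ⊢
      exact ⟨OrderBound.mono (n := 0) hs h.1,
        fun a => OrderBound.mono (Nat.succ_le_succ hs) (h.2 a)⟩

theorem OrderBound.add (hU : IsOpen U) : ∀ {n s : ℕ} {q r : ℝ → Pt → ℝ},
    (∀ᶠ ε in 𝓝[>] (0 : ℝ), ContDiffOn ℝ ∞ (q ε) U) →
    (∀ᶠ ε in 𝓝[>] (0 : ℝ), ContDiffOn ℝ ∞ (r ε) U) →
    OrderBound U n s q → OrderBound U n s r → OrderBound U n s fun ε x => q ε x + r ε x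
  | 0, _, _, _, _, _, h, h' => orderBound_zero.2 fun K hK hKU => by
      obtain ⟨C, hC⟩ := orderBound_zero.1 h K hK hKU
      obtain ⟨C', hC'⟩ := orderBound_zero.1 h' K hK hKU
      refine ⟨C + C', ?_⟩
      filter_upwards [hC, hC'] with ε h1 h2 x hx
      rw [add_div]
      exact (abs_add_le _ _).trans (add_le_add (h1 x hx) (h2 x hx))
  | n + 1, s, q, r, hq, hr, h, h' => by
      rw [orderBound_succ] at h h' ⊢
      refine ⟨OrderBound.add hU (n := 0) hq hr h.1 h'.1, fun a => ?_⟩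
      refine OrderBound.congr hU (OrderBound.add hU ?_ ?_ (h.2 a) (h'.2 a)) ?_
      · filter_upwards [hq] with ε h1 using contDiffOn_pd hU h1 a
      · filter_upwards [hr] with ε h1 using contDiffOn_pd hU h1 a
      · filter_upwards [hq, hr] with ε h1 h2 x hx
        exact (pd_add (differentiableAt_of_smooth hU h1 hx)
          (differentiableAt_of_smooth hU h2 hx)).symm

theorem OrderBound.mul (hU : IsOpen U) : ∀ {n s s' : ℕ} {q r : ℝ → Pt → ℝ},
    (∀ᶠ ε in 𝓝[>] (0 : ℝ), ContDiffOn ℝ ∞ (q ε) U) →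
    (∀ᶠ ε in 𝓝[>] (0 : ℝ), ContDiffOn ℝ ∞ (r ε) U) →
    OrderBound U n s q → OrderBound U n s' r → OrderBound U n (s + s') fun ε x => q ε x * r ε x
  | 0, s, s', q, r, _, _, h, h' => orderBound_zero.2 fun K hK hKU => by
      obtain ⟨C, hC⟩ := orderBound_zero.1 h K hK hKU
      obtain ⟨C', hC'⟩ := orderBound_zero.1 h' K hK hKU
      refine ⟨C * C', ?_⟩
      filter_upwards [hC, hC'] with ε h1 h2 x hx
      rw [abs_mul, pow_add, ← div_mul_div_comm]
      exact mul_le_mul (h1 x hx) (h2 x hx) (abs_nonneg _) ((abs_nonneg _).trans (h1 x hx))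
  | n + 1, s, s', q, r, hq, hr, h, h' => by
      have hq' : ∀ a, ∀ᶠ ε in 𝓝[>] (0 : ℝ), ContDiffOn ℝ ∞ (pd a (q ε)) U := fun a => by
        filter_upwards [hq] with ε h1 using contDiffOn_pd hU h1 a
      have hr' : ∀ a, ∀ᶠ ε in 𝓝[>] (0 : ℝ), ContDiffOn ℝ ∞ (pd a (r ε)) U := fun a => by
        filter_upwards [hr] with ε h1 using contDiffOn_pd hU h1 a
      have hs := h.of_succ
      have hs' := h'.of_succ
      rw [orderBound_succ] at h h' ⊢
      refine ⟨OrderBound.mul hU (n := 0) hq hr h.1 h'.1, fun a => ?_⟩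
      have t1 := OrderBound.mul hU (hq' a) hr (h.2 a) hs'
      have t2 := OrderBound.mul hU hq (hr' a) hs (h'.2 a)
      rw [show s + 1 + s' = s + s' + 1 by ring] at t1
      rw [show s + (s' + 1) = s + s' + 1 by ring] at t2
      refine OrderBound.congr hU (OrderBound.add hU ?_ ?_ t1 t2) ?_
      · filter_upwards [hq' a, hr] with ε h1 h2 using h1.mul h2
      · filter_upwards [hq, hr' a] with ε h1 h2 using h1.mul h2
      · filter_upwards [hq, hr] with ε h1 h2 x hx
        exact (pd_mul (differentiableAt_of_smooth hU h1 hx)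
          (differentiableAt_of_smooth hU h2 hx)).symm

theorem orderBound_const (c : ℝ) : ∀ n, OrderBound U n 0 fun _ _ => c := by
  -- The zero family is handled for every `s` at once, since each differentiation in the recursion
  -- raises `s`.
  have hz : ∀ n s, OrderBound U n s fun _ _ => (0 : ℝ) := by
    intro n
    induction n with
    | zero => exact fun s => orderBound_zero.2 fun K _ _ => ⟨0, Eventually.of_forall fun ε x _ => by simp⟩
    | succ n ih =>
      refine fun s => orderBound_succ.2 ⟨orderBound_zero.2 fun K _ _ =>
        ⟨0, Eventually.of_forall fun ε x _ => by simp⟩, fun a => ?_⟩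
      have : (fun (_ : ℝ) => pd a fun _ => (0 : ℝ)) = fun _ _ => 0 := by
        funext ε x; exact pd_const 0
      rw [this]
      exact ih _
  have h0 : OrderBound U 0 0 fun _ _ => c :=
    orderBound_zero.2 fun K _ _ => ⟨|c|, Eventually.of_forall fun ε x _ => by simp⟩
  intro n
  cases n with
  | zero => exact h0
  | succ n =>
    refine orderBound_succ.2 ⟨h0, fun a => ?_⟩
    have : (fun (_ : ℝ) => pd a fun _ => c) = fun _ _ => 0 := by
      funext ε x; exact pd_const c
    rw [this]
    exact hz _ _

/-- `iterPd` adds derivatives on the outside, whereas the recursion of `OrderBound` differentiates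
the innermost function first; this reconciles the two orders. -/
theorem iterPd_append (l : List (Fin 4)) (a : Fin 4) (f : Pt → ℝ) :
    iterPd (l ++ [a]) f = iterPd l (pd a f) := by
  induction l with
  | nil => rfl
  | cons b l ih => simp only [List.cons_append, iterPd, ih]

theorem orderBound_of_iterPd : ∀ (n : ℕ) {s : ℕ} {q : ℝ → Pt → ℝ},
    (∀ K : Set Pt, IsCompact K → K ⊆ U → ∀ l : List (Fin 4), ∃ C : ℝ,
      ∀ᶠ ε in 𝓝[>] (0 : ℝ), ∀ x ∈ K, |iterPd l (q ε) x| ≤ C / ε ^ (s + l.length)) →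
    OrderBound U n s q
  | 0, _, _, h => orderBound_zero.2 fun K hK hKU => h K hK hKU []
  | n + 1, s, q, h => by
      refine orderBound_succ.2 ⟨orderBound_zero.2 fun K hK hKU => h K hK hKU [],
        fun a => orderBound_of_iterPd n ?_⟩
      intro K hK hKU l
      obtain ⟨C, hC⟩ := h K hK hKU (l ++ [a])
      refine ⟨C, ?_⟩
      filter_upwards [hC] with ε h1 x hx
      have := h1 x hx
      rw [iterPd_append, List.length_append, List.length_singleton] at this
      rwa [show s + 1 + l.length = s + (l.length + 1) by ring]

namespace HasOrder

theorem pd (hU : IsOpen U) (h : HasOrder U s q) (a : Fin 4) :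
    HasOrder U (s + 1) fun ε => SingularWave.pd a (q ε) where
  smooth := by filter_upwards [h.smooth] with ε h1 using contDiffOn_pd hU h1 a
  bound n := (orderBound_succ.1 (h.bound (n + 1))).2 a

theorem congr (hU : IsOpen U) (h : HasOrder U s q)
    (hqr : ∀ᶠ ε in 𝓝[>] (0 : ℝ), ∀ x ∈ U, q ε x = r ε x) : HasOrder U s r where
  smooth := by
    filter_upwards [h.smooth, hqr] with ε h1 h2 using h1.congr fun x hx => (h2 x hx).symm
  bound n := (h.bound n).congr hU hqr

theorem mono (hs : s ≤ s') (h : HasOrder U s q) : HasOrder U s' q :=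
  ⟨h.smooth, fun n => (h.bound n).mono hs⟩

theorem add (hU : IsOpen U) (h : HasOrder U s q) (h' : HasOrder U s r) :
    HasOrder U s fun ε x => q ε x + r ε x where
  smooth := by filter_upwards [h.smooth, h'.smooth] with ε h1 h2 using h1.add h2
  bound n := .add hU h.smooth h'.smooth (h.bound n) (h'.bound n)

theorem mul (hU : IsOpen U) (h : HasOrder U s q) (h' : HasOrder U s' r) :
    HasOrder U (s + s') fun ε x => q ε x * r ε x where
  smooth := by filter_upwards [h.smooth, h'.smooth] with ε h1 h2 using h1.mul h2
  bound n := .mul hU h.smooth h'.smooth (h.bound n) (h'.bound n)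

theorem const (c : ℝ) : HasOrder U 0 fun _ _ => c :=
  ⟨Eventually.of_forall fun _ => contDiffOn_const, orderBound_const c⟩

theorem const_mul (hU : IsOpen U) (c : ℝ) (h : HasOrder U s q) :
    HasOrder U s fun ε x => c * q ε x := by
  simpa using (const c).mul hU h

theorem sub (hU : IsOpen U) (h : HasOrder U s q) (h' : HasOrder U s r) :
    HasOrder U s fun ε x => q ε x - r ε x :=
  (h.add hU (h'.const_mul hU (-1))).congr hU (Eventually.of_forall fun _ _ _ => by ring)

theorem sum (hU : IsOpen U) {ι : Type*} (t : Finset ι) {Q : ι → ℝ → Pt → ℝ}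
    (h : ∀ i ∈ t, HasOrder U s (Q i)) : HasOrder U s fun ε x => ∑ i ∈ t, Q i ε x := by
  classical
  induction t using Finset.induction_on with
  | empty => simpa using (const 0).mono (Nat.zero_le s)
  | insert i t hi ih =>
    simp only [Finset.sum_insert hi]
    exact (h i (Finset.mem_insert_self _ _)).add hU
      (ih fun j hj => h j (Finset.mem_insert_of_mem hj))

end HasOrder

end Order

/-! ### Expressions of lower order in the derivatives of the field -/

section LowerOrder

open Filter

variable {U : Set Pt} {g : ℝ → MetricField} {m m' w w' s : ℕ} {F F' : ℝ → (Pt → ℝ) → Pt → ℝ}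

/-- Linear expressions in `∇^{(l)} u`, `1 ≤ l ≤ m`, with coefficients of order `O(ε^{-(w-l)})`. -/
inductive IsLower (U : Set Pt) (g : ℝ → MetricField) (m w : ℕ) :
    (ℝ → (Pt → ℝ) → Pt → ℝ) → Prop
  | zero : IsLower U g m w fun _ _ _ => 0
  | term (l : ℕ) (hl : 1 ≤ l) (hlm : l ≤ m) (s : ℕ) (hs : s + l ≤ w) (q : ℝ → Pt → ℝ)
      (hq : HasOrder U s q) (J : Fin l → Fin 4) :
      IsLower U g m w fun ε u x => q ε x * iterCov (g ε) u l x J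
  | add (F F' : ℝ → (Pt → ℝ) → Pt → ℝ) : IsLower U g m w F → IsLower U g m w F' →
      IsLower U g m w fun ε u x => F ε u x + F' ε u x
  | congr (F F' : ℝ → (Pt → ℝ) → Pt → ℝ) : IsLower U g m w F →
      (∀ᶠ ε in 𝓝[>] (0 : ℝ), ∀ u, ContDiffOn ℝ ∞ u U → ∀ x ∈ U, F ε u x = F' ε u x) →
      IsLower U g m w F'

namespace IsLower

theorem mono (hm : m ≤ m') (hw : w ≤ w') (h : IsLower U g m w F) : IsLower U g m' w' F := by
  induction h with
  | zero => exact zero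
  | term l hl hlm s hs q hq J => exact term l hl (hlm.trans hm) s (hs.trans hw) q hq J
  | add F F' _ _ h h' => exact add _ _ h h'
  | congr F F' _ hF h => exact congr _ _ h hF

theorem mul (hU : IsOpen U) {q : ℝ → Pt → ℝ} (hq : HasOrder U s q) (h : IsLower U g m w F) :
    IsLower U g m (s + w) fun ε u x => q ε x * F ε u x := by
  induction h with
  | zero => simpa using zero
  | term l hl hlm s' hs r hr J =>
    refine congr _ _ (term l hl hlm (s + s') (by omega) _ (hq.mul hU hr) J) ?_
    exact Eventually.of_forall fun ε u _ x _ => by ring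
  | add F F' _ _ h h' =>
    exact congr _ _ (add _ _ h h') (Eventually.of_forall fun ε u _ x _ => by ring)
  | congr F F' _ hF h =>
    refine congr _ _ h ?_
    filter_upwards [hF] with ε h1 u hu x hx
    rw [h1 u hu x hx]

theorem neg (hU : IsOpen U) (h : IsLower U g m w F) :
    IsLower U g m w fun ε u x => -F ε u x := by
  have := mul hU (HasOrder.const (-1)) h
  rw [zero_add] at this
  exact congr _ _ this (Eventually.of_forall fun ε u _ x _ => by ring)

theorem sub (hU : IsOpen U) (h : IsLower U g m w F) (h' : IsLower U g m w F') :
    IsLower U g m w fun ε u x => F ε u x - F' ε u x :=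
  congr _ _ (add _ _ h (h'.neg hU)) (Eventually.of_forall fun ε u _ x _ => by ring)

theorem sum {ι : Type*} (t : Finset ι) {G : ι → ℝ → (Pt → ℝ) → Pt → ℝ}
    (h : ∀ i ∈ t, IsLower U g m w (G i)) :
    IsLower U g m w fun ε u x => ∑ i ∈ t, G i ε u x := by
  classical
  induction t using Finset.induction_on with
  | empty => simpa using zero
  | insert i t hi ih =>
    simp only [Finset.sum_insert hi]
    exact add _ _ (h i (Finset.mem_insert_self _ _))
      (ih fun j hj => h j (Finset.mem_insert_of_mem hj))

theorem smooth (hU : IsOpen U) (hg : ∀ᶠ ε in 𝓝[>] (0 : ℝ), IsTimeMetric U (g ε))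
    (h : IsLower U g m w F) : ∀ᶠ ε in 𝓝[>] (0 : ℝ), ∀ u, ContDiffOn ℝ ∞ u U →
      ContDiffOn ℝ ∞ (F ε u) U := by
  induction h with
  | zero => exact Eventually.of_forall fun _ _ _ => contDiffOn_const
  | term l hl hlm s' hs r hr J =>
    filter_upwards [hg, hr.smooth] with ε h1 h2 u hu using h2.mul (smooth_iterCov hU h1 hu l J)
  | add F F' _ _ h h' =>
    filter_upwards [h, h'] with ε h1 h2 u hu using (h1 u hu).add (h2 u hu)
  | congr F F' _ hF h =>
    filter_upwards [hF, h] with ε h1 h2 u hu using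
      (h2 u hu).congr fun x hx => (h1 u hu x hx).symm

/-- A coefficient of `∇^{(l)} u` of order `s ≤ w - l` has square `O(ε^{-2(w-l)})`. The constant and
the range of `ε` are fixed before `u`, which gives uniformity in the solution. -/
theorem bound (h : IsLower U g m w F) {K : Set Pt} (hK : IsCompact K) (hKU : K ⊆ U) :
    ∃ C : ℝ, 0 ≤ C ∧ ∀ᶠ ε in 𝓝[>] (0 : ℝ), ∀ u, ContDiffOn ℝ ∞ u U → ∀ x ∈ K,
      F ε u x ^ 2 ≤ C * ∑ l ∈ Finset.Icc 1 m,
        1 / ε ^ (2 * (w - l)) * compSq (iterCov (g ε) u l x) := by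
  induction h with
  | zero =>
    refine ⟨0, le_rfl, Eventually.of_forall fun ε u _ x _ => by simp⟩
  | term l hl hlm s hs q hq J =>
    obtain ⟨C, hC⟩ := orderBound_zero.1 ((hq.mono (show s ≤ w - l by omega)).bound 0) K hK hKU
    refine ⟨C ^ 2, sq_nonneg _, ?_⟩
    filter_upwards [hC, eventually_pos_le_one] with ε h1 hε u _ x hx
    have hmem : l ∈ Finset.Icc 1 m := Finset.mem_Icc.2 ⟨hl, hlm⟩
    have hnn : ∀ l, 0 ≤ 1 / ε ^ (2 * (w - l)) * compSq (iterCov (g ε) u l x) := fun l =>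
      mul_nonneg (by have := pow_pos hε.1 (2 * (w - l)); positivity) (compSq_nonneg _)
    have hJ : iterCov (g ε) u l x J ^ 2 ≤ compSq (iterCov (g ε) u l x) :=
      Finset.single_le_sum (f := fun I => iterCov (g ε) u l x I ^ 2)
        (fun I _ => sq_nonneg _) (Finset.mem_univ J)
    have hq2 : q ε x ^ 2 ≤ C ^ 2 * (1 / ε ^ (2 * (w - l))) := by
      have := sq_le_sq' (by linarith [neg_abs_le (q ε x), h1 x hx]) ((le_abs_self _).trans (h1 x hx))
      refine this.trans (le_of_eq ?_)
      rw [div_pow, ← pow_mul, mul_comm 2, mul_one_div]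
    rw [mul_pow]
    calc q ε x ^ 2 * iterCov (g ε) u l x J ^ 2
        ≤ C ^ 2 * (1 / ε ^ (2 * (w - l))) * compSq (iterCov (g ε) u l x) :=
          mul_le_mul hq2 hJ (sq_nonneg _) ((sq_nonneg _).trans hq2)
      _ = C ^ 2 * (1 / ε ^ (2 * (w - l)) * compSq (iterCov (g ε) u l x)) := by ring
      _ ≤ _ := mul_le_mul_of_nonneg_left
          (Finset.single_le_sum (fun l _ => hnn l) hmem) (sq_nonneg _)
  | add F F' _ _ h h' =>
    obtain ⟨C, hC0, hC⟩ := h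
    obtain ⟨C', hC0', hC'⟩ := h'
    refine ⟨2 * C + 2 * C', by positivity, ?_⟩
    filter_upwards [hC, hC'] with ε h1 h2 u hu x hx
    nlinarith [h1 u hu x hx, h2 u hu x hx, sq_nonneg (F ε u x - F' ε u x)]
  | congr F F' _ hF h =>
    obtain ⟨C, hC0, hC⟩ := h
    refine ⟨C, hC0, ?_⟩
    filter_upwards [hC, hF] with ε h1 h2 u hu x hx
    rw [← h2 u hu x (hKU hx)]
    exact h1 u hu x hx

theorem iterCov_of_one_le (hm : 1 ≤ m) (hw : m ≤ w) (J : Fin m → Fin 4) :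
    IsLower U g m w fun ε u x => iterCov (g ε) u m x J :=
  congr _ _ (term m hm le_rfl 0 (by simpa using hw) _ (HasOrder.const 1) J)
    (Eventually.of_forall fun ε u _ x _ => by ring)

theorem slotAction {k : ℕ} (hU : IsOpen U)
    (hΓ : ∀ c a b, HasOrder U 1 fun ε x => christoffel (g ε) x c a b) (a : Fin 4)
    {G : ℝ → (Pt → ℝ) → Pt → Tens k} (hG : ∀ I, IsLower U g m w fun ε u x => G ε u x I)
    (J : Fin k → Fin 4) : IsLower U g m (w + 1) fun ε u x =>
      SingularWave.slotAction (connMatrix (g ε) x a) (G ε u x) J := by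
  rw [add_comm]
  exact sum _ fun i _ => sum _ fun c _ => mul hU (hΓ c a (J i)) (hG _)

/-- A derivative either falls on a coefficient and costs `1/ε`, or produces `∇^{(l+1)} u` together
with a Christoffel symbol of order one times `∇^{(l)} u`. In each case the total weight grows by one
and `l ≥ 1` is preserved. -/
theorem pd (hU : IsOpen U) (hg : ∀ᶠ ε in 𝓝[>] (0 : ℝ), IsTimeMetric U (g ε))
    (hΓ : ∀ c a b, HasOrder U 1 fun ε x => christoffel (g ε) x c a b)
    (h : IsLower U g m w F) (p : Fin 4) :
    IsLower U g (m + 1) (w + 1) fun ε u x => SingularWave.pd p (F ε u) x := by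
  induction h with
  | zero => simpa only [pd_const] using zero
  | term l hl hlm s hs q hq J =>
    have t1 : IsLower U g (m + 1) (w + 1) fun ε u x =>
        SingularWave.pd p (q ε) x * iterCov (g ε) u l x J :=
      term l hl (by omega) (s + 1) (by omega) _ (hq.pd hU p) J
    have t2 : IsLower U g (m + 1) (w + 1) fun ε u x =>
        q ε x * iterCov (g ε) u (l + 1) x (Fin.cons p J) :=
      term (l + 1) (by omega) (by omega) s (by omega) q hq _
    have t3 : IsLower U g (m + 1) (w + 1) fun ε u x =>
        q ε x * SingularWave.slotAction (connMatrix (g ε) x p) (iterCov (g ε) u l x) J :=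
      (mul hU hq ((slotAction hU hΓ p (iterCov_of_one_le hl le_rfl) J))).mono (by omega) (by omega)
    refine congr _ _ (add _ _ t1 (add _ _ t2 t3)) ?_
    filter_upwards [hg, hq.smooth] with ε h1 h2 u hu x hx
    rw [pd_mul (differentiableAt_of_smooth hU h2 hx)
      (differentiableAt_of_smooth hU (smooth_iterCov hU h1 hu l J) hx), iterCov_cons, covSlice_eq]
    ring
  | add F F' hF hF' h h' =>
    refine congr _ _ (add _ _ h h') ?_
    filter_upwards [hF.smooth hU hg, hF'.smooth hU hg] with ε h1 h2 u hu x hx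
    exact (pd_add (differentiableAt_of_smooth hU (h1 u hu) hx)
      (differentiableAt_of_smooth hU (h2 u hu) hx)).symm
  | congr F F' _ hF h =>
    refine congr _ _ h ?_
    filter_upwards [hF] with ε h1 u hu x hx
    exact pd_congr_of_isOpen hU hx (h1 u hu)

theorem covSlice {k : ℕ} (hU : IsOpen U) (hg : ∀ᶠ ε in 𝓝[>] (0 : ℝ), IsTimeMetric U (g ε))
    (hΓ : ∀ c a b, HasOrder U 1 fun ε x => christoffel (g ε) x c a b)
    {G : ℝ → (Pt → ℝ) → Pt → Tens k} (hG : ∀ I, IsLower U g m w fun ε u x => G ε u x I)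
    (p : Fin 4) (J : Fin k → Fin 4) : IsLower U g (m + 1) (w + 1) fun ε u x =>
      SingularWave.covSlice (g ε) (G ε u) x p J := by
  simp only [covSlice_eq]
  exact sub hU ((hG J).pd hU hg hΓ p) ((slotAction hU hΓ p hG J).mono (by omega) le_rfl)

end IsLower

/-- The curvature consists of `∂Γ` and `ΓΓ`, both `O(ε^{-2})`, and acts linearly on `∇^{(k)} u`:
weight `k + 2`. -/
theorem isLower_commError (hU : IsOpen U) (hg : ∀ᶠ ε in 𝓝[>] (0 : ℝ), IsTimeMetric U (g ε))
    (hΓ : ∀ c a b, HasOrder U 1 fun ε x => christoffel (g ε) x c a b) (k : ℕ) (a b : Fin 4)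
    (J : Fin k → Fin 4) :
    IsLower U g k (k + 2) fun ε u x => commError (g ε) u k x (Fin.cons a (Fin.cons b J)) := by
  have hT : 1 ≤ k → ∀ I : Fin k → Fin 4, IsLower U g k k fun ε u x => iterCov (g ε) u k x I :=
    fun hk I => IsLower.iterCov_of_one_le hk le_rfl I
  have t1 : IsLower U g k (k + 2) fun ε u x => ∑ i, ∑ c,
      (pd b (fun y => christoffel (g ε) y c a (J i)) x
        - pd a (fun y => christoffel (g ε) y c b (J i)) x)
        * iterCov (g ε) u k x (Function.update J i c) := by
    refine IsLower.sum _ fun i _ => IsLower.sum _ fun c _ => ?_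
    rw [add_comm k 2]
    exact IsLower.mul hU (((hΓ c a (J i)).pd hU b).sub hU ((hΓ c b (J i)).pd hU a))
      (hT (Fin.pos i) _)
  have t2 : ∀ a b, IsLower U g k (k + 2) fun ε u x =>
      slotAction (connMatrix (g ε) x a)
        (slotAction (connMatrix (g ε) x b) (iterCov (g ε) u k x)) J := by
    intro a b
    -- For `k = 0` there are no slots to act on, so undifferentiated `u` never occurs.
    rcases Nat.eq_zero_or_pos k with rfl | hk
    · simpa [slotAction] using IsLower.zero
    · exact IsLower.slotAction hU hΓ a (IsLower.slotAction hU hΓ b (hT hk)) J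
  refine IsLower.congr _ _ (((t1.add _ _ (t2 a b))).sub hU (t2 b a)) ?_
  filter_upwards [hg] with ε hm u hu x hx
  exact (covDeriv_commutator hU hm hx (smooth_iterCov hU hm hu k) a b J).symm

/-- Induction on `k`: the error vanishes on functions, and each contribution in `boxError_succ`
raises the order and the weight by one. -/
theorem isLower_boxError (hU : IsOpen U) (hg : ∀ᶠ ε in 𝓝[>] (0 : ℝ), IsTimeMetric U (g ε))
    (hi : ∀ a b, HasOrder U 0 fun ε x => (g ε x)⁻¹ a b)
    (hΓ : ∀ c a b, HasOrder U 1 fun ε x => christoffel (g ε) x c a b) :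
    ∀ (k : ℕ) (I : Fin k → Fin 4),
      IsLower U g k (k + 2) fun ε u x => boxError (g ε) u k x I
  | 0, I => by
      refine IsLower.congr _ _ IsLower.zero ?_
      filter_upwards [hg] with ε hm u hu x hx
      exact (sub_eq_zero.2 (box_eq_trace hU hm hx hu I).symm).symm
  | k + 1, I => by
      have hc : ∀ I : Fin (k + 2) → Fin 4, IsLower U g k (k + 2) fun ε u x =>
          commError (g ε) u k x I := by
        intro I
        have := isLower_commError hU hg hΓ k (I 0) (Fin.tail I 0) (Fin.tail (Fin.tail I))
        simpa only [Fin.cons_self_tail] using this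
      obtain ⟨p, I, rfl⟩ : ∃ p I', I = Fin.cons p I' := ⟨I 0, Fin.tail I, (Fin.cons_self_tail I).symm⟩
      have t1 : IsLower U g (k + 1) (k + 1 + 2) fun ε u x => ∑ a, ∑ c, (g ε x)⁻¹ a c
          * (covSlice (g ε) (commError (g ε) u k) x a (Fin.cons c (Fin.cons p I))
            + commError (g ε) u (k + 1) x (Fin.cons a (Fin.cons p (Fin.cons c I)))) := by
        refine IsLower.sum _ fun a _ => IsLower.sum _ fun c _ => ?_
        have := IsLower.mul hU (hi a c) (IsLower.add _ _ (IsLower.covSlice hU hg hΓ hc a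
          (Fin.cons c (Fin.cons p I))) (isLower_commError hU hg hΓ (k + 1) a p (Fin.cons c I)))
        rwa [zero_add] at this
      have t2 := IsLower.covSlice hU hg hΓ (isLower_boxError hU hg hi hΓ k) p I
      refine IsLower.congr _ _ (IsLower.add _ _ t1 t2) ?_
      filter_upwards [hg] with ε hm u hu x hx
      exact (boxError_succ hU hm hx hu k p I).symm

end LowerOrder

/-! ### Estimates for weakly singular metrics -/

section WeaklySingular

open Filter

variable {U : Set Pt} {g : ℝ → MetricField} {K : Set Pt}

theorem IsWeaklySingular.eventually_isTimeMetric (hg : IsWeaklySingular U g) :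
    ∀ᶠ ε in 𝓝[>] (0 : ℝ), IsTimeMetric U (g ε) := by
  obtain ⟨M, hM, h⟩ := hg.dt_timelike
  filter_upwards [h, eventually_pos_le_one] with ε h1 hε
  refine ⟨hg.smooth ε hε.1 hε.2, hg.lorentzian ε hε.1 hε.2, fun x hx => (h1 x hx).trans_lt ?_⟩
  exact div_neg_of_neg_of_pos (by norm_num) (by positivity)

theorem IsWeaklySingular.hasOrder_metric (hg : IsWeaklySingular U g) (a b : Fin 4) :
    HasOrder U 0 fun ε x => g ε x a b where
  smooth := by filter_upwards [hg.eventually_isTimeMetric] with ε h using h.smooth a b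
  bound n := orderBound_of_iterPd n fun K hK hKU l => by
    obtain ⟨C, hC⟩ := hg.bound K hK hKU l
    refine ⟨C, ?_⟩
    filter_upwards [hC] with ε h x hx
    rw [zero_add]
    exact h x hx a b

theorem IsWeaklySingular.hasOrder_inv (hg : IsWeaklySingular U g) (a b : Fin 4) :
    HasOrder U 0 fun ε x => (g ε x)⁻¹ a b where
  smooth := by filter_upwards [hg.eventually_isTimeMetric] with ε h using h.smooth_inv a b
  bound n := orderBound_of_iterPd n fun K hK hKU l => by
    obtain ⟨C, hC⟩ := hg.bound_inv K hK hKU l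
    refine ⟨C, ?_⟩
    filter_upwards [hC] with ε h x hx
    rw [zero_add]
    exact h x hx a b

theorem IsWeaklySingular.hasOrder_christoffel (hU : IsOpen U) (hg : IsWeaklySingular U g)
    (c a b : Fin 4) : HasOrder U 1 fun ε x => christoffel (g ε) x c a b := by
  have hd : ∀ a b d, HasOrder U 1 fun ε x => pd a (fun y => g ε y b d) x :=
    fun a b d => (hg.hasOrder_metric b d).pd hU a
  unfold christoffel
  refine HasOrder.const_mul hU _ (HasOrder.sum hU _ fun d _ => ?_)
  have := (hg.hasOrder_inv c d).mul hU (((hd a b d).add hU (hd b a d)).sub hU (hd d a b))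
  rwa [zero_add] at this

/-- Uniform pointwise bounds for the metric and its normal vector field at a point. -/
structure BoundedGeometry (g : MetricField) (x : Pt) (C : ℝ) : Prop where
  inv : ∀ a b, |(g x)⁻¹ a b| ≤ C
  xiHat : ∀ a, |xiHat g x a| ≤ C
  covXiHat : ∀ a b, |covXiHat g x a b| ≤ C
  riem_inv : ∀ a b, |(riem g x)⁻¹ a b| ≤ C
  riem : ∀ a, riem g x a a ≤ C ^ 2
  V : 1 ≤ C * V g x

/-- Only the undifferentiated bounds of (A), the bound (B) and the lower bound `V ≥ 1/M₀` enter. The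
Christoffel symbols are not bounded uniformly and are deliberately absent. -/
theorem IsWeaklySingular.exists_boundedGeometry (hU : IsOpen U) (hg : IsWeaklySingular U g)
    (hK : IsCompact K) (hKU : K ⊆ U) :
    ∃ C : ℝ, 1 ≤ C ∧ ∀ᶠ ε in 𝓝[>] (0 : ℝ), ∀ x ∈ K, BoundedGeometry (g ε) x C := by
  obtain ⟨M, hM, hV⟩ := hg.dt_timelike
  obtain ⟨C₁, h₁⟩ := hg.bound K hK hKU []
  obtain ⟨C₂, h₂⟩ := hg.bound_inv K hK hKU []
  obtain ⟨C₃, h₃⟩ := hg.bound_covXi K hK hKU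
  obtain ⟨A, hA1, hMA, h1A, h2A, h3A⟩ : ∃ A : ℝ, 1 ≤ A ∧ M ≤ A ∧ C₁ ≤ A ∧ C₂ ≤ A ∧ C₃ ≤ A := by
    have := le_abs_self C₁; have := le_abs_self C₂; have := le_abs_self C₃
    have := abs_nonneg C₁; have := abs_nonneg C₂; have := abs_nonneg C₃
    refine ⟨1 + M + |C₁| + |C₂| + |C₃|, ?_, ?_, ?_, ?_, ?_⟩ <;> linarith
  have hp : ∀ {i j : ℕ}, i ≤ j → A ^ i ≤ A ^ j := fun h => pow_le_pow_right₀ hA1 h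
  -- The largest quantity is `∇ξ̂`: its first part is at most `A²`, its second at most `A⁴ · 16A³`.
  refine ⟨17 * A ^ 7, by linarith [one_le_pow₀ hA1 (n := 7)], ?_⟩
  filter_upwards [hV, h₁, h₂, h₃, hg.eventually_isTimeMetric] with ε hV h₁ h₂ h₃ hm x hx
  have hxU := hKU hx
  have hVp := hm.V_pos hxU
  have hVi : (V (g ε) x)⁻¹ ≤ A := by
    have h1 := hV x hxU
    have h2 : 1 / M ^ 2 ≤ V (g ε) x ^ 2 := by
      rw [hm.V_sq hxU]
      have : -1 / M ^ 2 = -(1 / M ^ 2) := by ring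
      linarith
    have h3 : (1 / M) ^ 2 ≤ V (g ε) x ^ 2 := by rwa [div_pow, one_pow]
    have h4 : 1 / M ≤ V (g ε) x := (sq_le_sq₀ (by positivity) hVp.le).1 h3
    rw [inv_le_comm₀ hVp (by linarith)]
    refine le_trans ?_ h4
    rw [one_div]
    exact inv_anti₀ hM hMA
  have hVi0 : 0 < (V (g ε) x)⁻¹ := inv_pos.2 hVp
  have hVabs : |(V (g ε) x)⁻¹| ≤ A := by rwa [abs_of_pos hVi0]
  have hmul : ∀ {p q : ℝ} {i j : ℕ}, |p| ≤ A ^ i → |q| ≤ A ^ j → |p * q| ≤ A ^ (i + j) := by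
    intro p q i j hp hq
    rw [abs_mul, pow_add]
    exact mul_le_mul hp hq (abs_nonneg _) (by positivity)
  have bV : |(V (g ε) x)⁻¹| ≤ A ^ 1 := by simpa using hVabs
  have bg : ∀ a b, |g ε x a b| ≤ A ^ 1 := fun a b => by
    have := h₁ x hx a b
    simp only [iterPd, List.length_nil, pow_zero, div_one] at this
    simpa using this.trans h1A
  have bi : ∀ a b, |(g ε x)⁻¹ a b| ≤ A ^ 1 := fun a b => by
    have := h₂ x hx a b
    simp only [iterPd, List.length_nil, pow_zero, div_one] at this
    simpa using this.trans h2A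
  have bc : ∀ a b, |covXi (g ε) x a b| ≤ A ^ 1 := fun a b => by
    simpa using (h₃ x hx a b).trans h3A
  have bxi : ∀ a, |xi (g ε) x a| ≤ A ^ 1 := fun a => by
    rw [IsTimeMetric.xi_eq, abs_neg]; exact bi a 0
  have bh : ∀ a, |xiHat (g ε) x a| ≤ A ^ 2 := fun a => by
    rw [xiHat, div_eq_mul_inv]; exact hmul (bxi a) bV
  have bl : ∀ a, |xiHatLow (g ε) x a| ≤ A ^ 1 := fun a => by
    rw [hm.xiHatLow_eq hxU, div_eq_mul_inv, abs_mul]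
    have : |xiLow a| ≤ 1 := by unfold xiLow; split_ifs <;> simp
    calc |xiLow a| * |(V (g ε) x)⁻¹| ≤ 1 * A ^ 1 :=
          mul_le_mul this bV (abs_nonneg _) zero_le_one
      _ = A ^ 1 := one_mul _
  have p7 : 1 ≤ A ^ 7 := one_le_pow₀ hA1
  refine ⟨fun a b => ?_, fun a => ?_, fun a b => ?_, fun a b => ?_, fun a => ?_, ?_⟩
  · exact (bi a b).trans (by linarith [hp (show 1 ≤ 7 by norm_num)])
  · exact (bh a).trans (by linarith [hp (show 2 ≤ 7 by norm_num)])
  · have hs : |∑ c, ∑ d, g ε x c d * covXi (g ε) x a c * xi (g ε) x d| ≤ 16 * A ^ 3 := by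
      refine (Finset.abs_sum_le_sum_abs _ _).trans ?_
      calc _ ≤ ∑ _c : Fin 4, ∑ _d : Fin 4, A ^ 3 := Finset.sum_le_sum fun c _ =>
            (Finset.abs_sum_le_sum_abs _ _).trans
              (Finset.sum_le_sum fun d _ => hmul (hmul (bg c d) (bc a c)) (bxi d))
        _ = 16 * A ^ 3 := by simp; ring
    have hf : |xi (g ε) x b * (V (g ε) x)⁻¹ ^ 3| ≤ A ^ 4 := by
      refine hmul (i := 1) (j := 3) (bxi b) ?_
      rw [abs_pow]
      exact pow_le_pow_left₀ (abs_nonneg _) hVabs 3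
    rw [hm.covXiHat_eq hU hxU]
    have e : covXi (g ε) x a b / V (g ε) x + xi (g ε) x b *
        (∑ c, ∑ d, g ε x c d * covXi (g ε) x a c * xi (g ε) x d) / V (g ε) x ^ 3
        = covXi (g ε) x a b * (V (g ε) x)⁻¹ + (xi (g ε) x b * (V (g ε) x)⁻¹ ^ 3)
          * ∑ c, ∑ d, g ε x c d * covXi (g ε) x a c * xi (g ε) x d := by
      rw [inv_pow]; field_simp
    rw [e]
    refine (abs_add_le _ _).trans ?_
    rw [abs_mul (xi (g ε) x b * _)]
    have h1 : |covXi (g ε) x a b * (V (g ε) x)⁻¹| ≤ A ^ 2 := hmul (bc a b) bV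
    have h2 : |xi (g ε) x b * (V (g ε) x)⁻¹ ^ 3|
        * |∑ c, ∑ d, g ε x c d * covXi (g ε) x a c * xi (g ε) x d| ≤ A ^ 4 * (16 * A ^ 3) :=
      mul_le_mul hf hs (abs_nonneg _) (by positivity)
    linarith [hp (show 2 ≤ 7 by norm_num)]
  · rw [hm.riem_inv hxU]
    refine (abs_add_le _ _).trans ?_
    rw [mul_assoc, abs_mul 2]
    have := hmul (bh a) (bh b)
    have h2 : |(2 : ℝ)| = 2 := abs_of_pos two_pos
    rw [h2]
    linarith [bi a b, hp (show 1 ≤ 7 by norm_num), hp (show 2 + 2 ≤ 7 by norm_num)]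
  · have h1 := le_of_abs_le (bg a a)
    have h2 := le_of_abs_le (hmul (bl a) (bl a))
    simp only [riem, Matrix.of_apply]
    have h3 : (17 * A ^ 7) ^ 2 = 289 * A ^ 14 := by ring
    rw [h3]
    linarith [hp (show 1 ≤ 14 by norm_num), hp (show 1 + 1 ≤ 14 by norm_num),
      one_le_pow₀ hA1 (n := 14)]
  · have h1 : 1 ≤ A * V (g ε) x := by
      have := mul_le_mul_of_nonneg_right hVi hVp.le
      rwa [inv_mul_cancel₀ hVp.ne'] at this
    have h2 : A ≤ 17 * A ^ 7 := by
      have := hp (show 1 ≤ 7 by norm_num)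
      rw [pow_one] at this
      linarith
    exact h1.trans (mul_le_mul_of_nonneg_right h2 hVp.le)

/-- The divergence of the energy current of order `j` with respect to the metric. -/
def divCurrent (g : MetricField) (u : Pt → ℝ) (j : ℕ) (x : Pt) : ℝ :=
  ∑ a, (pd a (current g u j a) x + (∑ b, christoffel g x b b a) * current g u j a x)

/-- The density of the energy of order `j` with respect to the volume. -/
def energyDensity (g : MetricField) (u : Pt → ℝ) (j : ℕ) (x : Pt) : ℝ :=
  ∑ i ∈ Finset.range (j + 1), current g u i 0 x

theorem compSq_add_le {k : ℕ} (S T : Tens k) :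
    compSq (S + T) ≤ 2 * compSq S + 2 * compSq T := by
  simp only [compSq, Finset.mul_sum, ← Finset.sum_add_distrib]
  refine Finset.sum_le_sum fun I _ => ?_
  rw [Pi.add_apply]
  nlinarith [sq_nonneg (S I - T I)]

/-- The divergence of `½ ξ̂ u²` is `½ (div ξ̂) u² + u ξ̂·∂u`, estimated without the wave equation.
It involves the gradient of `u`, so it can be absorbed only in an energy of order at least one. -/
theorem divCurrent_zero_le {W : Set Pt} {h : MetricField} {x : Pt} {u : Pt → ℝ} {C : ℝ}
    (hC : 1 ≤ C) (hU : IsOpen W) (hm : IsTimeMetric W h) (hx : x ∈ W) (hu : ContDiffOn ℝ ∞ u W)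
    (hb : BoundedGeometry h x C) :
    divCurrent h u 0 x ≤ 4 * C * (compSq (iterCov h u 0 x) + compSq (iterCov h u 1 x)) := by
  have dv : ∀ b, DifferentiableAt ℝ (fun y => xiHat h y b) x :=
    fun b => differentiableAt_of_smooth hU (hm.smooth_xiHat b) hx
  have du := differentiableAt_of_smooth hU hu hx
  have e1 : ∀ a, pd a (current h u 0 a) x
      = 1 / 2 * pd a (fun y => xiHat h y a) x * u x ^ 2 + xiHat h x a * (u x * pd a u x) := by
    intro a
    have : pd a (current h u 0 a) x = pd a (fun y => 1 / 2 * xiHat h y a * (u y * u y)) x := by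
      congr 1; funext y; simp only [current, sq]
    rw [this, pd_mul ((dv a).const_mul _) (du.fun_mul du), pd_const_mul _ (dv a), pd_mul du du]
    ring
  have e2 : divCurrent h u 0 x
      = 1 / 2 * (∑ a, covXiHat h x a a) * u x ^ 2 + ∑ a, xiHat h x a * (u x * pd a u x) := by
    unfold divCurrent
    simp only [e1]
    simp only [current, covXiHat, Fin.sum_univ_four]
    ring
  have e3 : compSq (iterCov h u 0 x) = u x ^ 2 := by simp [compSq, iterCov]
  have e4 : compSq (iterCov h u 1 x) = ∑ a, pd a u x ^ 2 := by
    unfold compSq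
    rw [sum_cons]
    refine Finset.sum_congr rfl fun a _ => ?_
    have : ∀ I : Fin 0 → Fin 4, iterCov h u 1 x (Fin.cons a I) = pd a u x := by
      intro I
      rw [iterCov_cons, covSlice_eq]
      simp [slotAction, iterCov]
    simp [this]
  rw [e2, e3, e4]
  have t1 : ∑ a, covXiHat h x a a ≤ 4 * C :=
    (Finset.sum_le_sum fun a _ => le_of_abs_le (hb.covXiHat a a)).trans (le_of_eq (by simp))
  have t2 : ∑ a, xiHat h x a * (u x * pd a u x) ≤ ∑ a, C * ((u x ^ 2 + pd a u x ^ 2) / 2) := by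
    refine Finset.sum_le_sum fun a _ => (le_abs_self _).trans ?_
    rw [abs_mul]
    refine mul_le_mul (hb.xiHat a) ?_ (abs_nonneg _) (by linarith)
    rw [abs_le]
    constructor <;> nlinarith [sq_nonneg (u x + pd a u x), sq_nonneg (u x - pd a u x)]
  rw [← Finset.mul_sum, ← Finset.sum_div, Finset.sum_add_distrib, Finset.sum_const,
    Finset.card_univ, Fintype.card_fin, nsmul_eq_mul] at t2
  have hs : 0 ≤ ∑ a, pd a u x ^ 2 := Finset.sum_nonneg fun a _ => sq_nonneg _
  have hCs : 0 ≤ C * ∑ a, pd a u x ^ 2 := mul_nonneg (by linarith) hs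
  have h3 := mul_le_mul_of_nonneg_right t1 (sq_nonneg (u x))
  push_cast at t2
  linarith

/-- The wave equation enters here: the traced derivative is `∇^{(k)} f` plus `boxError`. This error
and the commutators are bounded componentwise by the weighted lower derivatives. -/
theorem exists_divCurrent_succ_le (hU : IsOpen U) (hg : IsWeaklySingular U g) (hK : IsCompact K)
    (hKU : K ⊆ U) (k : ℕ) : ∃ C : ℝ, 0 ≤ C ∧ ∀ᶠ ε in 𝓝[>] (0 : ℝ), ∀ u f : Pt → ℝ,
      ContDiffOn ℝ ∞ u U → (∀ x ∈ U, box (g ε) u x = f x) → ∀ x ∈ K,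
      divCurrent (g ε) u (k + 1) x ≤ C * (compSq (iterCov (g ε) f k x)
        + (∑ l ∈ Finset.Icc 1 k, 1 / ε ^ (2 * (k + 2 - l)) * compSq (iterCov (g ε) u l x))
        + compSq (iterCov (g ε) u (k + 1) x)) := by
  have hm := hg.eventually_isTimeMetric
  have hΓ := hg.hasOrder_christoffel hU
  obtain ⟨C, hC1, hC⟩ := hg.exists_boundedGeometry hU hK hKU
  obtain ⟨D, hD0, hD⟩ := exists_sum_pd_current_le k hC1
  -- There is one constant for each component; as there are finitely many, they can be summed.
  choose B hB0 hB using fun I => (isLower_boxError hU hm hg.hasOrder_inv hΓ k I).bound hK hKU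
  choose Q hQ0 hQ using fun (p : Fin 4 × Fin 4 × (Fin k → Fin 4)) =>
    (isLower_commError hU hm hΓ k p.1 p.2.1 p.2.2).bound hK hKU
  have hBs : 0 ≤ ∑ I, B I := Finset.sum_nonneg fun I _ => hB0 I
  have hQs : 0 ≤ ∑ p, Q p := Finset.sum_nonneg fun I _ => hQ0 I
  refine ⟨D * (2 + 2 * (∑ I, B I) + ∑ p, Q p), by positivity, ?_⟩
  filter_upwards [hm, hC, eventually_all.2 hB, eventually_all.2 hQ, eventually_pos_le_one]
    with ε hm hC hB hQ hε u f hu hf x hx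
  have hxU := hKU hx
  have hb := hC x hx
  have h1 := hD U (g ε) u x hU hm hxU hu hb.inv hb.xiHat hb.covXiHat hb.riem_inv
  set Z := ∑ l ∈ Finset.Icc 1 k, 1 / ε ^ (2 * (k + 2 - l)) * compSq (iterCov (g ε) u l x) with hZ
  have hZ0 : 0 ≤ Z := Finset.sum_nonneg fun l _ =>
    mul_nonneg (by have := pow_pos hε.1 (2 * (k + 2 - l)); positivity) (compSq_nonneg _)
  have h2 : compSq (∑ a, ∑ c, (g ε x)⁻¹ a c • fun I : Fin k → Fin 4 =>
      iterCov (g ε) u (k + 2) x (Fin.cons a (Fin.cons c I)))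
      ≤ 2 * compSq (iterCov (g ε) f k x) + 2 * ((∑ I, B I) * Z) := by
    have : (∑ a, ∑ c, (g ε x)⁻¹ a c • fun I : Fin k → Fin 4 =>
        iterCov (g ε) u (k + 2) x (Fin.cons a (Fin.cons c I)))
        = iterCov (g ε) f k x + boxError (g ε) u k x := by
      funext I
      rw [Pi.add_apply, boxError, ← iterCov_congr hU hf k x hxU, traceIdx]
      simp [Finset.sum_apply]
    rw [this]
    refine (compSq_add_le _ _).trans ?_
    have h3 : compSq (boxError (g ε) u k x) ≤ (∑ I, B I) * Z := by
      rw [Finset.sum_mul]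
      exact Finset.sum_le_sum fun I _ => hB I u hu x hx
    linarith
  have h3 : ∑ a, ∑ d, compSq ((fun J : Fin k → Fin 4 =>
      iterCov (g ε) u (k + 2) x (Fin.cons a (Fin.cons d J)))
        - fun J => iterCov (g ε) u (k + 2) x (Fin.cons d (Fin.cons a J))) ≤ (∑ p, Q p) * Z := by
    rw [Finset.sum_mul, Fintype.sum_prod_type]
    refine Finset.sum_le_sum fun a _ => ?_
    rw [Fintype.sum_prod_type]
    refine Finset.sum_le_sum fun d _ => Finset.sum_le_sum fun J _ => ?_
    exact hQ (a, d, J) u hu x hx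
  refine h1.trans ?_
  rw [mul_assoc D]
  refine mul_le_mul_of_nonneg_left ?_ hD0
  have hf0 := compSq_nonneg (iterCov (g ε) f k x)
  have hu0 := compSq_nonneg (iterCov (g ε) u (k + 1) x)
  nlinarith [mul_nonneg hBs hf0, mul_nonneg hQs hf0, mul_nonneg hBs hu0, mul_nonneg hQs hu0]

/-- The divergence of the total energy current is controlled by the source, the energies of lower
order with negative powers of `ε`, and the energy itself. -/
theorem exists_sum_divCurrent_le (hU : IsOpen U) (hg : IsWeaklySingular U g) (hK : IsCompact K)
    (hKU : K ⊆ U) {k : ℕ} (hk : 1 ≤ k) : ∃ C : ℝ, 0 < C ∧ ∀ᶠ ε in 𝓝[>] (0 : ℝ), ∀ u f : Pt → ℝ,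
      ContDiffOn ℝ ∞ u U → (∀ x ∈ U, box (g ε) u x = f x) → ∀ x ∈ K,
      ∑ j ∈ Finset.range (k + 1), divCurrent (g ε) u j x
        ≤ C * ((∑ i ∈ Finset.range k, normCovSq (g ε) f i x)
          + (∑ l ∈ Finset.Icc 1 (k - 1), 1 / ε ^ (2 * (1 + k - l)) * energyDensity (g ε) u l x)
          + energyDensity (g ε) u k x) := by
  obtain ⟨C, hC1, hC⟩ := hg.exists_boundedGeometry hU hK hKU
  choose D hD0 hD using fun i => exists_divCurrent_succ_le hU hg hK hKU i
  set N : ℝ := 4 ^ k * (4 ^ k * (C ^ k) ^ 2) with hN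
  have hN0 : 0 ≤ N := by positivity
  have hDs : 0 ≤ ∑ i ∈ Finset.range k, D i := Finset.sum_nonneg fun i _ => hD0 i
  -- `N` compares components with the norm for all orders up to `k`, and `2C` compares the norm with
  -- the current, since `V/2 ≥ 1/(2C)`.
  set A : ℝ := N * (2 * C) with hA
  have hNA : N ≤ A := by nlinarith
  have hA0 : 0 ≤ A := hN0.trans hNA
  refine ⟨1 + (8 * C + ∑ i ∈ Finset.range k, D i) * A, by positivity, ?_⟩
  filter_upwards [hg.eventually_isTimeMetric, hC, eventually_pos_le_one,
    (Finset.range k).eventually_all.2 fun i _ => hD i] with ε hm hC hε hD u f hu hf x hx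
  have hxU := hKU hx
  have hb := hC x hx
  have hVp := hm.V_pos hxU
  have hcmp : ∀ (v : Pt → ℝ) (l : ℕ), l ≤ k →
      compSq (iterCov (g ε) v l x) ≤ N * normCovSq (g ε) v l x := by
    intro v l hl
    refine (compSq_le_contr_riem hm hxU (by linarith) hb.riem _).trans ?_
    refine mul_le_mul_of_nonneg_right ?_ (normCovSq_nonneg hm hxU l)
    rw [hN]
    have h1 : (4 : ℝ) ^ l ≤ 4 ^ k := pow_le_pow_right₀ (by norm_num) hl
    have h2 : C ^ l ≤ C ^ k := pow_le_pow_right₀ hC1 hl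
    gcongr
  have hcur : ∀ l, normCovSq (g ε) u l x ≤ 2 * C * current (g ε) u l 0 x := by
    intro l
    rw [current_zero hm hxU]
    have := mul_le_mul_of_nonneg_right hb.V (normCovSq_nonneg (u := u) hm hxU l)
    linarith
  have hden : ∀ l i, i ≤ l → current (g ε) u i 0 x ≤ energyDensity (g ε) u l x := fun l i hi =>
    Finset.single_le_sum (f := fun i => current (g ε) u i 0 x)
      (fun i _ => current_zero_nonneg hm hxU i) (Finset.mem_range.2 (Nat.lt_succ_of_le hi))
  have hden0 : ∀ l, 0 ≤ energyDensity (g ε) u l x := fun l =>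
    Finset.sum_nonneg fun i _ => current_zero_nonneg hm hxU i
  have hu1 : ∀ l i, i ≤ l → i ≤ k →
      compSq (iterCov (g ε) u i x) ≤ A * energyDensity (g ε) u l x := by
    intro l i hi hik
    calc compSq (iterCov (g ε) u i x) ≤ N * normCovSq (g ε) u i x := hcmp u i hik
      _ ≤ N * (2 * C * energyDensity (g ε) u l x) := by
          refine mul_le_mul_of_nonneg_left ((hcur i).trans ?_) hN0
          exact mul_le_mul_of_nonneg_left (hden l i hi) (by linarith)
      _ = _ := by rw [hA]; ring
  have hpw : ∀ n, 0 < 1 / ε ^ n := fun n => by have := pow_pos hε.1 n; positivity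
  set F := ∑ i ∈ Finset.range k, normCovSq (g ε) f i x with hF
  have hF0 : 0 ≤ F := Finset.sum_nonneg fun i _ => normCovSq_nonneg hm hxU i
  set Z := ∑ l ∈ Finset.Icc 1 (k - 1), 1 / ε ^ (2 * (1 + k - l)) * energyDensity (g ε) u l x with hZ
  have hZ0 : 0 ≤ Z := Finset.sum_nonneg fun l _ => mul_nonneg (hpw _).le (hden0 l)
  set E := energyDensity (g ε) u k x with hE
  have hE0 : 0 ≤ E := hden0 k
  have hsum0 : 0 ≤ F + Z + E := by positivity
  have h0 : divCurrent (g ε) u 0 x ≤ 8 * C * A * (F + Z + E) := by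
    refine (divCurrent_zero_le hC1 hU hm hxU hu hb).trans ?_
    have a0 := hu1 k 0 (Nat.zero_le _) (Nat.zero_le _)
    have a1 := hu1 k 1 hk hk
    have : 4 * C * (compSq (iterCov (g ε) u 0 x) + compSq (iterCov (g ε) u 1 x))
        ≤ 4 * C * (2 * (A * E)) := mul_le_mul_of_nonneg_left (by linarith) (by linarith)
    have h2 : 0 ≤ 8 * C * A * (F + Z) := by positivity
    linarith
  have h1 : ∀ i ∈ Finset.range k, divCurrent (g ε) u (i + 1) x ≤ D i * A * (F + Z + E) := by
    intro i hi
    have hik := Finset.mem_range.1 hi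
    refine (hD i hi u f hu hf x hx).trans ?_
    rw [mul_assoc]
    refine mul_le_mul_of_nonneg_left ?_ (hD0 i)
    have b1 : compSq (iterCov (g ε) f i x) ≤ A * F := by
      refine (hcmp f i hik.le).trans (mul_le_mul hNA ?_ (normCovSq_nonneg hm hxU i) hA0)
      exact Finset.single_le_sum (f := fun i => normCovSq (g ε) f i x)
        (fun i _ => normCovSq_nonneg hm hxU i) hi
    have b2 : ∑ l ∈ Finset.Icc 1 i, 1 / ε ^ (2 * (i + 2 - l)) * compSq (iterCov (g ε) u l x)
        ≤ A * Z := by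
      rw [hZ, Finset.mul_sum]
      calc _ ≤ ∑ l ∈ Finset.Icc 1 i,
            A * (1 / ε ^ (2 * (1 + k - l)) * energyDensity (g ε) u l x) := by
            refine Finset.sum_le_sum fun l hl => ?_
            have hl' := Finset.mem_Icc.1 hl
            -- The current of order `i + 1 ≤ k` carries the weight `2(i + 2 - l) ≤ 2(1 + k - l)`;
            -- for `ε ≤ 1` the larger exponent dominates.
            have c1 : 1 / ε ^ (2 * (i + 2 - l)) ≤ 1 / ε ^ (2 * (1 + k - l)) :=
              one_div_le_one_div_of_le (pow_pos hε.1 _)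
                (pow_le_pow_of_le_one hε.1.le hε.2 (by omega))
            calc _ ≤ 1 / ε ^ (2 * (1 + k - l)) * (A * energyDensity (g ε) u l x) :=
                  mul_le_mul c1 (hu1 l l le_rfl (by omega)) (compSq_nonneg _) (hpw _).le
              _ = _ := by ring
        _ ≤ _ := Finset.sum_le_sum_of_subset_of_nonneg
            (Finset.Icc_subset_Icc_right (by omega))
            fun l _ _ => mul_nonneg hA0 (mul_nonneg (hpw _).le (hden0 l))
    have b3 := hu1 k (i + 1) hik hik
    linarith
  rw [Finset.sum_range_succ']
  have h2 := Finset.sum_le_sum h1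
  rw [← Finset.sum_mul, ← Finset.sum_mul] at h2
  linarith

end WeaklySingular

/-! ### Slices and slabs -/

section Fubini

open MeasureTheory Set

variable {U Ω : Set Pt} {f : Pt → ℝ} {τ : ℝ}

theorem continuous_atTime (τ : ℝ) : Continuous (atTime τ) :=
  continuous_const.finCons continuous_id

theorem isCompact_slice_closure (hK : IsCompact (closure Ω)) (τ : ℝ) :
    IsCompact {y | atTime τ y ∈ closure Ω} := by
  have hc : Continuous fun x : Pt => (Fin.tail x : Fin 3 → ℝ) :=
    continuous_pi fun i => continuous_apply _
  refine (hK.image hc).of_isClosed_subset (isClosed_closure.preimage (continuous_atTime τ)) ?_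
  exact fun y hy => ⟨atTime τ y, hy, rfl⟩

theorem isOpen_slice (hΩ : IsOpen Ω) (τ : ℝ) : IsOpen (slice Ω τ) :=
  hΩ.preimage (continuous_atTime τ)

theorem isOpen_slab (hΩ : IsOpen Ω) (τ : ℝ) : IsOpen (slab Ω τ) :=
  hΩ.inter ((isOpen_lt continuous_const (continuous_apply 0)).inter
    (isOpen_lt (continuous_apply 0) continuous_const))

theorem integrableOn_slice (hK : IsCompact (closure Ω)) (hKU : closure Ω ⊆ U)
    (hf : ContinuousOn f U) (τ : ℝ) : IntegrableOn (fun y => f (atTime τ y)) (slice Ω τ) := by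
  have h : ContinuousOn (fun y => f (atTime τ y)) {y | atTime τ y ∈ closure Ω} :=
    hf.comp (continuous_atTime τ).continuousOn fun y hy => hKU hy
  exact (h.integrableOn_compact (isCompact_slice_closure hK τ)).mono_set
    fun y hy => subset_closure hy

theorem integrableOn_slab (hK : IsCompact (closure Ω)) (hKU : closure Ω ⊆ U)
    (hf : ContinuousOn f U) (τ : ℝ) : IntegrableOn f (slab Ω τ) :=
  ((hf.mono hKU).integrableOn_compact hK).mono_set fun _ hx => subset_closure hx.1

/-- Fubini's theorem on the slab between two level sets of the time coordinate. -/
theorem integral_slab (hΩ : IsOpen Ω) (hK : IsCompact (closure Ω)) (hKU : closure Ω ⊆ U)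
    (hf : ContinuousOn f U) (hτ : 0 ≤ τ) :
    ∫ x in slab Ω τ, f x = ∫ t in (0 : ℝ)..τ, ∫ y in slice Ω t, f (atTime t y) := by
  have hms := (isOpen_slab hΩ τ).measurableSet
  have hint : Integrable ((slab Ω τ).indicator f) :=
    (integrable_indicator_iff hms).2 (integrableOn_slab hK hKU hf τ)
  have hmp := (volume_preserving_piFinSuccAbove (fun _ : Fin 4 => ℝ) 0).symm
  have e : ∀ p : ℝ × (Fin 3 → ℝ),
      (MeasurableEquiv.piFinSuccAbove (fun _ : Fin 4 => ℝ) 0).symm p = atTime p.1 p.2 :=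
    fun p => Fin.insertNth_zero' _ _
  rw [← integral_indicator hms, ← hmp.integral_comp']
  have hint' := (hmp.integrable_comp_emb (MeasurableEquiv.measurableEmbedding _)).2 hint
  have hsym : ∀ p, (slab Ω τ).indicator f
      ((MeasurableEquiv.piFinSuccAbove (fun _ : Fin 4 => ℝ) 0).symm p)
      = (slab Ω τ).indicator f (atTime p.1 p.2) := fun p => by rw [e]
  simp only [hsym]
  have hint2 : Integrable (fun p : ℝ × (Fin 3 → ℝ) => (slab Ω τ).indicator f (atTime p.1 p.2))
      (volume.prod volume) := by
    refine hint'.congr (Filter.Eventually.of_forall fun p => ?_)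
    exact hsym p
  refine (integral_prod _ hint2).trans ?_
  rw [intervalIntegral.integral_of_le hτ, ← integral_Ioc_eq_integral_Ioo.symm,
    ← integral_indicator measurableSet_Ioo]
  congr 1
  funext t
  by_cases ht : t ∈ Ioo 0 τ
  · rw [indicator_of_mem ht, ← integral_indicator (isOpen_slice hΩ t).measurableSet]
    congr 1
    funext y
    by_cases hy : atTime t y ∈ Ω
    · rw [indicator_of_mem (show y ∈ slice Ω t from hy),
        indicator_of_mem (show atTime t y ∈ slab Ω τ from ⟨hy, ht.1, ht.2⟩)]
    · rw [indicator_of_notMem (show y ∉ slice Ω t from hy),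
        indicator_of_notMem (show atTime t y ∉ slab Ω τ from fun h => hy h.1)]
  · rw [indicator_of_notMem ht]
    refine integral_eq_zero_of_ae (Filter.Eventually.of_forall fun y => ?_)
    exact indicator_of_notMem (fun h => ht ⟨h.2.1, h.2.2⟩) _

end Fubini

/-! ### The divergence theorem up to a future boundary -/

section DivergenceTheorem

open MeasureTheory Set Filter

variable {U Ω : Set Pt} {ρ : Pt → ℝ} {c τ : ℝ}

/-- A function vanishing near the future boundary extends by zero. -/
theorem eventually_zero_outside (hU : IsOpen U) (hKU : closure Ω ⊆ U) (hρ : ContinuousOn ρ U)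
    (hρΩ : ∀ x ∈ U, 0 ≤ x 0 → (x ∈ Ω ↔ ρ x < 0)) (hc : 0 < c) {θ : Pt → ℝ}
    (hθ : ∀ x ∈ U, -c < ρ x → θ x = 0) {x : Pt} (hx : x ∉ Ω) (hx0 : 0 ≤ x 0) :
    ∀ᶠ y in 𝓝[{y | 0 ≤ y 0}] x, Ω.indicator θ y = 0 := by
  by_cases hxU : x ∈ U
  -- Outside `Ω` with `t ≥ 0` one has `ρ ≥ 0 > -c`, and `ρ > -c` persists nearby, where `θ`
  -- vanishes. A point outside `U` has a neighbourhood missing the closure of `Ω`.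
  · have h1 : 0 ≤ ρ x := not_lt.1 fun h => hx ((hρΩ x hxU hx0).2 h)
    have h2 : ∀ᶠ y in 𝓝 x, -c < ρ y :=
      (hρ.continuousAt (hU.mem_nhds hxU)).eventually (lt_mem_nhds (by linarith))
    filter_upwards [mem_nhdsWithin_of_mem_nhds h2, mem_nhdsWithin_of_mem_nhds (hU.mem_nhds hxU)]
      with y hy hyU
    by_cases hyΩ : y ∈ Ω
    · rw [indicator_of_mem hyΩ, hθ y hyU hy]
    · exact indicator_of_notMem hyΩ _
  · have h1 : (closure Ω)ᶜ ∈ 𝓝 x :=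
      isClosed_closure.isOpen_compl.mem_nhds fun h => hxU (hKU h)
    filter_upwards [mem_nhdsWithin_of_mem_nhds h1] with y hy
    exact indicator_of_notMem (fun h => hy (subset_closure h)) _

theorem continuousOn_indicator_cutoff (hU : IsOpen U) (hΩ : IsOpen Ω) (hKU : closure Ω ⊆ U)
    (hρ : ContinuousOn ρ U) (hρΩ : ∀ x ∈ U, 0 ≤ x 0 → (x ∈ Ω ↔ ρ x < 0)) (hc : 0 < c)
    {θ : Pt → ℝ} (hθc : ContinuousOn θ U) (hθ : ∀ x ∈ U, -c < ρ x → θ x = 0) :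
    ContinuousOn (Ω.indicator θ) {y | 0 ≤ y 0} := by
  intro x hx0
  by_cases hx : x ∈ Ω
  · have h1 : ContinuousAt θ x := hθc.continuousAt (hU.mem_nhds (hKU (subset_closure hx)))
    have h2 : Ω.indicator θ =ᶠ[𝓝 x] θ :=
      eventually_of_mem (hΩ.mem_nhds hx) fun y hy => indicator_of_mem hy _
    exact (h1.congr h2.symm).continuousWithinAt
  · have h := eventually_zero_outside hU hKU hρ hρΩ hc hθ hx hx0
    have h2 : ContinuousWithinAt (fun _ : Pt => (0 : ℝ)) {y | 0 ≤ y 0} x :=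
      continuousWithinAt_const
    exact h2.congr_of_eventuallyEq h (indicator_of_notMem hx _)

theorem hasFDerivAt_indicator_cutoff (hU : IsOpen U) (hΩ : IsOpen Ω) (hKU : closure Ω ⊆ U)
    (hρ : ContinuousOn ρ U) (hρΩ : ∀ x ∈ U, 0 ≤ x 0 → (x ∈ Ω ↔ ρ x < 0)) (hc : 0 < c)
    {θ : Pt → ℝ} (hθd : ContDiffOn ℝ 1 θ U) (hθ : ∀ x ∈ U, -c < ρ x → θ x = 0) {x : Pt}
    (hx0 : 0 < x 0) : HasFDerivAt (Ω.indicator θ) (Ω.indicator (fderiv ℝ θ) x) x := by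
  by_cases hx : x ∈ Ω
  · have h1 : HasFDerivAt θ (fderiv ℝ θ x) x :=
      ((hθd.contDiffAt (hU.mem_nhds (hKU (subset_closure hx)))).differentiableAt
        (by simp)).hasFDerivAt
    rw [indicator_of_mem hx]
    exact h1.congr_of_eventuallyEq
      (eventually_of_mem (hΩ.mem_nhds hx) fun y hy => indicator_of_mem hy _)
  · have h := eventually_zero_outside hU hKU hρ hρΩ hc hθ hx hx0.le
    have h0 : {y : Pt | 0 ≤ y 0} ∈ 𝓝 x :=
      mem_of_superset ((isOpen_lt continuous_const (continuous_apply 0)).mem_nhds hx0)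
        fun y (hy : 0 < y 0) => hy.le
    rw [nhdsWithin_eq_nhds.2 h0] at h
    rw [indicator_of_notMem hx]
    exact (hasFDerivAt_const (0 : ℝ) x).congr_of_eventuallyEq h

/-- The divergence theorem for vector fields vanishing near the future boundary. -/
theorem integral_divergence_cutoff (hU : IsOpen U) (hΩ : IsOpen Ω) (hK : IsCompact (closure Ω))
    (hKU : closure Ω ⊆ U) (hρ : ContinuousOn ρ U)
    (hρΩ : ∀ x ∈ U, 0 ≤ x 0 → (x ∈ Ω ↔ ρ x < 0)) (hc : 0 < c) {θ : Fin 4 → Pt → ℝ}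
    (hθd : ∀ a, ContDiffOn ℝ 1 (θ a) U) (hθ : ∀ a, ∀ x ∈ U, -c < ρ x → θ a x = 0)
    (hτ : 0 ≤ τ) :
    ∫ x in slab Ω τ, ∑ a, pd a (θ a) x
      = (∫ y in slice Ω τ, θ 0 (atTime τ y)) - ∫ y in slice Ω 0, θ 0 (atTime 0 y) := by
  obtain ⟨R, hR⟩ := hK.isBounded.exists_norm_le
  -- The region lies strictly inside `|x^i| < r`, so in the box `[0,τ] × [-r,r]³` the field extended
  -- by zero has no flux through the lateral faces, and the faces `t = 0` and `t = τ` give the two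
  -- slices.
  set r : ℝ := |R| + 1 with hr
  have hr0 : 0 < r := by positivity
  have hRr : R < r := by have := le_abs_self R; linarith
  have hΩr : ∀ x ∈ Ω, ∀ i, |x i| < r := fun x hx i =>
    ((norm_le_pi_norm x i).trans (hR x (subset_closure hx))).trans_lt hRr
  set p : Pt := atTime 0 fun _ => -r with hp
  set q : Pt := atTime τ fun _ => r with hq
  have hp0 : p 0 = 0 := rfl
  have hq0 : q 0 = τ := rfl
  have hps : ∀ i : Fin 3, p i.succ = -r := fun i => rfl
  have hqs : ∀ i : Fin 3, q i.succ = r := fun i => rfl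
  have hpq : p ≤ q := by
    intro i
    refine Fin.cases hτ (fun i => ?_) i
    rw [hps, hqs]; linarith
  have hIcc : Icc p q ⊆ {y | 0 ≤ y 0} := fun y hy => hy.1 0
  have hpdc : ∀ a, ContinuousOn (pd a (θ a)) U := fun a =>
    ((hθd a).continuousOn_fderiv_of_isOpen hU le_rfl).clm_apply continuousOn_const
  have hpd0 : ∀ a, ∀ x ∈ U, -c < ρ x → pd a (θ a) x = 0 := by
    intro a x hxU hx
    have h2 : ∀ᶠ y in 𝓝 x, -c < ρ y :=
      (hρ.continuousAt (hU.mem_nhds hxU)).eventually (lt_mem_nhds hx)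
    have h3 : θ a =ᶠ[𝓝 x] fun _ => 0 := by
      filter_upwards [h2, hU.mem_nhds hxU] with y hy hyU using hθ a y hyU hy
    rw [pd_congr h3, pd_const]
  have hDc : ContinuousOn (Ω.indicator fun x => ∑ a, pd a (θ a) x) {y | 0 ≤ y 0} :=
    continuousOn_indicator_cutoff hU hΩ hKU hρ hρΩ hc
      (continuousOn_finsetSum _ fun a _ => hpdc a)
      fun x hxU hx => Finset.sum_eq_zero fun a _ => hpd0 a x hxU hx
  have hsum : (fun x => ∑ a, (Ω.indicator (fderiv ℝ (θ a)) x) (Pi.single a 1))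
      = Ω.indicator fun x => ∑ a, pd a (θ a) x := by
    funext x
    by_cases hx : x ∈ Ω
    · simp only [indicator_of_mem hx]; rfl
    · simp [indicator_of_notMem hx]
  have hdiv := integral_divergence_of_hasFDerivAt_off_countable' p q hpq
    (fun a => Ω.indicator (θ a)) (fun a => Ω.indicator (fderiv ℝ (θ a))) ∅ countable_empty
    (fun a => (continuousOn_indicator_cutoff hU hΩ hKU hρ hρΩ hc (hθd a).continuousOn
      (hθ a)).mono hIcc)
    (fun x hx a => hasFDerivAt_indicator_cutoff hU hΩ hKU hρ hρΩ hc (hθd a) (hθ a)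
      (hx.1 0 (mem_univ _)).1)
    (by
      rw [hsum]
      exact (hDc.mono hIcc).integrableOn_compact isCompact_Icc)
  rw [hsum] at hdiv
  have hface : ∀ t, ∫ y in Icc (p ∘ Fin.succAbove 0) (q ∘ Fin.succAbove 0),
      Ω.indicator (θ 0) (Fin.insertNth 0 t y) = ∫ y in slice Ω t, θ 0 (atTime t y) := by
    intro t
    have e1 : (fun y : Fin 3 → ℝ => Ω.indicator (θ 0) (Fin.insertNth (0 : Fin 4) t y))
        = (slice Ω t).indicator fun y => θ 0 (atTime t y) := by
      funext y
      rw [Fin.insertNth_zero']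
      rfl
    rw [e1, setIntegral_indicator (isOpen_slice hΩ t).measurableSet]
    congr 2
    refine inter_eq_right.2 fun y hy => ?_
    have h1 : ∀ i : Fin 3, |y i| < r := fun i => hΩr _ hy i.succ
    exact ⟨fun i => (abs_le.1 (h1 i).le).1, fun i => (abs_le.1 (h1 i).le).2⟩
  have hside : ∀ (i : Fin 3) (s : ℝ), |s| = r →
      ∫ y in Icc (p ∘ Fin.succAbove i.succ) (q ∘ Fin.succAbove i.succ),
        Ω.indicator (θ i.succ) (Fin.insertNth i.succ s y) = 0 := by
    intro i s hs
    refine integral_eq_zero_of_ae (Eventually.of_forall fun y => ?_)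
    refine indicator_of_notMem (fun h => ?_) _
    have := hΩr _ h i.succ
    rw [Fin.insertNth_apply_same, hs] at this
    exact lt_irrefl _ this
  have hlhs : ∫ x in Icc p q, Ω.indicator (fun x => ∑ a, pd a (θ a) x) x
      = ∫ x in slab Ω τ, ∑ a, pd a (θ a) x := by
    have hae : (Set.pi univ fun i => Ioo (p i) (q i)) =ᵐ[volume] Icc p q :=
      Measure.univ_pi_Ioo_ae_eq_Icc
    rw [← setIntegral_congr_set hae, setIntegral_indicator hΩ.measurableSet]
    congr 2
    ext x
    constructor
    · exact fun hx => ⟨hx.2, (hx.1 0 (mem_univ _)).1, (hx.1 0 (mem_univ _)).2⟩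
    · refine fun hx => ⟨fun i _ => ?_, hx.1⟩
      refine Fin.cases ⟨hx.2.1, hx.2.2⟩ (fun i => ?_) i
      exact abs_lt.1 (hΩr x hx.1 i.succ)
  rw [hlhs, Fin.sum_univ_succ, hface, hface] at hdiv
  rw [hdiv, hp0, hq0]
  simp only [hps, hqs, hside _ r (abs_of_pos hr0), hside _ (-r) (by rw [abs_neg, abs_of_pos hr0])]
  simp

/-- The points of the closure near which `P` fails to hold form a compact set. By hypothesis it lies
in `Ω`, so `ρ` has a negative maximum there, and above that maximum `P` must hold. -/
theorem exists_collar (hKU : closure Ω ⊆ U) (hK : IsCompact (closure Ω)) (hρ : ContinuousOn ρ U)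
    (hρΩ : ∀ x ∈ U, 0 ≤ x 0 → (x ∈ Ω ↔ ρ x < 0)) {P : Pt → Prop}
    (hP : ∀ x ∈ closure (Ω ∩ {y : Pt | 0 ≤ y 0}), x ∉ Ω → ∀ᶠ y in 𝓝 x, P y) :
    ∃ δ > 0, ∀ x ∈ Ω, 0 ≤ x 0 → -δ < ρ x → P x := by
  set A := closure (Ω ∩ {y : Pt | 0 ≤ y 0}) with hA
  have hAK : A ⊆ closure Ω := closure_mono inter_subset_left
  have hA0 : A ⊆ {y : Pt | 0 ≤ y 0} := by
    have hcl : IsClosed {y : Pt | 0 ≤ y 0} := isClosed_le continuous_const (continuous_apply 0)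
    exact (closure_mono inter_subset_right).trans hcl.closure_eq.subset
  set B := A ∩ (interior {x | P x})ᶜ with hB
  have hBc : IsCompact B := (hK.of_isClosed_subset isClosed_closure hAK).inter_right
    isOpen_interior.isClosed_compl
  have hBneg : ∀ x ∈ B, ρ x < 0 := by
    intro x hx
    refine (hρΩ x (hKU (hAK hx.1)) (hA0 hx.1)).1 ?_
    by_contra hxΩ
    exact hx.2 (mem_interior_iff_mem_nhds.2 (hP x hx.1 hxΩ))
  have hin : ∀ x ∈ Ω, 0 ≤ x 0 → x ∉ B → P x := by
    intro x hx hx0 hxB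
    by_contra hPx
    exact hxB ⟨subset_closure ⟨hx, hx0⟩, fun h => hPx (interior_subset h)⟩
  rcases B.eq_empty_or_nonempty with he | hne
  · exact ⟨1, one_pos, fun x hx hx0 _ => hin x hx hx0 (by simp [he])⟩
  · obtain ⟨z, hz, hmax⟩ := hBc.exists_isMaxOn hne (hρ.mono fun x hx => hKU (hAK hx.1))
    refine ⟨-ρ z, by linarith [hBneg z hz], fun x hx hx0 hlt => hin x hx hx0 fun hxB => ?_⟩
    have : ρ x ≤ ρ z := hmax hxB
    linarith

theorem deriv_smoothTransition_nonneg (s : ℝ) : 0 ≤ deriv Real.smoothTransition s :=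
  Real.smoothTransition.monotone.deriv_nonneg

theorem deriv_smoothTransition_eq_zero {s : ℝ} (hs : 1 < s) :
    deriv Real.smoothTransition s = 0 := by
  have : Real.smoothTransition =ᶠ[𝓝 s] fun _ => 1 := by
    filter_upwards [lt_mem_nhds hs] with t ht using Real.smoothTransition.one_of_one_le ht.le
  rw [this.deriv_eq, deriv_const]

/-- The energy inequality: the flux through the future boundary may be dropped. -/
theorem integral_slice_le (hU : IsOpen U) (hΩ : IsOpen Ω) (hK : IsCompact (closure Ω))
    (hKU : closure Ω ⊆ U) (hρ : ContDiffOn ℝ 1 ρ U)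
    (hρΩ : ∀ x ∈ U, 0 ≤ x 0 → (x ∈ Ω ↔ ρ x < 0)) {J : Fin 4 → Pt → ℝ} {G : Pt → ℝ}
    (hJ : ∀ a, ContDiffOn ℝ ∞ (J a) U) (hJ0 : ∀ x ∈ Ω, 0 ≤ J 0 x)
    (hflux : ∀ x ∈ closure (Ω ∩ {y : Pt | 0 ≤ y 0}), x ∉ Ω →
      ∀ᶠ y in 𝓝 x, 0 ≤ ∑ a, J a y * pd a ρ y)
    (hG : ContinuousOn G U) (hG0 : ∀ x ∈ Ω, 0 ≤ G x)
    (hJG : ∀ x ∈ Ω, ∑ a, pd a (J a) x ≤ G x) (hτ : 0 ≤ τ) :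
    ∫ y in slice Ω τ, J 0 (atTime τ y)
      ≤ (∫ y in slice Ω 0, J 0 (atTime 0 y)) + ∫ x in slab Ω τ, G x := by
  obtain ⟨δ, hδ, hcol⟩ := exists_collar hKU hK hρ.continuousOn hρΩ hflux
  have hΩU : ∀ x ∈ Ω, x ∈ U := fun x hx => hKU (subset_closure hx)
  -- The cutoff is `0` where `ρ ≥ -1/n` and `1` where `ρ ≤ -2/n`.
  set χ : ℝ → Pt → ℝ := fun n x => Real.smoothTransition (-(n * ρ x) - 1) with hχ
  have hχ1 : ∀ n x, χ n x ≤ 1 := fun n x => Real.smoothTransition.le_one _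
  have hχ0 : ∀ n x, 0 ≤ χ n x := fun n x => Real.smoothTransition.nonneg _
  have hχd : ∀ n, ContDiffOn ℝ 1 (χ n) U := fun n =>
    (Real.smoothTransition.contDiff (n := 1)).comp_contDiffOn
      ((contDiffOn_const.mul hρ).neg.sub contDiffOn_const)
  have hJ1 : ∀ a, ContDiffOn ℝ 1 (J a) U := fun a => (hJ a).of_le (by simp)
  have hpdχ : ∀ n a, ∀ x ∈ U, pd a (χ n) x
      = -(n * deriv Real.smoothTransition (-(n * ρ x) - 1)) * pd a ρ x := by
    intro n a x hx
    have h1 : HasFDerivAt ρ (fderiv ℝ ρ x) x :=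
      ((hρ.contDiffAt (hU.mem_nhds hx)).differentiableAt (by simp)).hasFDerivAt
    have h2 : HasFDerivAt (fun y => -(n * ρ y) - 1) (-(n • fderiv ℝ ρ x)) x :=
      ((h1.const_mul n).fun_neg).sub_const 1
    have h3 : HasDerivAt Real.smoothTransition (deriv Real.smoothTransition (-(n * ρ x) - 1))
        (-(n * ρ x) - 1) :=
      ((Real.smoothTransition.contDiff (n := 1)).differentiable (by simp) _).hasDerivAt
    have h4 := h3.comp_hasFDerivAt x h2
    rw [show χ n = Real.smoothTransition ∘ fun y => -(n * ρ y) - 1 from rfl,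
      pd_of_hasFDerivAt h4]
    simp [pd]
    ring
  -- For `n > 2/δ` the gradient of the cutoff lives in the collar where the flux is nonnegative.
  -- Since `∂χ` is a nonpositive multiple of `∂ρ`, its contribution, although of size `n`, has the
  -- sign that allows it to be dropped.
  have key : ∀ n : ℝ, 2 / δ < n → ∫ y in slice Ω τ, χ n (atTime τ y) * J 0 (atTime τ y)
      ≤ (∫ y in slice Ω 0, J 0 (atTime 0 y)) + ∫ x in slab Ω τ, G x := by
    intro n hn
    have hn0 : 0 < n := lt_trans (by positivity) hn
    have hθd : ∀ a, ContDiffOn ℝ 1 (fun x => χ n x * J a x) U := fun a => (hχd n).mul (hJ1 a)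
    have hdiv := integral_divergence_cutoff hU hΩ hK hKU hρ.continuousOn hρΩ
      (c := 1 / n) (by positivity) (θ := fun a x => χ n x * J a x) hθd
      (fun a x _ hx => by
        have : χ n x = 0 := by
          refine Real.smoothTransition.zero_of_nonpos ?_
          have h1 : n * -(1 / n) < n * ρ x := mul_lt_mul_of_pos_left hx hn0
          have h2 : n * -(1 / n) = -1 := by field_simp
          linarith
        simp only [this, zero_mul]) hτ
    have hpdc : ∀ a, ContinuousOn (pd a fun x => χ n x * J a x) U := fun a =>
      ((hθd a).continuousOn_fderiv_of_isOpen hU le_rfl).clm_apply continuousOn_const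
    have h1 : ∫ x in slab Ω τ, ∑ a, pd a (fun x => χ n x * J a x) x ≤ ∫ x in slab Ω τ, G x := by
      refine setIntegral_mono_on (integrableOn_slab hK hKU
        (continuousOn_finsetSum _ fun a _ => hpdc a) τ) (integrableOn_slab hK hKU hG τ)
        (isOpen_slab hΩ τ).measurableSet fun x hx => ?_
      have hxU := hΩU x hx.1
      have e1 : ∑ a, pd a (fun x => χ n x * J a x) x = χ n x * (∑ a, pd a (J a) x)
          - n * deriv Real.smoothTransition (-(n * ρ x) - 1) * ∑ a, J a x * pd a ρ x := by
        simp only [Finset.mul_sum, ← Finset.sum_sub_distrib]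
        refine Finset.sum_congr rfl fun a _ => ?_
        rw [pd_mul (((hχd n).contDiffAt (hU.mem_nhds hxU)).differentiableAt (by simp))
          (differentiableAt_of_smooth hU (hJ a) hxU), hpdχ n a x hxU]
        ring
      have e2 : 0 ≤ n * deriv Real.smoothTransition (-(n * ρ x) - 1) * ∑ a, J a x * pd a ρ x := by
        by_cases hs : 1 < -(n * ρ x) - 1
        · rw [deriv_smoothTransition_eq_zero hs]; simp
        · refine mul_nonneg (mul_nonneg hn0.le (deriv_smoothTransition_nonneg _)) ?_
          refine hcol x hx.1 hx.2.1.le ?_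
          have h2 : 2 < n * δ := by rwa [div_lt_iff₀ hδ] at hn
          by_contra hcon
          have := mul_le_mul_of_nonneg_left (not_lt.1 hcon) hn0.le
          linarith
      have e3 : χ n x * (∑ a, pd a (J a) x) ≤ G x := by
        calc _ ≤ χ n x * G x := mul_le_mul_of_nonneg_left (hJG x hx.1) (hχ0 n x)
          _ ≤ 1 * G x := mul_le_mul_of_nonneg_right (hχ1 n x) (hG0 x hx.1)
          _ = G x := one_mul _
      linarith
    have h2 : ∫ y in slice Ω 0, χ n (atTime 0 y) * J 0 (atTime 0 y)
        ≤ ∫ y in slice Ω 0, J 0 (atTime 0 y) := by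
      refine setIntegral_mono_on (integrableOn_slice hK hKU (hθd 0).continuousOn 0)
        (integrableOn_slice hK hKU (hJ 0).continuousOn 0) (isOpen_slice hΩ 0).measurableSet
        fun y hy => ?_
      exact mul_le_of_le_one_left (hJ0 _ hy) (hχ1 _ _)
    linarith
  -- Every point of the slice has `ρ < 0`, so the cutoff is eventually `1` there; dominated
  -- convergence restores the full integral.
  have hlim : Tendsto (fun n : ℕ => ∫ y in slice Ω τ, χ n (atTime τ y) * J 0 (atTime τ y)) atTop
      (𝓝 (∫ y in slice Ω τ, J 0 (atTime τ y))) := by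
    refine tendsto_integral_of_dominated_convergence (fun y => |J 0 (atTime τ y)|)
      (fun n => (integrableOn_slice hK hKU ((hχd n).mul (hJ1 0)).continuousOn
        τ).aestronglyMeasurable)
      (integrableOn_slice hK hKU (hJ 0).continuousOn τ).abs ?_ ?_
    · intro n
      refine Eventually.of_forall fun y => ?_
      rw [Real.norm_eq_abs, abs_mul, abs_of_nonneg (hχ0 _ _)]
      exact mul_le_of_le_one_left (abs_nonneg _) (hχ1 _ _)
    · refine (ae_restrict_iff' (isOpen_slice hΩ τ).measurableSet).2
        (Eventually.of_forall fun y hy => ?_)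
      have hneg : ρ (atTime τ y) < 0 := (hρΩ _ (hΩU _ hy) hτ).1 hy
      refine tendsto_const_nhds.congr' ?_
      have h1 : ∀ᶠ n : ℕ in atTop, 2 / -ρ (atTime τ y) < n :=
        (tendsto_natCast_atTop_atTop (R := ℝ)).eventually (eventually_gt_atTop _)
      filter_upwards [h1] with n hn
      rw [div_lt_iff₀ (by linarith)] at hn
      have : χ n (atTime τ y) = 1 := Real.smoothTransition.one_of_one_le (by linarith)
      rw [this, one_mul]
  refine le_of_tendsto hlim ?_
  filter_upwards [(tendsto_natCast_atTop_atTop (R := ℝ)).eventually (eventually_gt_atTop (2 / δ))]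
    with n hn using key n hn

end DivergenceTheorem

/-! ### Energies and Sobolev norms as integrals of densities -/

section Energies

open MeasureTheory Set Filter

variable {U Ω : Set Pt} {g : MetricField} {u f : Pt → ℝ} {τ : ℝ}

theorem smooth_contr {k : ℕ} {m : Pt → Fin k → Matrix (Fin 4) (Fin 4) ℝ} {S T : Pt → Tens k}
    (hm : ∀ i p q, ContDiffOn ℝ ∞ (fun x => m x i p q) U)
    (hS : ∀ I, ContDiffOn ℝ ∞ (fun x => S x I) U) (hT : ∀ I, ContDiffOn ℝ ∞ (fun x => T x I) U) :
    ContDiffOn ℝ ∞ (fun x => contr (m x) (S x) (T x)) U :=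
  ContDiffOn.sum fun I _ => ContDiffOn.sum fun J _ =>
    ((contDiffOn_prod fun i _ => hm i (I i) (J i)).mul (hS I)).mul (hT J)

theorem smooth_normCovSq (hU : IsOpen U) (hm : IsTimeMetric U g) (hf : ContDiffOn ℝ ∞ f U)
    (j : ℕ) : ContDiffOn ℝ ∞ (normCovSq g f j) U :=
  smooth_contr (fun _ p q => hm.smooth_riem_inv p q) (smooth_iterCov hU hm hf j)
    (smooth_iterCov hU hm hf j)

theorem smooth_current (hU : IsOpen U) (hm : IsTimeMetric U g) (hu : ContDiffOn ℝ ∞ u U)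
    (j : ℕ) (a : Fin 4) : ContDiffOn ℝ ∞ (current g u j a) U := by
  cases j with
  | zero => exact (contDiffOn_const.mul (hm.smooth_xiHat a)).mul (hu.pow 2)
  | succ j =>
    refine smooth_contr (fun i p q => ?_) (smooth_iterCov hU hm hu _) (smooth_iterCov hU hm hu _)
    refine Fin.cases ?_ (fun i => ?_) i
    · exact ((hm.smooth_inv a p).mul (hm.smooth_xiHat q)).neg.add
        ((contDiffOn_const.mul (hm.smooth_xiHat a)).mul (hm.smooth_inv p q))
    · exact hm.smooth_riem_inv p q

theorem smooth_energyDensity (hU : IsOpen U) (hm : IsTimeMetric U g) (hu : ContDiffOn ℝ ∞ u U)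
    (j : ℕ) : ContDiffOn ℝ ∞ (energyDensity g u j) U :=
  ContDiffOn.sum fun i _ => smooth_current hU hm hu i 0

theorem energyDensity_nonneg (hm : IsTimeMetric U g) {x : Pt} (hx : x ∈ U) (j : ℕ) :
    0 ≤ energyDensity g u j x :=
  Finset.sum_nonneg fun i _ => current_zero_nonneg hm hx i

theorem energy_eq_integral (hU : IsOpen U) (hΩ : IsOpen Ω) (hK : IsCompact (closure Ω))
    (hKU : closure Ω ⊆ U) (hm : IsTimeMetric U g) (hu : ContDiffOn ℝ ∞ u U) (k : ℕ) (τ : ℝ) :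
    energy g Ω k τ u
      = ∫ y in slice Ω τ, volDensity g (atTime τ y) * energyDensity g u k (atTime τ y) := by
  have h1 : ∀ y ∈ slice Ω τ, volDensity g (atTime τ y) * energyDensity g u k (atTime τ y)
      = ∑ j ∈ Finset.range (k + 1),
        current g u j 0 (atTime τ y) * volDensity g (atTime τ y) := fun y _ => by
    rw [energyDensity, Finset.mul_sum]
    exact Finset.sum_congr rfl fun _ _ => mul_comm _ _
  rw [setIntegral_congr_fun (isOpen_slice hΩ τ).measurableSet h1,
    integral_finsetSum _ fun j _ => integrableOn_slice (f := fun x =>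
      current g u j 0 x * volDensity g x) hK hKU
      ((smooth_current hU hm hu j 0).mul hm.smooth_volDensity).continuousOn τ]
  refine Finset.sum_congr rfl fun j _ => setIntegral_congr_fun (isOpen_slice hΩ τ).measurableSet ?_
  intro y hy
  simp only [energyTensor_eq_current hm (hKU (subset_closure hy)) j]

theorem sobolevNorm_sq (hΩ : IsOpen Ω) (hKU : closure Ω ⊆ U) (hm : IsTimeMetric U g)
    (k : ℕ) (τ : ℝ) :
    sobolevNorm g Ω k τ f ^ 2
      = ∑ j ∈ Finset.range (k + 1), ∫ x in slab Ω τ, normCovSq g f j x * volDensity g x :=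
  Real.sq_sqrt <| Finset.sum_nonneg fun j _ =>
    setIntegral_nonneg (isOpen_slab hΩ τ).measurableSet fun x hx =>
      have hxU : x ∈ U := hKU (subset_closure hx.1)
      mul_nonneg (normCovSq_nonneg hm hxU j) (hm.volDensity_pos hxU).le

theorem integral_slab_energyDensity (hU : IsOpen U) (hΩ : IsOpen Ω) (hK : IsCompact (closure Ω))
    (hKU : closure Ω ⊆ U) (hm : IsTimeMetric U g) (hu : ContDiffOn ℝ ∞ u U) (k : ℕ)
    (hτ : 0 ≤ τ) :
    ∫ x in slab Ω τ, volDensity g x * energyDensity g u k x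
      = ∫ ζ in (0 : ℝ)..τ, energy g Ω k ζ u := by
  rw [integral_slab hΩ hK hKU
    (hm.smooth_volDensity.mul (smooth_energyDensity hU hm hu k)).continuousOn hτ]
  exact intervalIntegral.integral_congr fun t _ =>
    (energy_eq_integral hU hΩ hK hKU hm hu k t).symm

/-- A conormal which is timelike and future directed at a point remains so nearby. -/
theorem eventually_flux_nonneg (hU : IsOpen U) (hm : IsTimeMetric U g) {ρ : Pt → ℝ}
    (hρ : ContDiffOn ℝ 1 ρ U) {x : Pt} (hx : x ∈ U)
    (hr : ∑ a, ∑ b, (g x)⁻¹ a b * pd a ρ x * pd b ρ x < 0)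
    (hrn : 0 < ∑ a, xi g x a * pd a ρ x) (k : ℕ) :
    ∀ᶠ y in 𝓝 x, 0 ≤ ∑ a, (volDensity g y * ∑ j ∈ Finset.range k, current g u j a y) * pd a ρ y := by
  have hd : ∀ a, ContinuousOn (pd a ρ) U := fun a =>
    (hρ.continuousOn_fderiv_of_isOpen hU le_rfl).clm_apply continuousOn_const
  have c1 : ContinuousAt (fun y => ∑ a, ∑ b, (g y)⁻¹ a b * pd a ρ y * pd b ρ y) x :=
    (continuousOn_finsetSum _ fun a _ => continuousOn_finsetSum _ fun b _ =>
      ((hm.smooth_inv a b).continuousOn.mul (hd a)).mul (hd b)).continuousAt (hU.mem_nhds hx)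
  have c2 : ContinuousAt (fun y => ∑ a, xi g y a * pd a ρ y) x :=
    (continuousOn_finsetSum _ fun a _ =>
      (hm.smooth_xi a).continuousOn.mul (hd a)).continuousAt (hU.mem_nhds hx)
  filter_upwards [hU.mem_nhds hx, c1.eventually_lt_const hr, c2.eventually_const_lt hrn]
    with y hy h1 h2
  have e : ∑ a, (volDensity g y * ∑ j ∈ Finset.range k, current g u j a y) * pd a ρ y
      = volDensity g y * ∑ j ∈ Finset.range k, ∑ a, current g u j a y * pd a ρ y := by
    rw [Finset.sum_comm, Finset.mul_sum]
    exact Finset.sum_congr rfl fun a _ => by rw [← Finset.sum_mul, mul_assoc]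
  rw [e]
  exact mul_nonneg (hm.volDensity_pos hy).le
    (Finset.sum_nonneg fun j _ => current_flux_nonneg hm hy h1 h2 j)

theorem sum_pd_volDensity_mul_sum_current (hU : IsOpen U) (hm : IsTimeMetric U g)
    (hu : ContDiffOn ℝ ∞ u U) {x : Pt} (hx : x ∈ U) (k : ℕ) :
    ∑ a, pd a (fun y => volDensity g y * ∑ j ∈ Finset.range k, current g u j a y) x
      = volDensity g x * ∑ j ∈ Finset.range k, divCurrent g u j x := by
  have hd : ∀ j a, DifferentiableAt ℝ (current g u j a) x := fun j a =>
    differentiableAt_of_smooth hU (smooth_current hU hm hu j a) hx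
  rw [hm.sum_pd_volDensity_mul hU hx (X := fun a y => ∑ j ∈ Finset.range k, current g u j a y)
    fun a => DifferentiableAt.fun_sum fun j _ => hd j a]
  simp only [divCurrent]
  rw [Finset.sum_comm]
  congr 1
  refine Finset.sum_congr rfl fun a _ => ?_
  rw [pd_sum fun j _ => hd j a, Finset.sum_add_distrib, Finset.mul_sum]

/-- The energy inequality for a single metric, given a bound for the divergence of the energy
current. -/
theorem energy_le_of_divCurrent_le (hU : IsOpen U) (hΩ : IsOpen Ω) (hK : IsCompact (closure Ω))
    (hKU : closure Ω ⊆ U) (hm : IsTimeMetric U g) {ρ : Pt → ℝ} (hρ : ContDiffOn ℝ 1 ρ U)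
    (hρΩ : ∀ x ∈ U, 0 ≤ x 0 → (x ∈ Ω ↔ ρ x < 0))
    (hs : ∀ x ∈ closure (Ω ∩ {y : Pt | 0 ≤ y 0}), x ∉ Ω →
      (∑ a : Fin 4, ∑ b : Fin 4, (g x)⁻¹ a b * pd a ρ x * pd b ρ x) < 0 ∧
      0 < ∑ a : Fin 4, xi g x a * pd a ρ x)
    (hu : ContDiffOn ℝ ∞ u U) (hf : ContDiffOn ℝ ∞ f U) {k : ℕ} {C : ℝ} (hC : 0 ≤ C)
    {s : Finset ℕ} {w : ℕ → ℝ} (hw : ∀ l ∈ s, 0 ≤ w l)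
    (hdiv : ∀ x ∈ closure Ω, ∑ j ∈ Finset.range (k + 2), divCurrent g u j x
      ≤ C * ((∑ i ∈ Finset.range (k + 1), normCovSq g f i x)
        + (∑ l ∈ s, w l * energyDensity g u l x) + energyDensity g u (k + 1) x))
    (hτ : 0 ≤ τ) :
    energy g Ω (k + 1) τ u ≤ energy g Ω (k + 1) 0 u + C * sobolevNorm g Ω k τ f ^ 2
      + C * (∑ l ∈ s, w l * ∫ ζ in (0 : ℝ)..τ, energy g Ω l ζ u)
      + C * ∫ ζ in (0 : ℝ)..τ, energy g Ω (k + 1) ζ u := by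
  have hΩU : ∀ {x}, x ∈ Ω → x ∈ U := fun hx => hKU (subset_closure hx)
  have hcN : ∀ i, ContinuousOn (fun x => normCovSq g f i x * volDensity g x) U := fun i =>
    ((smooth_normCovSq hU hm hf i).mul hm.smooth_volDensity).continuousOn
  have hcE : ∀ l, ContinuousOn (fun x => volDensity g x * energyDensity g u l x) U := fun l =>
    (hm.smooth_volDensity.mul (smooth_energyDensity hU hm hu l)).continuousOn
  set G : Pt → ℝ := fun x => C * ((∑ i ∈ Finset.range (k + 1), normCovSq g f i x * volDensity g x)
    + (∑ l ∈ s, w l * (volDensity g x * energyDensity g u l x))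
    + volDensity g x * energyDensity g u (k + 1) x) with hG
  -- The volume density factors out of the majorant, so the pointwise bound on the divergence can be
  -- multiplied by it.
  have hGe : ∀ x, G x = volDensity g x * (C * ((∑ i ∈ Finset.range (k + 1), normCovSq g f i x)
        + (∑ l ∈ s, w l * energyDensity g u l x) + energyDensity g u (k + 1) x)) := by
    intro x
    simp only [hG, ← Finset.sum_mul, mul_left_comm (w _), ← Finset.mul_sum]
    ring
  have hGc : ContinuousOn G U := continuousOn_const.mul
    (((continuousOn_finsetSum _ fun i _ => hcN i).add (continuousOn_finsetSum _ fun l _ =>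
      continuousOn_const.mul (hcE l))).add (hcE _))
  have main := integral_slice_le hU hΩ hK hKU hρ hρΩ
    (J := fun a y => volDensity g y * ∑ j ∈ Finset.range (k + 2), current g u j a y) (G := G)
    (fun a => hm.smooth_volDensity.mul (ContDiffOn.sum fun j _ => smooth_current hU hm hu j a))
    (fun x hx => mul_nonneg (hm.volDensity_pos (hΩU hx)).le
      (energyDensity_nonneg hm (hΩU hx) (k + 1)))
    (fun x hx hxΩ => eventually_flux_nonneg hU hm hρ (hKU (closure_mono inter_subset_left hx))
      (hs x hx hxΩ).1 (hs x hx hxΩ).2 _)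
    hGc
    (fun x hx => by
      rw [hGe]
      refine mul_nonneg (hm.volDensity_pos (hΩU hx)).le (mul_nonneg hC (add_nonneg (add_nonneg ?_ ?_)
        (energyDensity_nonneg hm (hΩU hx) _)))
      · exact Finset.sum_nonneg fun i _ => normCovSq_nonneg hm (hΩU hx) i
      · exact Finset.sum_nonneg fun l hl =>
          mul_nonneg (hw l hl) (energyDensity_nonneg hm (hΩU hx) l))
    (fun x hx => by
      rw [sum_pd_volDensity_mul_sum_current hU hm hu (hΩU hx), hGe]
      exact mul_le_mul_of_nonneg_left (hdiv x (subset_closure hx)) (hm.volDensity_pos (hΩU hx)).le)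
    hτ
  have hiN : ∀ i, IntegrableOn (fun x => normCovSq g f i x * volDensity g x) (slab Ω τ) :=
    fun i => integrableOn_slab hK hKU (hcN i) τ
  have hiE : ∀ l, IntegrableOn (fun x => volDensity g x * energyDensity g u l x) (slab Ω τ) :=
    fun l => integrableOn_slab hK hKU (hcE l) τ
  have hsN : IntegrableOn (fun x => ∑ i ∈ Finset.range (k + 1), normCovSq g f i x * volDensity g x)
      (slab Ω τ) := integrable_finsetSum _ fun i _ => hiN i
  have hsE : IntegrableOn (fun x => ∑ l ∈ s, w l * (volDensity g x * energyDensity g u l x))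
      (slab Ω τ) := integrable_finsetSum _ fun l _ => (hiE l).const_mul _
  have hsNE : IntegrableOn
      (fun x => (∑ i ∈ Finset.range (k + 1), normCovSq g f i x * volDensity g x)
        + ∑ l ∈ s, w l * (volDensity g x * energyDensity g u l x)) (slab Ω τ) := hsN.add hsE
  have hGi : ∫ x in slab Ω τ, G x = C * (sobolevNorm g Ω k τ f ^ 2
      + (∑ l ∈ s, w l * ∫ ζ in (0 : ℝ)..τ, energy g Ω l ζ u)
      + ∫ ζ in (0 : ℝ)..τ, energy g Ω (k + 1) ζ u) := by
    rw [hG, integral_const_mul, integral_add hsNE (hiE _), integral_add hsN hsE,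
      integral_finsetSum _ fun i _ => hiN i, integral_finsetSum _ fun l _ => (hiE l).const_mul _,
      sobolevNorm_sq hΩ hKU hm]
    simp only [integral_const_mul, integral_slab_energyDensity hU hΩ hK hKU hm hu _ hτ]
  have e1 := energy_eq_integral hU hΩ hK hKU hm hu (k + 1)
  rw [hGi] at main
  rw [e1 τ, e1 0]
  refine main.trans (le_of_eq ?_)
  simp only [energyDensity]
  ring

end Energies

end

end SingularWave

/-! ### The energy inequality with constants uniform in `ε` -/

theorem proposition1 (U : Set Pt) (hU : IsOpen U) (g : ℝ → MetricField)
    (hg : IsWeaklySingular U g) (Ω : Set Pt) (hΩ : IsAdmissibleRegion U g Ω)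
    (γ : ℝ) (hγ : 0 < γ) (k : ℕ) (hk : 1 ≤ k) :
    ∃ C₁ C₂ C₃ ε₀ : ℝ, 0 < C₁ ∧ 0 < C₂ ∧ 0 < C₃ ∧ 0 < ε₀ ∧ ε₀ ≤ 1 ∧
      ∀ ε : ℝ, 0 < ε → ε < ε₀ →
      ∀ u f : Pt → ℝ, ContDiffOn ℝ ∞ u U → ContDiffOn ℝ ∞ f U →
        (∀ x ∈ U, box (g ε) u x = f x) →
      ∀ τ : ℝ, 0 ≤ τ → τ ≤ γ →
        energy (g ε) Ω k τ u ≤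
          energy (g ε) Ω k 0 u
          + C₁ * (sobolevNorm (g ε) Ω (k - 1) τ f) ^ 2
          + C₂ * (∑ j ∈ Finset.Icc 1 (k - 1),
              (1 / ε ^ (2 * (1 + k - j))) * (∫ ζ in (0 : ℝ)..τ, energy (g ε) Ω j ζ u))
          + C₃ * (∫ ζ in (0 : ℝ)..τ, energy (g ε) Ω k ζ u) := by
  obtain ⟨ρ, hρ, hρΩ, hs⟩ := hΩ.spacelike_boundary
  obtain ⟨k, rfl⟩ : ∃ m, k = m + 1 := ⟨k - 1, by omega⟩
  obtain ⟨C, hC, hdiv⟩ := exists_sum_divCurrent_le hU hg hΩ.compact_closure hΩ.closure_subset hk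
  -- The spacelike boundary, the divergence bound on the closure of `Ω` and the time metric property
  -- hold for all small `ε`, hence on a common interval `(0, ε₁)`. The single constant of the
  -- divergence bound serves as all three constants.
  obtain ⟨ε₁, hε₁, hsub⟩ := mem_nhdsGT_iff_exists_Ioo_subset.1
    (hs.and (hdiv.and hg.eventually_isTimeMetric))
  refine ⟨C, C, C, min ε₁ 1, hC, hC, hC, lt_min hε₁ one_pos, min_le_right _ _, ?_⟩
  intro ε hε hεlt u f hu hf hbox τ hτ _
  obtain ⟨hsε, hdivε, hm⟩ := hsub ⟨hε, hεlt.trans_le (min_le_left _ _)⟩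
  exact energy_le_of_divCurrent_le hU hΩ.isOpen hΩ.compact_closure hΩ.closure_subset hm hρ hρΩ hsε
    hu hf hC.le (fun l _ => by positivity) (hdivε u f hu hbox) hτ
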